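/- **Setting.** Let $-1<q<1$, let $\mathcal H_{\mathbb R}$ be a real Hilbert space with $\dim\mathcal H_{\mathbb R}\ge 2$, let $\mathcal H$ be its complexification, and let $\mathcal F_q$ be the $q$-Fock space of $\mathcal H_{\mathbb R}$, i.e. the completion of $\bigoplus_{n\ge 0}\mathcal H^{\otimes n}$ for the inner product $$\langle f_1\otimes\cdots\otimes f_n,\ g_1\otimes\cdots\otimes g_m\rangle_q=\delta_{n,m}\sum_{\sigma\in S_n}q^{|\sigma|}\prod_{i=1}^n\langle f_i,g_{\sigma(i)}\rangle ,$$ where $|\sigma|$ is the number of inversions of $\sigma$. Let $\Omega$ be the vacuum vector, let $c(h)$ and $c_r(h)$ be the left and right creation operators of $h\in\mathcal H_{\mathbb R}$, let $a(h)=c(h)^*$, $a_r(h)=c_r(h)^*$, and $s(h)=c(h)+a(h)$. Let $M$ be the von Neumann algebra generated by all $s(h)$, $h\in\mathcal H_{\mathbb R}$; write $\tau(x)=\langle x\Omega,\Omega\rangle$, $\|x\|_2=\|x\Omega\|$, and identify $L^2(M)$ with $\mathcal F_q$ through $x\mapsto x\Omega$. Fix a unit vector $e\in\mathcal H_{\mathbb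 R}$ and let $A\subset M$ be the von Neumann subalgebra generated by $s(e)$; then $L^2(A)$ is the closed span $\mathcal F_q(\mathbb Re)$ of $\{e^{\otimes n}:n\ge 0\}$. For $k\ge 0$ let $T^k=\{\xi\in\mathcal H^{\otimes k}:a(e)\xi=a_r(e)\xi=0\}$ (with $\mathcal H^{\otimes k}$ the closed $k$-particle subspace of $\mathcal F_q$) and $\xi_{r,s}=e^{\otimes r}\otimes\xi\otimes e^{\otimes s}$ for $\xi\in T^k$, $r,s\ge 0$. Choose an orthonormal basis of each $T^k$, $k\ge 1$, and let $(\xi^i)_{i\in I}$ be the union of these bases. Let $[n]_q!=\prod_{k=1}^n\frac{1-q^k}{1-q}$. Call $q$ *admissible* (for these data) if 1. $\tfrac12[r+s]_q!\le\|\xi_{r,s}\|^2\le 2[r+s]_q!$ for all $k,r,s\ge 0$ and all $\xi\in T^k$ with $\|\xi\|=1$, and 2. the vectors $\xi^i_{r,s}/\|\xi^i_{r,s}\|$ ($i\in I$, $r,s\ge 0$) form a Riesz basis of $L^2(M)\ominus L^2(A)$: their span is dense in it, and there are $A_q,B_q>0$ with $A_q\sum|\lambda^i_{r,s}|^2\|\xi^i_{r,s}\|^2\le\|\sum\lambda^i_{r,s}\xi^i_{r,s}\|^2\le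 B_q\sum|\lambda^i_{r,s}|^2\|\xi^i_{r,s}\|^2$ for all finitely supported families of complex numbers $\lambda^i_{r,s}$. **Theorem.** (a) There is $q_0>0$ such that every $q\in(-1,1)$ with $|q|<q_0$ is admissible, for all $\mathcal H_{\mathbb R}$, all $e$ and all choices of the orthonormal bases. (b) Suppose that $q$ is admissible. Then for every integer $N\ge 0$ there are unique bounded operators $L_N,R_N$ on $L^2(M)$ that vanish on $L^2(A)$ and satisfy $$L_N\xi^i_{r,s}=\begin{cases}\xi^i_{r,s}&r\le N\\0&r>N\end{cases},\qquad R_N\xi^i_{r,s}=\begin{cases}\xi^i_{r,s}&s\le N\\0&s>N\end{cases}\qquad(i\in I,\ r,s\ge 0).$$ Let $\omega$ be a free ultrafilter on $\mathbb N$, let $C\subset A$ be a diffuse von Neumann subalgebra (with the unit of $A$), and let $z=(z_n)_n\in(M^\omega\ominus A^\omega)\cap C'$; that is, $(z_n)$ is a sequence in $M$ that is bounded in operator norm, $\lim_{n\to\omega}\tau(a_n^*z_n)=0$ for every sequence $(a_n)$ in $A$ that is bounded in operator norm, and $\lim_{n\to\omega}\|z_nc-cz_n\|_2=0$ for every $c\in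 C$. Then for every $N\ge 0$ $$\lim_{n\to\omega}\|L_N(z_n)\|_2=\lim_{n\to\omega}\|R_N(z_n)\|_2=0,$$ where $L_N(z_n)$ and $R_N(z_n)$ mean $L_N(z_n\Omega)$ and $R_N(z_n\Omega)$. -/

import Mathlib

open Filter Topology
open scoped InnerProductSpace ComplexConjugate

noncomputable section
namespace QGaussian

/-- The number of inversions of a permutation of `{0, …, n - 1}`. -/
def inversions {n : ℕ} (σ : Equiv.Perm (Fin n)) : ℕ :=
  (Finset.univ.filter fun p : Fin n × Fin n => p.1 < p.2 ∧ σ p.2 < σ p.1).card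

theorem inversions_eq_sum {n : ℕ} (σ : Equiv.Perm (Fin n)) :
    inversions σ = ∑ i, ∑ k, if i < k ∧ σ k < σ i then 1 else 0 := by
  rw [inversions, Finset.card_filter, ← Finset.univ_product_univ, Finset.sum_product]

theorem inversions_mul_inv {n : ℕ} (σ τ : Equiv.Perm (Fin n)) :
    inversions (τ * σ⁻¹) = ∑ a, ∑ b, if σ a < σ b ∧ τ b < τ a then 1 else 0 := by
  rw [inversions_eq_sum, ← Equiv.sum_comp σ]
  refine Finset.sum_congr rfl fun a _ => ?_
  rw [← Equiv.sum_comp σ]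
  simp

theorem inversions_mul_inv' {n : ℕ} (σ τ : Equiv.Perm (Fin n)) :
    inversions (τ * σ⁻¹) =
      ∑ p ∈ Finset.univ.filter (fun p : Fin n × Fin n => p.1 < p.2),
        if (σ p.1 < σ p.2 ↔ τ p.1 < τ p.2) then 0 else 1 := by
  have h1 : inversions (τ * σ⁻¹) = ∑ p : Fin n × Fin n,
      if σ p.1 < σ p.2 ∧ τ p.2 < τ p.1 then 1 else 0 := by
    rw [inversions_mul_inv, ← Finset.univ_product_univ, Finset.sum_product]
  have h2 : ∀ p : Fin n × Fin n, (if σ p.1 < σ p.2 ∧ τ p.2 < τ p.1 then 1 else 0 : ℕ) =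
      (if p.1 < p.2 then (if σ p.1 < σ p.2 ∧ τ p.2 < τ p.1 then 1 else 0) else 0) +
      (if p.2 < p.1 then (if σ p.1 < σ p.2 ∧ τ p.2 < τ p.1 then 1 else 0) else 0) := by
    intro p
    rcases lt_trichotomy p.1 p.2 with h | h | h
    · simp [h, h.not_gt]
    · simp [h]
    · simp [h, h.not_gt]
  have h3 : ∑ p : Fin n × Fin n,
      (if p.2 < p.1 then (if σ p.1 < σ p.2 ∧ τ p.2 < τ p.1 then 1 else 0) else 0 : ℕ) =
      ∑ p : Fin n × Fin n,
      (if p.1 < p.2 then (if σ p.2 < σ p.1 ∧ τ p.1 < τ p.2 then 1 else 0) else 0 : ℕ) :=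
    (Equiv.sum_comp (Equiv.prodComm (Fin n) (Fin n)) _).symm
  rw [h1, Finset.sum_congr rfl fun p _ => h2 p, Finset.sum_add_distrib, h3,
    ← Finset.sum_add_distrib, Finset.sum_filter]
  refine Finset.sum_congr rfl fun p _ => ?_
  by_cases hp : p.1 < p.2
  · have hs : σ p.1 ≠ σ p.2 := fun h => hp.ne (σ.injective h)
    have ht : τ p.1 ≠ τ p.2 := fun h => hp.ne (τ.injective h)
    rcases lt_or_gt_of_ne hs with h | h <;> rcases lt_or_gt_of_ne ht with h' | h' <;>
      simp [hp, h, h', h.not_gt, h'.not_gt]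
  · simp [hp]

theorem inversions_inv {n : ℕ} (σ : Equiv.Perm (Fin n)) : inversions σ⁻¹ = inversions σ := by
  have h1 := inversions_mul_inv' σ 1
  have h2 := inversions_mul_inv' 1 σ
  simp only [one_mul, inv_one, mul_one] at h1 h2
  rw [h1, h2]
  refine Finset.sum_congr rfl fun p _ => ?_
  simp only [iff_comm]

/-- The permutation sending `0` to `p.1` and `i + 1` to the image of `i` under `p.2`, followed by
the increasing map that skips `p.1`. -/
def consPerm {n : ℕ} (p : Fin (n + 1) × Equiv.Perm (Fin n)) : Equiv.Perm (Fin (n + 1)) :=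
  (finSuccEquiv' 0).trans ((Equiv.optionCongr p.2).trans (finSuccEquiv' p.1).symm)

theorem consPerm_zero {n : ℕ} (p : Fin (n + 1) × Equiv.Perm (Fin n)) : consPerm p 0 = p.1 := by
  simp [consPerm]

theorem consPerm_succ {n : ℕ} (p : Fin (n + 1) × Equiv.Perm (Fin n)) (i : Fin n) :
    consPerm p i.succ = p.1.succAbove (p.2 i) := by
  have : finSuccEquiv' (0 : Fin (n + 1)) i.succ = some i := by
    simp
  simp [consPerm, this]

theorem consPerm_bijective (n : ℕ) :
    Function.Bijective (consPerm : Fin (n + 1) × Equiv.Perm (Fin n) → _) := by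
  rw [Fintype.bijective_iff_injective_and_card]
  refine ⟨?_, ?_⟩
  · rintro ⟨j, τ⟩ ⟨j', τ'⟩ h
    have h0 : j = j' := by simpa [consPerm_zero] using congrArg (fun s => s 0) h
    subst h0
    congr 1
    ext1 i
    have := congrArg (fun s => s i.succ) h
    simpa [consPerm_succ] using this
  · simp [Fintype.card_perm, Nat.factorial_succ]

theorem inversions_consPerm {n : ℕ} (p : Fin (n + 1) × Equiv.Perm (Fin n)) :
    inversions (consPerm p) = p.1 + inversions p.2 := by
  rw [inversions_eq_sum, inversions_eq_sum, Fin.sum_univ_succ]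
  congr 1
  · rw [Fin.sum_univ_succ]
    simp only [lt_self_iff_false, false_and, if_false, consPerm_zero, consPerm_succ, zero_add,
      Fin.succ_pos, true_and]
    rw [Equiv.sum_comp p.2 (fun k => if p.1.succAbove k < p.1 then 1 else 0),
      ← Finset.card_filter]
    have : (Finset.univ.filter fun k : Fin n => p.1.succAbove k < p.1) =
        Finset.univ.filter fun k : Fin n => (k : ℕ) < p.1 := by
      ext k
      rw [Finset.mem_filter, Finset.mem_filter, Fin.succAbove_lt_iff_castSucc_lt, Fin.lt_def,
        Fin.val_castSucc]
    rw [this, Fin.card_filter_val_lt]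
    exact min_eq_right (Nat.lt_succ_iff.mp p.1.2)
  · refine Finset.sum_congr rfl fun i _ => ?_
    rw [Fin.sum_univ_succ]
    simp [consPerm_succ]

variable {H : Type*} [NormedAddCommGroup H] [InnerProductSpace ℝ H]

/-- A word of length `n` in the letters `H` stands for the elementary tensor of its letters. -/
abbrev Word (H : Type*) : Type _ := Σ n : ℕ, Fin n → H

/-- The `q`-deformed inner product of two elementary tensors of vectors of the real Hilbert space:
it vanishes for different lengths, and for equal lengths it is
`∑_σ q ^ |σ| ∏_i ⟪v_i, w_{σ(i)}⟫`, the sum over all permutations. -/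
def wordInner (q : ℝ) (v w : Word H) : ℝ :=
  if h : v.1 = w.1 then
    ∑ σ : Equiv.Perm (Fin v.1),
      q ^ inversions σ * ∏ i, ⟪v.2 i, w.2 (Fin.cast h (σ i))⟫_ℝ
  else 0

theorem wordInner_mk (q : ℝ) {n : ℕ} (v w : Fin n → H) :
    wordInner q ⟨n, v⟩ ⟨n, w⟩ =
      ∑ σ : Equiv.Perm (Fin n), q ^ inversions σ * ∏ i, ⟪v i, w (σ i)⟫_ℝ := by
  simp [wordInner]

theorem wordInner_of_ne (q : ℝ) {v w : Word H} (h : v.1 ≠ w.1) : wordInner q v w = 0 := by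
  simp [wordInner, h]

theorem wordInner_comm (q : ℝ) (v w : Word H) : wordInner q v w = wordInner q w v := by
  obtain ⟨n, v⟩ := v
  obtain ⟨m, w⟩ := w
  by_cases h : n = m
  · subst h
    rw [wordInner_mk, wordInner_mk, ← Equiv.sum_comp (Equiv.inv _)]
    refine Finset.sum_congr rfl fun σ _ => ?_
    rw [Equiv.inv_apply, inversions_inv, ← Equiv.prod_comp σ]
    simp [real_inner_comm]
  · rw [wordInner_of_ne q h, wordInner_of_ne q (Ne.symm h)]

theorem posSemidef_prod {X ι : Type*} [Fintype X] (s : Finset ι) (A : ι → X → X → ℝ)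
    (hA : ∀ i ∈ s, (Matrix.of (A i)).PosSemidef) :
    (Matrix.of fun x y => ∏ i ∈ s, A i x y).PosSemidef := by
  classical
  induction s using Finset.induction_on with
  | empty =>
    have := Matrix.posSemidef_vecMulVec_self_star (fun _ : X => (1 : ℝ))
    convert this using 1
    ext x y
    simp [Matrix.vecMulVec]
  | insert a s ha ih =>
    have := (hA a (Finset.mem_insert_self a s)).hadamard
      (ih fun i hi => hA i (Finset.mem_insert_of_mem hi))
    have e : (Matrix.of fun x y => ∏ i ∈ insert a s, A i x y) =
        (Matrix.of (A a)).hadamard (Matrix.of fun x y => ∏ i ∈ s, A i x y) := by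
      ext x y
      simp [Finset.prod_insert ha]
    rw [e]
    exact this

theorem posSemidef_sign {X : Type*} [Fintype X] {q : ℝ} (h1 : -1 ≤ q) (h2 : q ≤ 1)
    (P : X → Prop) [DecidablePred P] :
    (Matrix.of fun x y => if (P x ↔ P y) then (1 : ℝ) else q).PosSemidef := by
  have e1 := (Matrix.posSemidef_vecMulVec_self_star (fun _ : X => (1 : ℝ))).smul
    (show 0 ≤ (1 + q) / 2 by linarith)
  have e2 := (Matrix.posSemidef_vecMulVec_self_star (fun x : X => if P x then (1 : ℝ) else -1)).smul
    (show 0 ≤ (1 - q) / 2 by linarith)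
  convert e1.add e2 using 1
  ext x y
  by_cases hx : P x <;> by_cases hy : P y <;> simp [Matrix.vecMulVec, hx, hy] <;> ring

theorem wordInner_nonneg_aux {q : ℝ} (h1 : -1 ≤ q) (h2 : q ≤ 1) {n : ℕ}
    (t : Finset (Fin n → H)) (x : (Fin n → H) → ℝ) :
    0 ≤ ∑ v ∈ t, ∑ w ∈ t, x v * x w * wordInner q ⟨n, v⟩ ⟨n, w⟩ := by
  classical
  let X := t × Equiv.Perm (Fin n)
  let A : X → X → ℝ := fun a b =>
    ∏ p ∈ Finset.univ.filter (fun p : Fin n × Fin n => p.1 < p.2),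
      if (a.2 p.1 < a.2 p.2 ↔ b.2 p.1 < b.2 p.2) then 1 else q
  let B : X → X → ℝ := fun a b => ∏ i, ⟪a.1.1 (a.2 i), b.1.1 (b.2 i)⟫_ℝ
  have hA : (Matrix.of A).PosSemidef :=
    posSemidef_prod _ (fun (p : Fin n × Fin n) (a b : X) =>
      if (a.2 p.1 < a.2 p.2 ↔ b.2 p.1 < b.2 p.2) then 1 else q)
      fun p _ => posSemidef_sign h1 h2 (fun a : X => a.2 p.1 < a.2 p.2)
  have hB : (Matrix.of B).PosSemidef :=
    posSemidef_prod _ (fun (i : Fin n) (a b : X) => ⟪a.1.1 (a.2 i), b.1.1 (b.2 i)⟫_ℝ)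
      fun i _ => Matrix.posSemidef_gram ℝ (fun a : X => a.1.1 (a.2 i))
  have hAB := (hA.hadamard hB).dotProduct_mulVec_nonneg (fun a : X => x a.1.1)
  have hA' : ∀ a b : X, A a b = q ^ inversions (b.2 * a.2⁻¹) := by
    intro a b
    rw [inversions_mul_inv', ← Finset.prod_pow_eq_pow_sum]
    refine Finset.prod_congr rfl fun p _ => ?_
    by_cases h : (a.2 p.1 < a.2 p.2 ↔ b.2 p.1 < b.2 p.2) <;> simp [h]
  have hB' : ∀ a b : X, B a b = ∏ i, ⟪a.1.1 i, b.1.1 ((b.2 * a.2⁻¹) i)⟫_ℝ := by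
    intro a b
    rw [← Equiv.prod_comp a.2]
    simp [B]
  have key : ∀ v w : t, ∑ σ : Equiv.Perm (Fin n), ∑ τ : Equiv.Perm (Fin n),
      A (v, σ) (w, τ) * B (v, σ) (w, τ) =
      (n.factorial : ℝ) * wordInner q ⟨n, v.1⟩ ⟨n, w.1⟩ := by
    intro v w
    have : ∀ σ : Equiv.Perm (Fin n), ∑ τ : Equiv.Perm (Fin n),
        A (v, σ) (w, τ) * B (v, σ) (w, τ) = wordInner q ⟨n, v.1⟩ ⟨n, w.1⟩ := by
      intro σ
      rw [wordInner_mk, ← Equiv.sum_comp (Equiv.mulRight σ⁻¹)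
        fun ρ => q ^ inversions ρ * ∏ i, ⟪v.1 i, w.1 (ρ i)⟫_ℝ]
      exact Finset.sum_congr rfl fun τ _ => by rw [hA', hB']; rfl
    rw [Finset.sum_congr rfl fun σ _ => this σ]
    simp [Fintype.card_perm]
  have e : star (fun a : X => x a.1.1) ⬝ᵥ
      ((Matrix.of A).hadamard (Matrix.of B)).mulVec (fun a : X => x a.1.1) =
      (n.factorial : ℝ) *
        ∑ v ∈ t, ∑ w ∈ t, x v * x w * wordInner q ⟨n, v⟩ ⟨n, w⟩ := by
    rw [← Finset.sum_coe_sort t]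
    simp_rw [← Finset.sum_coe_sort t (fun w => _ * x w * _)]
    simp only [dotProduct, Matrix.mulVec, Matrix.hadamard_apply, Matrix.of_apply,
      Pi.star_apply, star_trivial, X, Fintype.sum_prod_type, Finset.mul_sum]
    refine Finset.sum_congr rfl fun v _ => ?_
    rw [Finset.sum_comm]
    refine Finset.sum_congr rfl fun w _ => ?_
    calc _ = x v.1 * x w.1 * ∑ σ : Equiv.Perm (Fin n), ∑ τ : Equiv.Perm (Fin n),
          A (v, σ) (w, τ) * B (v, σ) (w, τ) := by
          simp only [Finset.mul_sum]
          exact Finset.sum_congr rfl fun σ _ => Finset.sum_congr rfl fun τ _ => by ring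
      _ = _ := by rw [key]; ring
  rw [e] at hAB
  exact nonneg_of_mul_nonneg_right hAB (by positivity)

theorem wordInner_nonneg {q : ℝ} (h1 : -1 ≤ q) (h2 : q ≤ 1) (s : Finset (Word H))
    (x : Word H → ℝ) : 0 ≤ ∑ v ∈ s, ∑ w ∈ s, x v * x w * wordInner q v w := by
  classical
  have hs := Finset.sigma_image_fst_preimage_mk s
  rw [← hs]
  simp only [Finset.sum_sigma]
  refine Finset.sum_nonneg fun n hn => ?_
  refine (wordInner_nonneg_aux h1 h2 _ (fun v => x ⟨n, v⟩)).trans_eq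
    (Finset.sum_congr rfl fun v hv => ?_)
  rw [Finset.sum_eq_single n]
  · intro m _ hm
    refine Finset.sum_eq_zero fun w _ => ?_
    rw [wordInner_of_ne q (by simpa using hm.symm), mul_zero]
  · exact fun h => absurd hn h

/-- The algebraic `q`-Fock space before completion, presented by generators: formal complex linear
combinations of elementary tensors of real vectors, with the sesquilinear extension of
`wordInner`. The multilinear relations between elementary tensors are exactly the null vectors of
this semi-inner product, which the Hausdorff completion below divides out; what remains is the sum
of the tensor powers of the complexification of `H`, with the `q`-inner product. -/
def PreFock (_q : Set.Ioo (-1 : ℝ) 1) (H : Type*) : Type _ := Word H →₀ ℂ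

variable (q : Set.Ioo (-1 : ℝ) 1)

instance : AddCommGroup (PreFock q H) := inferInstanceAs (AddCommGroup (Word H →₀ ℂ))
instance : Module ℂ (PreFock q H) := inferInstanceAs (Module ℂ (Word H →₀ ℂ))

/-- The `q`-inner product (conjugate linear in the first variable, as usual in Mathlib). -/
abbrev preFockCore (H : Type*) [NormedAddCommGroup H] [InnerProductSpace ℝ H] :
    PreInnerProductSpace.Core ℂ (PreFock q H) where
  inner x y := Finsupp.sum (M := ℂ) x fun v a => Finsupp.sum (M := ℂ) y fun w b =>
    conj a * b * (wordInner q v w : ℂ)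
  conj_inner_symm x y := by
    simp only [Finsupp.sum, map_sum, map_mul, Complex.conj_conj, Complex.conj_ofReal]
    rw [Finset.sum_comm]
    refine Finset.sum_congr rfl fun v _ => Finset.sum_congr rfl fun w _ => ?_
    rw [wordInner_comm]
    ring
  re_inner_nonneg x := by
    have e : ∀ a b : ℂ, ∀ k : ℝ, RCLike.re (conj a * b * (k : ℂ)) =
        a.re * b.re * k + a.im * b.im * k := by
      intro a b k
      simp
      ring
    simp only [Finsupp.sum, map_sum, e, Finset.sum_add_distrib]
    exact add_nonneg (wordInner_nonneg q.2.1.le q.2.2.le _ fun v => ((show Word H →₀ ℂ from x) v).re)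
      (wordInner_nonneg q.2.1.le q.2.2.le _ fun v => ((show Word H →₀ ℂ from x) v).im)
  add_left x y z := by
    refine Finsupp.sum_add_index' (fun v => ?_) (fun v a b => ?_)
    · simp [Finsupp.sum]
    · simp [add_mul, Finsupp.sum, Finset.sum_add_distrib]
  smul_left x y r := by
    refine (Finsupp.sum_smul_index' (g := x) (b := r) fun v => by simp [Finsupp.sum]).trans ?_
    simp only [Finsupp.sum, Finset.mul_sum, smul_eq_mul, map_mul]
    exact Finset.sum_congr rfl fun v _ => Finset.sum_congr rfl fun w _ => by ring

instance : SeminormedAddCommGroup (PreFock q H) :=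
  InnerProductSpace.Core.toSeminormedAddCommGroup (c := preFockCore q H)
instance : InnerProductSpace ℂ (PreFock q H) := InnerProductSpace.ofCore (preFockCore q H)

/-- The elementary tensor given by a word. -/
def preWord (w : Word H) : PreFock q H := Finsupp.single w (1 : ℂ)

theorem inner_preWord (v w : Word H) :
    ⟪preWord q v, preWord q w⟫_ℂ = (wordInner q v w : ℂ) := by
  change Finsupp.sum (M := ℂ) (Finsupp.single v 1) (fun v a =>
    Finsupp.sum (M := ℂ) (Finsupp.single w 1) fun w b =>
    conj a * b * (wordInner q v w : ℂ)) = _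
  simp

/-- The linear map with prescribed values on elementary tensors. -/
def preLift {E : Type*} [AddCommGroup E] [Module ℂ E] (f : Word H → E) : PreFock q H →ₗ[ℂ] E :=
  Finsupp.linearCombination ℂ f

theorem preLift_preWord {E : Type*} [AddCommGroup E] [Module ℂ E] (f : Word H → E) (w : Word H) :
    preLift q f (preWord q w) = f w :=
  (Finsupp.linearCombination_single ℂ (1 : ℂ) w).trans (one_smul ℂ (f w))

theorem span_preWord : Submodule.span ℂ (Set.range (preWord q : Word H → PreFock q H)) = ⊤ := by
  rw [eq_top_iff]
  rintro x -
  have : (Finsupp.linearCombination ℂ (preWord q : Word H → PreFock q H) x) = x :=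
    (Finsupp.sum_congr (fun v _ => (Finsupp.smul_single_one v _))).trans (Finsupp.sum_single (x : Word H →₀ ℂ))
  rw [← this]
  exact (Finsupp.mem_span_range_iff_exists_finsupp).2 ⟨x, rfl⟩

theorem preFock_induction {P : PreFock q H → Prop} (x : PreFock q H)
    (h0 : P 0) (hw : ∀ w, P (preWord q w)) (ha : ∀ x y, P x → P y → P (x + y))
    (hs : ∀ (c : ℂ) x, P x → P (c • x)) : P x := by
  have hx : x ∈ Submodule.span ℂ (Set.range (preWord q : Word H → PreFock q H)) := by
    rw [span_preWord]; trivial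
  induction hx using Submodule.span_induction with
  | mem y hy => obtain ⟨w, rfl⟩ := hy; exact hw w
  | zero => exact h0
  | add x y _ _ hx hy => exact ha x y hx hy
  | smul c x _ hx => exact hs c x hx

/-- The letter `h` put in front of a word. -/
def consWord (h : H) (w : Word H) : Word H := ⟨w.1 + 1, Fin.cons h w.2⟩

/-- The reversed word. -/
def reverseWord (w : Word H) : Word H := ⟨w.1, fun i => w.2 i.rev⟩

/-- The letter `h` put at the end of a word. -/
def snocWord (w : Word H) (h : H) : Word H := ⟨w.1 + 1, Fin.snoc w.2 h⟩

/-- Left creation before completion: `w ↦ h ⊗ w`. -/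
def preCreation (h : H) : PreFock q H →ₗ[ℂ] PreFock q H :=
  preLift q fun w => preWord q (consWord h w)

/-- Right creation before completion: `w ↦ w ⊗ h`. -/
def preCreationRight (h : H) : PreFock q H →ₗ[ℂ] PreFock q H :=
  preLift q fun w => preWord q (snocWord w h)

/-- Reversal of all words. -/
def preFlip : PreFock q H →ₗ[ℂ] PreFock q H :=
  preLift q fun w => preWord q (reverseWord w)

/-- `∑_j q ^ j ⟪h, w_j⟫ • (w without its letter j)`. -/
def deletions (h : H) : Word H → PreFock q H
  | ⟨0, _⟩ => 0
  | ⟨n + 1, w⟩ => ∑ j : Fin (n + 1),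
      (((q : ℝ) ^ (j : ℕ) * ⟪h, w j⟫_ℝ : ℝ) : ℂ) • preWord q ⟨n, fun i => w (j.succAbove i)⟩

/-- Left annihilation before completion. -/
def preAnnihilation (h : H) : PreFock q H →ₗ[ℂ] PreFock q H := preLift q (deletions q h)

theorem wordInner_cons (q : ℝ) (h : H) {n : ℕ} (v : Fin n → H) (w : Fin (n + 1) → H) :
    wordInner q (consWord h ⟨n, v⟩) ⟨n + 1, w⟩ =
      ∑ j : Fin (n + 1), q ^ (j : ℕ) * ⟪h, w j⟫_ℝ *
        wordInner q ⟨n, v⟩ ⟨n, fun i => w (j.succAbove i)⟩ := by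
  simp only [consWord]
  rw [wordInner_mk, ← (consPerm_bijective n).sum_comp, Fintype.sum_prod_type]
  refine Finset.sum_congr rfl fun j _ => ?_
  rw [wordInner_mk, Finset.mul_sum]
  refine Finset.sum_congr rfl fun τ _ => ?_
  rw [inversions_consPerm, Fin.prod_univ_succ, pow_add]
  simp only [consPerm_zero, consPerm_succ, Fin.cons_zero, Fin.cons_succ]
  ring

theorem inner_preCreation_preWord (h : H) (v w : Word H) :
    ⟪preCreation q h (preWord q v), preWord q w⟫_ℂ =
      ⟪preWord q v, preAnnihilation q h (preWord q w)⟫_ℂ := by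
  rw [preCreation, preLift_preWord, preAnnihilation, preLift_preWord, inner_preWord]
  obtain ⟨n, v⟩ := v
  obtain ⟨m, w⟩ := w
  cases m with
  | zero => rw [wordInner_of_ne _ (by simp [consWord])]; simp [deletions]
  | succ m =>
    simp only [deletions, inner_sum, inner_smul_right, inner_preWord]
    by_cases hnm : n = m
    · subst hnm
      rw [wordInner_cons]
      push_cast
      rfl
    · rw [wordInner_of_ne _ (by simpa [consWord] using hnm)]
      symm
      rw [Complex.ofReal_zero]
      refine Finset.sum_eq_zero fun j _ => ?_
      rw [wordInner_of_ne _ (by simpa using hnm)]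
      simp

theorem inner_preCreation (h : H) (x y : PreFock q H) :
    ⟪preCreation q h x, y⟫_ℂ = ⟪x, preAnnihilation q h y⟫_ℂ := by
  induction x using preFock_induction with
  | h0 => simp
  | ha x x' hx hx' => simp [inner_add_left, hx, hx']
  | hs c x hx => simp [inner_smul_left, hx]
  | hw v =>
    induction y using preFock_induction with
    | h0 => simp
    | ha y y' hy hy' => simp [inner_add_right, hy, hy']
    | hs c y hy => simp [inner_smul_right, hy]
    | hw w => exact inner_preCreation_preWord q h v w

theorem preAnnihilation_preCreation (h : H) (x : PreFock q H) :
    preAnnihilation q h (preCreation q h x) =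
      ((‖h‖ ^ 2 : ℝ) : ℂ) • x + ((q : ℝ) : ℂ) • preCreation q h (preAnnihilation q h x) := by
  induction x using preFock_induction with
  | h0 => simp
  | ha x x' hx hx' => simp only [map_add, hx, hx', smul_add]; abel
  | hs c x hx => simp only [map_smul, hx, smul_add, smul_comm c]
  | hw w =>
    obtain ⟨n, w⟩ := w
    simp only [preCreation, preAnnihilation, preLift_preWord, consWord, deletions]
    rw [Fin.sum_univ_succ]
    congr 1
    · simp
    · cases n with
      | zero => simp
      | succ n =>
        simp only [map_sum, map_smul, preLift_preWord, Finset.smul_sum, smul_smul]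
        refine Finset.sum_congr rfl fun j _ => ?_
        congr 1
        · simp only [Fin.cons_succ, Fin.val_succ, pow_succ]
          push_cast
          ring
        · congr 2
          ext i
          refine Fin.cases ?_ (fun i => ?_) i <;> simp

/-- The span of the words of length at most `n`. -/
def lengthLE (H : Type*) (n : ℕ) : Submodule ℂ (PreFock q H) :=
  Submodule.span ℂ (preWord q '' {w : Word H | w.1 ≤ n})

theorem exists_mem_lengthLE (x : PreFock q H) : ∃ n, x ∈ lengthLE q H n := by
  induction x using preFock_induction with
  | h0 => exact ⟨0, zero_mem _⟩
  | hw w => exact ⟨w.1, Submodule.subset_span ⟨w, show w.1 ≤ w.1 from le_rfl, rfl⟩⟩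
  | hs c x hx => exact hx.imp fun n hn => Submodule.smul_mem _ c hn
  | ha x y hx hy =>
    obtain ⟨n, hn⟩ := hx
    obtain ⟨m, hm⟩ := hy
    have mono : ∀ {a b : ℕ}, a ≤ b → lengthLE q H a ≤ lengthLE q H b := fun hab =>
      Submodule.span_mono (Set.image_mono fun w (hw : w.1 ≤ _) => hw.trans hab)
    exact ⟨max n m, add_mem (mono (le_max_left n m) hn) (mono (le_max_right n m) hm)⟩

theorem preAnnihilation_mem (h : H) (n : ℕ) (x : PreFock q H) (hx : x ∈ lengthLE q H (n + 1)) :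
    preAnnihilation q h x ∈ lengthLE q H n := by
  induction hx using Submodule.span_induction with
  | zero => simp
  | add x y _ _ hx hy => rw [map_add]; exact add_mem hx hy
  | smul c x _ hx => rw [map_smul]; exact Submodule.smul_mem _ c hx
  | mem y hy =>
    obtain ⟨⟨m, w⟩, hw, rfl⟩ := hy
    rw [preAnnihilation, preLift_preWord]
    cases m with
    | zero => exact zero_mem _
    | succ m =>
      refine Submodule.sum_mem _ fun j _ => Submodule.smul_mem _ _ ?_
      exact Submodule.subset_span ⟨_, show m ≤ n from Nat.le_of_succ_le_succ (show m + 1 ≤ n + 1 from hw), rfl⟩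

theorem preAnnihilation_eq_zero (h : H) (x : PreFock q H) (hx : x ∈ lengthLE q H 0) :
    preAnnihilation q h x = 0 := by
  induction hx using Submodule.span_induction with
  | zero => simp
  | add x y _ _ hx hy => rw [map_add, hx, hy, add_zero]
  | smul c x _ hx => rw [map_smul, hx, smul_zero]
  | mem y hy =>
    obtain ⟨⟨m, w⟩, hw, rfl⟩ := hy
    obtain rfl : m = 0 := Nat.le_zero.1 hw
    rw [preAnnihilation, preLift_preWord, deletions]

theorem norm_preCreation_sq (h : H) (x : PreFock q H) :
    ‖preCreation q h x‖ ^ 2 =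
      ‖h‖ ^ 2 * ‖x‖ ^ 2 + (q : ℝ) * ‖preAnnihilation q h x‖ ^ 2 := by
  have h1 : ⟪preCreation q h x, preCreation q h x⟫_ℂ =
      ((‖h‖ ^ 2 : ℝ) : ℂ) * ⟪x, x⟫_ℂ +
        ((q : ℝ) : ℂ) * ⟪preAnnihilation q h x, preAnnihilation q h x⟫_ℂ := by
    rw [inner_preCreation, preAnnihilation_preCreation, inner_add_right, inner_smul_right,
      inner_smul_right, ← inner_conj_symm x (preCreation q h _), inner_preCreation,
      inner_conj_symm]
  simp only [inner_self_eq_norm_sq_to_K, RCLike.ofReal_eq_complex_ofReal] at h1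
  exact_mod_cast h1

theorem norm_preCreation_le_aux (h : H) (n : ℕ) : ∀ x ∈ lengthLE q H n,
    ‖preCreation q h x‖ ^ 2 ≤ ‖h‖ ^ 2 / (1 - |(q : ℝ)|) * ‖x‖ ^ 2 := by
  have hq : 0 < 1 - |(q : ℝ)| := sub_pos.2 (abs_lt.2 q.2)
  set K := ‖h‖ ^ 2 / (1 - |(q : ℝ)|) with hK
  have hK0 : 0 ≤ K := by positivity
  have hKe : ‖h‖ ^ 2 + |(q : ℝ)| * K = K := by
    rw [hK]; field_simp; ring
  have hKn : 0 ≤ |(q : ℝ)| * K := by positivity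
  induction n with
  | zero =>
    intro x hx
    rw [norm_preCreation_sq, preAnnihilation_eq_zero q h x hx, norm_zero]
    nlinarith [sq_nonneg ‖x‖]
  | succ n ih =>
    intro x hx
    have hax := ih _ (preAnnihilation_mem q h n x hx)
    have h2 : ‖preAnnihilation q h x‖ ^ 2 ≤
        ‖preCreation q h (preAnnihilation q h x)‖ * ‖x‖ := by
      have := norm_inner_le_norm (𝕜 := ℂ) (preCreation q h (preAnnihilation q h x)) x
      rwa [inner_preCreation, inner_self_eq_norm_sq_to_K, norm_pow, RCLike.norm_ofReal,
        abs_norm] at this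
    have h3 : ‖preAnnihilation q h x‖ ^ 2 ≤ K * ‖x‖ ^ 2 := by
      rcases (sq_nonneg ‖preAnnihilation q h x‖).eq_or_lt with h0 | h0
      · rw [← h0]; positivity
      · have h4 := pow_le_pow_left₀ h0.le h2 2
        rw [mul_pow] at h4
        refine le_of_mul_le_mul_left (h4.trans' (le_of_eq (sq _).symm) |>.trans
          ((mul_le_mul_of_nonneg_right hax (sq_nonneg _)).trans_eq (by ring))) h0
    rw [norm_preCreation_sq]
    have h5 : (q : ℝ) * ‖preAnnihilation q h x‖ ^ 2 ≤ |(q : ℝ)| * (K * ‖x‖ ^ 2) :=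
      (mul_le_mul_of_nonneg_right (le_abs_self _) (sq_nonneg _)).trans
        (mul_le_mul_of_nonneg_left h3 (abs_nonneg _))
    calc _ ≤ ‖h‖ ^ 2 * ‖x‖ ^ 2 + |(q : ℝ)| * (K * ‖x‖ ^ 2) := by linarith
      _ = (‖h‖ ^ 2 + |(q : ℝ)| * K) * ‖x‖ ^ 2 := by ring
      _ = _ := by rw [hKe]

theorem norm_preCreation_le (h : H) (x : PreFock q H) :
    ‖preCreation q h x‖ ≤ √(‖h‖ ^ 2 / (1 - |(q : ℝ)|)) * ‖x‖ := by
  obtain ⟨n, hn⟩ := exists_mem_lengthLE q x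
  have hq : 0 < 1 - |(q : ℝ)| := sub_pos.2 (abs_lt.2 q.2)
  refine le_of_sq_le_sq ?_ (by positivity)
  rw [mul_pow, Real.sq_sqrt (by positivity)]
  exact norm_preCreation_le_aux q h n x hn

theorem inversions_rev {n : ℕ} (σ : Equiv.Perm (Fin n)) :
    inversions (Fin.revPerm.permCongr σ) = inversions σ := by
  rw [inversions_eq_sum, inversions_eq_sum, Finset.sum_comm, ← Equiv.sum_comp Fin.revPerm]
  refine Finset.sum_congr rfl fun i _ => ?_
  rw [← Equiv.sum_comp Fin.revPerm]
  refine Finset.sum_congr rfl fun k _ => ?_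
  simp

theorem wordInner_reverse (q : ℝ) (v w : Word H) :
    wordInner q (reverseWord v) (reverseWord w) = wordInner q v w := by
  obtain ⟨n, v⟩ := v
  obtain ⟨m, w⟩ := w
  by_cases h : n = m
  · subst h
    simp only [reverseWord]
    rw [wordInner_mk, wordInner_mk, ← Equiv.sum_comp Fin.revPerm.permCongr]
    refine Finset.sum_congr rfl fun σ _ => ?_
    rw [inversions_rev, ← Equiv.prod_comp Fin.revPerm]
    simp
  · rw [wordInner_of_ne q h, wordInner_of_ne q (by simpa [reverseWord] using h)]

theorem inner_preFlip (x y : PreFock q H) : ⟪preFlip q x, preFlip q y⟫_ℂ = ⟪x, y⟫_ℂ := by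
  induction x using preFock_induction with
  | h0 => simp
  | ha x x' hx hx' => simp [inner_add_left, hx, hx']
  | hs c x hx => simp [inner_smul_left, hx]
  | hw v =>
    induction y using preFock_induction with
    | h0 => simp
    | ha y y' hy hy' => simp [inner_add_right, hy, hy']
    | hs c y hy => simp [inner_smul_right, hy]
    | hw w => rw [preFlip, preLift_preWord, preLift_preWord, inner_preWord, inner_preWord,
        wordInner_reverse]

theorem norm_preFlip (x : PreFock q H) : ‖preFlip q x‖ = ‖x‖ := by
  rw [@norm_eq_sqrt_re_inner ℂ, @norm_eq_sqrt_re_inner ℂ, inner_preFlip]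

theorem reverseWord_consWord (h : H) (w : Word H) :
    reverseWord (consWord h (reverseWord w)) = snocWord w h := by
  obtain ⟨n, w⟩ := w
  simp only [reverseWord, consWord, snocWord]
  congr 1
  ext i
  refine Fin.lastCases ?_ (fun i => ?_) i
  · simp
  · simp [Fin.rev_castSucc]

theorem preCreationRight_eq (h : H) (x : PreFock q H) :
    preCreationRight q h x = preFlip q (preCreation q h (preFlip q x)) := by
  induction x using preFock_induction with
  | h0 => simp
  | ha x x' hx hx' => simp [hx, hx']
  | hs c x hx => simp [hx]
  | hw w =>
    simp only [preCreationRight, preFlip, preCreation, preLift_preWord, reverseWord_consWord]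

theorem norm_preCreationRight_le (h : H) (x : PreFock q H) :
    ‖preCreationRight q h x‖ ≤ √(‖h‖ ^ 2 / (1 - |(q : ℝ)|)) * ‖x‖ := by
  rw [preCreationRight_eq, norm_preFlip, ← norm_preFlip q x]
  exact norm_preCreation_le q h _

/-- The `q`-Fock space: the Hausdorff completion for the `q`-inner product. -/
abbrev Fock (q : Set.Ioo (-1 : ℝ) 1) (H : Type*) [NormedAddCommGroup H]
    [InnerProductSpace ℝ H] : Type _ :=
  UniformSpace.Completion (PreFock q H)

/-- The elementary tensor of the letters of `w`, in the `q`-Fock space. -/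
def tensor (w : Word H) : Fock q H := (preWord q w : PreFock q H)

/-- The vacuum vector: the empty word. -/
def vacuum (H : Type*) [NormedAddCommGroup H] [InnerProductSpace ℝ H] : Fock q H :=
  tensor q ⟨0, Fin.elim0⟩

/-- The left creation operator `c(h)`. -/
def creation (h : H) : Fock q H →L[ℂ] Fock q H :=
  ((preCreation q h).mkContinuous _ (norm_preCreation_le q h)).completion

/-- The right creation operator `c_r(h)`. -/
def creationRight (h : H) : Fock q H →L[ℂ] Fock q H :=
  ((preCreationRight q h).mkContinuous _ (norm_preCreationRight_le q h)).completion

theorem inner_tensor (v w : Word H) : ⟪tensor q v, tensor q w⟫_ℂ = (wordInner q v w : ℂ) :=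
  (UniformSpace.Completion.inner_coe _ _).trans (inner_preWord q v w)

theorem creation_tensor (h : H) (w : Word H) :
    creation q h (tensor q w) = tensor q (consWord h w) := by
  rw [creation, tensor, ContinuousLinearMap.completion_apply_coe, LinearMap.mkContinuous_apply,
    preCreation, preLift_preWord, tensor]

theorem creationRight_tensor (h : H) (w : Word H) :
    creationRight q h (tensor q w) = tensor q (snocWord w h) := by
  rw [creationRight, tensor, ContinuousLinearMap.completion_apply_coe,
    LinearMap.mkContinuous_apply, preCreationRight, preLift_preWord, tensor]

/-- The left annihilation operator `a(h)`, the adjoint of `c(h)`. -/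
def annihilation (h : H) : Fock q H →L[ℂ] Fock q H :=
  ContinuousLinearMap.adjoint (creation q h)

/-- The right annihilation operator `a_r(h)`, the adjoint of `c_r(h)`. -/
def annihilationRight (h : H) : Fock q H →L[ℂ] Fock q H :=
  ContinuousLinearMap.adjoint (creationRight q h)

/-- The `q`-Gaussian operator `s(h) = c(h) + a(h)`. -/
def gaussian (h : H) : Fock q H →L[ℂ] Fock q H := creation q h + annihilation q h

/-- The von Neumann algebra generated by a set of operators: the double commutant of the set
together with the adjoints of its elements. -/
def generated {K : Type*} [NormedAddCommGroup K] [InnerProductSpace ℂ K] [CompleteSpace K]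
    (S : Set (K →L[ℂ] K)) : VonNeumannAlgebra K where
  toStarSubalgebra :=
    StarSubalgebra.centralizer ℂ (StarSubalgebra.centralizer ℂ S : Set (K →L[ℂ] K))
  centralizer_centralizer' := by
    change Set.centralizer (Set.centralizer
        ((StarSubalgebra.centralizer ℂ
          (StarSubalgebra.centralizer ℂ S : Set (K →L[ℂ] K)) : StarSubalgebra ℂ (K →L[ℂ] K)) :
            Set (K →L[ℂ] K))) =
      ((StarSubalgebra.centralizer ℂ
          (StarSubalgebra.centralizer ℂ S : Set (K →L[ℂ] K)) : StarSubalgebra ℂ (K →L[ℂ] K)) :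
            Set (K →L[ℂ] K))
    simp only [StarSubalgebra.coe_centralizer, Set.centralizer_centralizer_centralizer]

/-- The `q`-Gaussian von Neumann algebra `M = Γ_q(H)`. -/
def gaussianAlgebra (H : Type*) [NormedAddCommGroup H] [InnerProductSpace ℝ H] :
    VonNeumannAlgebra (Fock q H) :=
  generated (Set.range (gaussian q : H → _))

/-- The generator subalgebra `A = Γ_q(ℝe)` of `M`: the von Neumann algebra generated by `s(e)`. -/
def generatorSubalgebra (e : H) : VonNeumannAlgebra (Fock q H) :=
  generated {gaussian q e}

/-- The closed subspace `F_q(ℝe) = L²(A)` of the `q`-Fock space `F_q(H) = L²(M)`, spanned by the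
tensor powers of `e`. -/
def fockLine (e : H) : Submodule ℂ (Fock q H) :=
  (Submodule.span ℂ (Set.range fun n : ℕ => (creation q e ^ n) (vacuum q H))).topologicalClosure

/-- The `k`-particle space: the closed span of the elementary tensors of length `k`. -/
def particleSpace (H : Type*) [NormedAddCommGroup H] [InnerProductSpace ℝ H] (k : ℕ) :
    Submodule ℂ (Fock q H) :=
  (Submodule.span ℂ (tensor q '' {w : Word H | w.1 = k})).topologicalClosure

/-- `T^k`: the `k`-particle vectors killed by both `a(e)` and `a_r(e)`. -/
def kernelSpace (e : H) (k : ℕ) : Submodule ℂ (Fock q H) :=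
  particleSpace q H k ⊓ (annihilation q e).ker ⊓ (annihilationRight q e).ker

/-- `ξ_{r,s} = e^{⊗ r} ⊗ ξ ⊗ e^{⊗ s}`. -/
def pad (e : H) (r s : ℕ) (ξ : Fock q H) : Fock q H :=
  (creation q e ^ r) ((creationRight q e ^ s) ξ)

/-- The `q`-factorial `[n]_q! = [1]_q ⋯ [n]_q` with `[k]_q = (1 - q ^ k) / (1 - q)`. -/
def qFactorial (q : ℝ) (n : ℕ) : ℝ := ∏ k ∈ Finset.range n, (1 - q ^ (k + 1)) / (1 - q)

/-- `v` is a Riesz basis of the closed subspace `K`: its span is dense in `K`, and the norms of its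
finite linear combinations are equivalent to the `ℓ²` norms of the coefficients. -/
structure IsRieszBasis {E ι : Type*} [NormedAddCommGroup E] [InnerProductSpace ℂ E]
    (K : Submodule ℂ E) (v : ι → E) : Prop where
  closure_span : (Submodule.span ℂ (Set.range v)).topologicalClosure = K
  bounds : ∃ α > (0 : ℝ), ∃ β > (0 : ℝ), ∀ (s : Finset ι) (c : ι → ℂ),
    α * ∑ i ∈ s, ‖c i‖ ^ 2 ≤ ‖∑ i ∈ s, c i • v i‖ ^ 2 ∧
    ‖∑ i ∈ s, c i • v i‖ ^ 2 ≤ β * ∑ i ∈ s, ‖c i‖ ^ 2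

section Basis

variable {e : H} {κ : ℕ → Type*}

/-- The vectors `ξ^i_{r,s}`, where `i = ⟨k, j⟩` and `ξ^i` is the `j`-th vector of the chosen
orthonormal basis of `T^{k + 1}`. -/
def basisVector (b : ∀ k, HilbertBasis (κ k) ℂ (kernelSpace q e (k + 1)))
    (p : (Σ k, κ k) × ℕ × ℕ) : Fock q H :=
  pad q e p.2.1 p.2.2 (b p.1.1 p.1.2 : kernelSpace q e (p.1.1 + 1))

/-- The standing smallness condition on `q`: the norms of `ξ_{r,s}` for unit vectors `ξ` of all
the `T^k` are comparable to `[r + s]_q!` up to a factor of two, and the normalized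
vectors `ξ^i_{r,s}` form a Riesz basis of `L²(M) ⊖ L²(A)`. -/
structure IsSmall (b : ∀ k, HilbertBasis (κ k) ℂ (kernelSpace q e (k + 1))) : Prop where
  norm_bounds : ∀ (k : ℕ), ∀ ξ ∈ kernelSpace q e k, ‖ξ‖ = 1 → ∀ r s : ℕ,
    1 / 2 * qFactorial q (r + s) ≤ ‖pad q e r s ξ‖ ^ 2 ∧
    ‖pad q e r s ξ‖ ^ 2 ≤ 2 * qFactorial q (r + s)
  riesz : IsRieszBasis (fockLine q e)ᗮ
    fun p => ((‖basisVector q b p‖⁻¹ : ℝ) : ℂ) • basisVector q b p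

/-- `L` is the operator `L_N`: the bounded operator that vanishes on `L²(A)`, fixes `ξ^i_{r,s}`
for `r ≤ N` and kills it for `r > N`. -/
structure IsLeftTruncation (b : ∀ k, HilbertBasis (κ k) ℂ (kernelSpace q e (k + 1))) (N : ℕ)
    (L : Fock q H →L[ℂ] Fock q H) : Prop where
  on_line : ∀ x ∈ fockLine q e, L x = 0
  on_basis : ∀ (i : Σ k, κ k) (r s : ℕ),
    L (basisVector q b (i, r, s)) = if r ≤ N then basisVector q b (i, r, s) else 0

/-- `R` is the operator `R_N`: the bounded operator that vanishes on `L²(A)`, fixes `ξ^i_{r,s}`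
for `s ≤ N` and kills it for `s > N`. -/
structure IsRightTruncation (b : ∀ k, HilbertBasis (κ k) ℂ (kernelSpace q e (k + 1))) (N : ℕ)
    (R : Fock q H →L[ℂ] Fock q H) : Prop where
  on_line : ∀ x ∈ fockLine q e, R x = 0
  on_basis : ∀ (i : Σ k, κ k) (r s : ℕ),
    R (basisVector q b (i, r, s)) = if s ≤ N then basisVector q b (i, r, s) else 0

end Basis

/-- A von Neumann algebra is diffuse if it has no minimal projection: every nonzero projection has
a nonzero proper subprojection. -/
def IsDiffuse {K : Type*} [NormedAddCommGroup K] [InnerProductSpace ℂ K] [CompleteSpace K]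
    (C : VonNeumannAlgebra K) : Prop :=
  ∀ p ∈ C, IsStarProjection p → p ≠ 0 →
    ∃ r ∈ C, IsStarProjection r ∧ r * p = r ∧ r ≠ 0 ∧ r ≠ p

/-- `z` represents an element of the ultrapower `P^ω`: a sequence in `P`, bounded in operator norm.
(Two such sequences represent the same element if the trace norm of their difference tends to zero
along `ω`; the conditions below do not depend on the representative.) -/
structure IsBoundedSeq (P : VonNeumannAlgebra (Fock q H)) (z : ℕ → Fock q H →L[ℂ] Fock q H) :
    Prop where
  mem : ∀ n, z n ∈ P
  bounded : ∃ K : ℝ, ∀ n, ‖z n‖ ≤ K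

/-- `x ∈ M` as a vector of `L²(M) = F_q(H)`, namely `x Ω`. Its norm is the trace norm `‖x‖₂`,
and `⟪x Ω, y Ω⟫ = τ(x* y)`. -/
def toL2 (x : Fock q H →L[ℂ] Fock q H) : Fock q H := x (vacuum q H)

/-- The element `(z_n)` is orthogonal to `P^ω`: `lim_{n → ω} τ(a_n* z_n) = 0` for every
`(a_n)` in `P^ω`. -/
def IsOrthogonal (ω : Ultrafilter ℕ) (P : VonNeumannAlgebra (Fock q H))
    (z : ℕ → Fock q H →L[ℂ] Fock q H) : Prop :=
  ∀ a, IsBoundedSeq q P a → Tendsto (fun n => ⟪toL2 q (a n), toL2 q (z n)⟫_ℂ) ω (𝓝 0)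

/-- The element `(z_n)` of the ultrapower commutes with `C`: `lim_{n → ω} ‖z_n c - c z_n‖₂ = 0` for
all `c ∈ C`. -/
def CommutesWith (ω : Ultrafilter ℕ) (C : VonNeumannAlgebra (Fock q H))
    (z : ℕ → Fock q H →L[ℂ] Fock q H) : Prop :=
  ∀ c ∈ C, Tendsto (fun n => ‖toL2 q (z n * c - c * z n)‖) ω (𝓝 0)

end QGaussian

end

universe u

open QGaussian

/-!
Write `c`, `a` for the left creation and annihilation operators of `e`, rescaled by `√(1 - q)`, and
`F_n = ∏_{j ≤ n} (1 - q ^ j)`.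

For small `q`, the inner products of the vectors `ξ_{r,s}` satisfy two recursions, one for each side
on which a letter `e` can be removed (`IsPadGram`). They make the Gram matrix almost diagonal, with
entries of size `|q| ^ |r - r'|`, and the Riesz bounds follow from its small row sums. Density comes
from the observation that an `n`-particle vector orthogonal to all `ξ_{r,s}` is sent by `a(e)` and
`a_r(e)` to vectors of the same kind, so that it is in `T^n` (`isSmall_of_small`).

For admissible `q`, the truncations exist because the Riesz bounds turn coordinate projections into
bounded operators. Let `V_N` be the closed span of the `ξ^i_{r,s}` with `r ≤ N` (`lowSpace`). The
asymptotic statement rests on four facts.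

* The operator `a` is a strict contraction for a weighted `ℓ²` norm equivalent to the norm on `V_N`,
  so `‖a^J v‖` decays geometrically for `v ∈ V_N` (`PaddedBasis.exists_decay`).
* Hence `|⟪w v, v'⟫| ≤ C_N ‖w Ω‖ ‖v‖ ‖v'‖` for `w ∈ A` and `v, v' ∈ V_N`. For the normally ordered
  `q`-Hermite polynomials `∑_{i + l = j} c^i a^l / (F_i F_l)` this is the decay of
  `⟪a^l v, a^i v'⟫`; their values at `Ω` are orthogonal, which gives the estimate on their linear
  span, and a two-dimensional version of the double commutant theorem extends it to `A`
  (`PaddedBasis.exists_inner_le`).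
* The right action `ρ(u)` of `u ∈ A`, which is the conjugate of `u` by the reversal of words,
  commutes with `M` and preserves `V_N` (`PaddedBasis.rightAct_mem_lowSpace`).
* As `C` is diffuse, `1` is a finite sum of orthogonal projections `p_i ∈ C` of arbitrarily small
  trace norm (`IsDiffuse.isFineSum_one`).

So `E = ∑ p_i ρ(p_i)` is small on `V_N`, as `‖p_i ρ(p_i) y‖² = ⟪p_i ρ(p_i) y, ρ(p_i) y⟫`. If `x_n`
is bounded and asymptotically commutes with `C`, then `E x_n - x_n` tends to `0`, and therefore so
does the orthogonal projection of `x_n` to `V_N` (`PaddedBasis.tendsto_starProjection_lowSpace`).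
The truncation `L_N` is not orthogonal, but `V_m` is almost orthogonal to the `ξ^i_{r,s}` with `r`
much larger than `m`, and a pigeonhole argument over many truncation levels bounds `‖L_N x‖` by the
projections of `x` to the spaces `V_m` (`PaddedBasis.exists_norm_truncation_le`). The statement on
`R_N` is the one on `L_N` for the reversed vectors.
-/

noncomputable section
namespace QGaussian

/-! ### Operators on the `q`-Fock space -/

section

variable {H : Type*} [NormedAddCommGroup H] [InnerProductSpace ℝ H]
variable (q : Set.Ioo (-1 : ℝ) 1)

theorem creation_coe (h : H) (x : PreFock q H) :
    creation q h (x : Fock q H) = (preCreation q h x : PreFock q H) := by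
  rw [creation, ContinuousLinearMap.completion_apply_coe, LinearMap.mkContinuous_apply]

theorem creationRight_coe (h : H) (x : PreFock q H) :
    creationRight q h (x : Fock q H) = (preCreationRight q h x : PreFock q H) := by
  rw [creationRight, ContinuousLinearMap.completion_apply_coe, LinearMap.mkContinuous_apply]

theorem annihilation_coe (h : H) (x : PreFock q H) :
    annihilation q h (x : Fock q H) = (preAnnihilation q h x : PreFock q H) := by
  refine ext_inner_left ℂ fun v => ?_
  rw [annihilation, ContinuousLinearMap.adjoint_inner_right]
  induction v using UniformSpace.Completion.induction_on with
  | hp => exact isClosed_eq (by fun_prop) (by fun_prop)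
  | ih v =>
    rw [creation_coe, UniformSpace.Completion.inner_coe, UniformSpace.Completion.inner_coe,
      inner_preCreation]

/-- Bounded operators that agree on elementary tensors are equal. -/
theorem clm_ext_tensor {E : Type*} [NormedAddCommGroup E] [NormedSpace ℂ E]
    {S T : Fock q H →L[ℂ] E} (h : ∀ w, S (tensor q w) = T (tensor q w)) : S = T := by
  ext x
  induction x using UniformSpace.Completion.induction_on with
  | hp => exact isClosed_eq (by fun_prop) (by fun_prop)
  | ih x =>
    induction x using preFock_induction with
    | h0 => rw [UniformSpace.Completion.coe_zero, map_zero, map_zero]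
    | hw w => exact h w
    | ha x y hx hy => rw [UniformSpace.Completion.coe_add, map_add, map_add, hx, hy]
    | hs c x hx => rw [UniformSpace.Completion.coe_smul, map_smul, map_smul, hx]

theorem annihilation_comp_creation (h : H) :
    annihilation q h ∘L creation q h =
      ((‖h‖ ^ 2 : ℝ) : ℂ) • ContinuousLinearMap.id ℂ (Fock q H) +
        ((q : ℝ) : ℂ) • creation q h ∘L annihilation q h := by
  refine clm_ext_tensor q fun w => ?_
  change annihilation q h (creation q h (tensor q w)) = ((‖h‖ ^ 2 : ℝ) : ℂ) • tensor q w +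
    ((q : ℝ) : ℂ) • creation q h (annihilation q h (tensor q w))
  simp only [tensor, creation_coe, annihilation_coe, preAnnihilation_preCreation,
    UniformSpace.Completion.coe_add, UniformSpace.Completion.coe_smul]

theorem creation_comm_creationRight (h h' : H) :
    creation q h ∘L creationRight q h' = creationRight q h' ∘L creation q h := by
  refine clm_ext_tensor q fun w => ?_
  simp only [ContinuousLinearMap.comp_apply, creation_tensor, creationRight_tensor]
  obtain ⟨n, w⟩ := w
  simp only [consWord, snocWord, Fin.cons_snoc_eq_snoc_cons]

theorem preAnnihilation_snocWord (h h' : H) (w : Word H) :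
    preAnnihilation q h (preWord q (snocWord w h')) =
      preCreationRight q h' (preAnnihilation q h (preWord q w)) +
        (((q : ℝ) ^ w.1 * ⟪h, h'⟫_ℝ : ℝ) : ℂ) • preWord q w := by
  obtain ⟨n, w⟩ := w
  simp only [preAnnihilation, preLift_preWord, snocWord, deletions]
  rw [Fin.sum_univ_castSucc]
  congr 1
  · cases n with
    | zero => simp
    | succ n =>
      simp only [map_sum, map_smul, preCreationRight, preLift_preWord, snocWord]
      refine Finset.sum_congr rfl fun j _ => ?_
      congr 1
      · simp
      · congr 2
        ext i
        refine Fin.lastCases ?_ (fun i => ?_) i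
        · simp
        · simp
  · simp

/-- On elementary tensors of length `n`, `a(h) c_r(h') - c_r(h') a(h) = q ^ n ⟪h, h'⟫`. -/
theorem annihilation_creationRight_tensor (h h' : H) (w : Word H) :
    annihilation q h (creationRight q h' (tensor q w)) =
      creationRight q h' (annihilation q h (tensor q w)) +
        (((q : ℝ) ^ w.1 * ⟪h, h'⟫_ℝ : ℝ) : ℂ) • tensor q w := by
  rw [creationRight_tensor]
  simp only [tensor, annihilation_coe, preAnnihilation_snocWord, creationRight_coe,
    UniformSpace.Completion.coe_add, UniformSpace.Completion.coe_smul]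

theorem annihilation_vacuum (h : H) : annihilation q h (vacuum q H) = 0 := by
  rw [vacuum, tensor, annihilation_coe, preAnnihilation, preLift_preWord, deletions,
    UniformSpace.Completion.coe_zero]

/-! ### The flip -/

/-- The unitary on the `q`-Fock space that reverses elementary tensors. -/
def flip (H : Type*) [NormedAddCommGroup H] [InnerProductSpace ℝ H] : Fock q H →L[ℂ] Fock q H :=
  ((preFlip q).mkContinuous 1 fun x : PreFock q H => by
    rw [norm_preFlip, one_mul]).completion

theorem flip_coe (x : PreFock q H) : flip q H (x : Fock q H) = (preFlip q x : PreFock q H) := by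
  rw [flip, ContinuousLinearMap.completion_apply_coe, LinearMap.mkContinuous_apply]

theorem flip_tensor (w : Word H) : flip q H (tensor q w) = tensor q (reverseWord w) := by
  rw [tensor, flip_coe, preFlip, preLift_preWord, tensor]

@[simp]
theorem flip_flip (x : Fock q H) : flip q H (flip q H x) = x := by
  have : flip q H ∘L flip q H = ContinuousLinearMap.id ℂ _ := by
    refine clm_ext_tensor q fun w => ?_
    simp [flip_tensor, reverseWord]
  exact DFunLike.congr_fun this x

theorem inner_flip (x y : Fock q H) : ⟪flip q H x, y⟫_ℂ = ⟪x, flip q H y⟫_ℂ := by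
  rw [← flip_flip q y, flip_flip q (flip q H y)]
  generalize flip q H y = y
  induction x, y using UniformSpace.Completion.induction_on₂ with
  | hp => exact isClosed_eq (by fun_prop) (by fun_prop)
  | ih x y => rw [flip_coe, flip_coe, UniformSpace.Completion.inner_coe, inner_preFlip,
      UniformSpace.Completion.inner_coe]

@[simp]
theorem norm_flip (x : Fock q H) : ‖flip q H x‖ = ‖x‖ := by
  rw [@norm_eq_sqrt_re_inner ℂ, @norm_eq_sqrt_re_inner ℂ, inner_flip, flip_flip]

@[simp]
theorem flip_vacuum : flip q H (vacuum q H) = vacuum q H := by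
  rw [vacuum, flip_tensor]
  simp only [reverseWord]
  congr!

theorem flip_creation (h : H) (x : Fock q H) :
    flip q H (creation q h x) = creationRight q h (flip q H x) := by
  have : flip q H ∘L creation q h = creationRight q h ∘L flip q H := by
    refine clm_ext_tensor q fun w => ?_
    simp only [ContinuousLinearMap.comp_apply, creation_tensor, creationRight_tensor, flip_tensor]
    rw [← reverseWord_consWord h (reverseWord w)]
    have : reverseWord (reverseWord w) = w := by simp [reverseWord]
    rw [this]
  exact DFunLike.congr_fun this x

theorem flip_creationRight (h : H) (x : Fock q H) :
    flip q H (creationRight q h x) = creation q h (flip q H x) := by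
  rw [← flip_flip q x, ← flip_creation, flip_flip, flip_flip]

theorem flip_annihilation (h : H) (x : Fock q H) :
    flip q H (annihilation q h x) = annihilationRight q h (flip q H x) := by
  refine ext_inner_left ℂ fun v => ?_
  rw [← inner_flip, annihilation, ContinuousLinearMap.adjoint_inner_right, annihilationRight,
    ContinuousLinearMap.adjoint_inner_right, ← inner_flip, flip_creationRight]

theorem flip_annihilationRight (h : H) (x : Fock q H) :
    flip q H (annihilationRight q h x) = annihilation q h (flip q H x) := by
  rw [← flip_flip q x, ← flip_annihilation, flip_flip, flip_flip]

/-! ### Particle spaces -/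

variable {q}

theorem tensor_mem_particleSpace (w : Word H) : tensor q w ∈ particleSpace q H w.1 :=
  Submodule.le_topologicalClosure _ (Submodule.subset_span ⟨w, rfl, rfl⟩)

theorem vacuum_mem_particleSpace : vacuum q H ∈ particleSpace q H 0 :=
  tensor_mem_particleSpace (⟨0, Fin.elim0⟩ : Word H)

theorem particleSpace_le {k : ℕ} {U : Submodule ℂ (Fock q H)} (hU : IsClosed (U : Set (Fock q H)))
    (h : ∀ w : Word H, w.1 = k → tensor q w ∈ U) : particleSpace q H k ≤ U := by
  unfold particleSpace
  refine Submodule.topologicalClosure_minimal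
    (Submodule.span ℂ (tensor q '' {w : Word H | w.1 = k}))
    (Submodule.span_le.2 ?_) hU
  rintro _ ⟨w, hw, rfl⟩
  exact h w hw

theorem eqOn_particleSpace {k : ℕ} {S T : Fock q H →L[ℂ] Fock q H}
    (h : ∀ w : Word H, w.1 = k → S (tensor q w) = T (tensor q w)) {x : Fock q H}
    (hx : x ∈ particleSpace q H k) : S x = T x := by
  have : particleSpace q H k ≤ (S - T).ker :=
    particleSpace_le (S - T).isClosed_ker fun w hw => by simp [h w hw]
  simpa [sub_eq_zero] using this hx

theorem mapsTo_particleSpace {k m : ℕ} {S : Fock q H →L[ℂ] Fock q H}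
    (h : ∀ w : Word H, w.1 = k → S (tensor q w) ∈ particleSpace q H m) {x : Fock q H}
    (hx : x ∈ particleSpace q H k) : S x ∈ particleSpace q H m := by
  have : particleSpace q H k ≤ (particleSpace q H m).comap (S : Fock q H →ₗ[ℂ] Fock q H) :=
    particleSpace_le ((Submodule.isClosed_topologicalClosure _).preimage S.continuous) h
  exact this hx

theorem creation_mem_particleSpace (h : H) {k : ℕ} {x : Fock q H}
    (hx : x ∈ particleSpace q H k) : creation q h x ∈ particleSpace q H (k + 1) := by
  refine mapsTo_particleSpace (fun w hw => ?_) hx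
  subst hw
  rw [creation_tensor]
  exact tensor_mem_particleSpace (consWord h w)

theorem flip_mem_particleSpace {k : ℕ} {x : Fock q H}
    (hx : x ∈ particleSpace q H k) : flip q H x ∈ particleSpace q H k := by
  refine mapsTo_particleSpace (fun w hw => ?_) hx
  subst hw
  rw [flip_tensor]
  exact tensor_mem_particleSpace (reverseWord w)

theorem creationRight_mem_particleSpace (h : H) {k : ℕ} {x : Fock q H}
    (hx : x ∈ particleSpace q H k) : creationRight q h x ∈ particleSpace q H (k + 1) := by
  rw [← flip_flip q (creationRight q h x), flip_creationRight]
  exact flip_mem_particleSpace (creation_mem_particleSpace h (flip_mem_particleSpace hx))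

theorem annihilation_mem_particleSpace (h : H) {k : ℕ} {x : Fock q H}
    (hx : x ∈ particleSpace q H (k + 1)) : annihilation q h x ∈ particleSpace q H k := by
  refine mapsTo_particleSpace (fun w hw => ?_) hx
  obtain ⟨n, w⟩ := w
  obtain rfl : n = k + 1 := hw
  rw [tensor, annihilation_coe, preAnnihilation, preLift_preWord, deletions]
  have : ((∑ j : Fin (k + 1), (((q : ℝ) ^ (j : ℕ) * ⟪h, w j⟫_ℝ : ℝ) : ℂ) •
      preWord q ⟨k, fun i => w (j.succAbove i)⟩ : PreFock q H) : Fock q H) =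
      ∑ j : Fin (k + 1), (((q : ℝ) ^ (j : ℕ) * ⟪h, w j⟫_ℝ : ℝ) : ℂ) •
      tensor q ⟨k, fun i => w (j.succAbove i)⟩ := by
    rw [← UniformSpace.Completion.coe_toComplL (𝕜 := ℂ), map_sum]
    simp only [map_smul]
    rfl
  rw [this]
  exact Submodule.sum_mem _ fun j _ => Submodule.smul_mem _ _
    (tensor_mem_particleSpace (⟨k, fun i => w (j.succAbove i)⟩ : Word H))

theorem annihilation_eq_zero_of_mem (h : H) {x : Fock q H}
    (hx : x ∈ particleSpace q H 0) : annihilation q h x = 0 := by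
  refine (eqOn_particleSpace (S := annihilation q h) (T := 0) (fun w hw => ?_) hx).trans rfl
  obtain ⟨n, w⟩ := w
  obtain rfl : n = 0 := hw
  rw [tensor, annihilation_coe, preAnnihilation, preLift_preWord, deletions,
    UniformSpace.Completion.coe_zero]
  rfl

theorem inner_eq_zero_of_particleSpace {k m : ℕ} (hkm : k ≠ m) {x y : Fock q H}
    (hx : x ∈ particleSpace q H k) (hy : y ∈ particleSpace q H m) : ⟪x, y⟫_ℂ = 0 := by
  have h1 : particleSpace q H k ≤ (particleSpace q H m)ᗮ := by
    refine particleSpace_le (Submodule.isClosed_orthogonal _) fun v hv => ?_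
    have h2 : particleSpace q H m ≤ (innerSL ℂ (tensor q v)).ker := by
      refine particleSpace_le (innerSL ℂ (tensor q v)).isClosed_ker fun w hw => ?_
      change ⟪tensor q v, tensor q w⟫_ℂ = 0
      rw [inner_tensor, wordInner_of_ne _ (by rw [hv, hw]; exact hkm), Complex.ofReal_zero]
    rw [Submodule.mem_orthogonal']
    exact fun u hu => h2 hu
  exact (Submodule.mem_orthogonal' _ _).1 (h1 hx) y hy

theorem annihilation_creationRight (h h' : H) {k : ℕ} {x : Fock q H}
    (hx : x ∈ particleSpace q H k) :
    annihilation q h (creationRight q h' x) =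
      creationRight q h' (annihilation q h x) + (((q : ℝ) ^ k * ⟪h, h'⟫_ℝ : ℝ) : ℂ) • x := by
  refine eqOn_particleSpace (S := annihilation q h ∘L creationRight q h')
    (T := creationRight q h' ∘L annihilation q h +
      (((q : ℝ) ^ k * ⟪h, h'⟫_ℝ : ℝ) : ℂ) • ContinuousLinearMap.id ℂ _) (fun w hw => ?_) hx
  subst hw
  exact annihilation_creationRight_tensor q h h' w

theorem creation_eq_creationRight_of_mem (h : H) {x : Fock q H}
    (hx : x ∈ particleSpace q H 0) : creation q h x = creationRight q h x := by
  refine eqOn_particleSpace (fun w hw => ?_) hx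
  obtain ⟨n, w⟩ := w
  obtain rfl : n = 0 := hw
  rw [creation_tensor, creationRight_tensor]
  simp only [consWord, snocWord]
  congr 2
  ext i
  obtain rfl : i = 0 := by omega
  rw [Fin.cons_zero]
  exact (Fin.snoc_last (α := fun _ => H) h w).symm

theorem eq_zero_of_forall_inner_particleSpace {x : Fock q H}
    (h : ∀ k, ∀ y ∈ particleSpace q H k, ⟪x, y⟫_ℂ = 0) : x = 0 := by
  have : innerSL ℂ x = 0 := clm_ext_tensor q fun w => h w.1 _ (tensor_mem_particleSpace w)
  have := DFunLike.congr_fun this x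
  exact inner_self_eq_zero.1 this

/-! ### Left and right actions commute -/

variable (q)

/-- Left and right Gaussian operators commute; the right one is the conjugate of the left one
by the flip. -/
theorem gaussian_comm_flip_gaussian (h h' : H) :
    gaussian q h ∘L (flip q H ∘L gaussian q h' ∘L flip q H) =
      (flip q H ∘L gaussian q h' ∘L flip q H) ∘L gaussian q h := by
  have e : flip q H ∘L gaussian q h' ∘L flip q H = creationRight q h' + annihilationRight q h' := by
    ext x
    simp [gaussian, flip_creation, flip_annihilation]
  have key : ∀ w, annihilation q h (creationRight q h' (tensor q w)) +
      creation q h (annihilationRight q h' (tensor q w)) =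
      creationRight q h' (annihilation q h (tensor q w)) +
      annihilationRight q h' (creation q h (tensor q w)) := by
    intro w
    have h1 := annihilation_creationRight_tensor q h h' w
    have h2 := congrArg (flip q H) (annihilation_creationRight_tensor q h' h (reverseWord w))
    rw [← flip_tensor] at h2
    simp only [flip_annihilation, flip_creationRight, map_add, map_smul, flip_flip,
      real_inner_comm h h'] at h2
    rw [h1, h2]
    simp only [reverseWord]
    abel
  have key' : annihilation q h ∘L creationRight q h' + creation q h ∘L annihilationRight q h' =
      creationRight q h' ∘L annihilation q h + annihilationRight q h' ∘L creation q h :=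
    clm_ext_tensor q key
  have c1 := creation_comm_creationRight q h h'
  have c2 : annihilation q h ∘L annihilationRight q h' =
      annihilationRight q h' ∘L annihilation q h := by
    have := congrArg ContinuousLinearMap.adjoint c1
    rw [ContinuousLinearMap.adjoint_comp, ContinuousLinearMap.adjoint_comp] at this
    exact this.symm
  rw [e]
  simp only [gaussian, ContinuousLinearMap.comp_add, ContinuousLinearMap.add_comp]
  rw [c1, c2]
  have aux : ∀ A X Y D Z W : Fock q H →L[ℂ] Fock q H, X + Y = W + Z →
      A + X + (Y + D) = A + Z + (W + D) := by
    intro A X Y D Z W h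
    have h' : A + X + (Y + D) = A + (X + Y) + D := by abel
    rw [h', h]
    abel
  exact aux _ _ _ _ _ _ key'

end

/-! ### Rescaled creation and annihilation operators -/

section

variable {H : Type*} [NormedAddCommGroup H] [InnerProductSpace ℝ H]
variable (q : Set.Ioo (-1 : ℝ) 1)

theorem one_sub_pos : 0 < 1 - (q : ℝ) := sub_pos.2 q.2.2

/-- `√(1 - q)`; multiplying creation and annihilation operators by it replaces the `q`-integers
`[n]_q` by the bounded numbers `1 - q ^ n`. -/
def scale : ℝ := √(1 - (q : ℝ))

theorem scale_pos : 0 < scale q := Real.sqrt_pos.2 (one_sub_pos q)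

theorem scale_sq : scale q ^ 2 = 1 - (q : ℝ) := Real.sq_sqrt (one_sub_pos q).le

theorem scale_mul_scale : ((scale q : ℝ) : ℂ) * (scale q : ℝ) = 1 - ((q : ℝ) : ℂ) := by
  rw [← Complex.ofReal_mul, ← sq, scale_sq]
  simp

/-- The rescaled left creation operator `√(1 - q) c(e)`. -/
def leftCre (e : H) : Fock q H →L[ℂ] Fock q H := (scale q : ℂ) • creation q e

/-- The rescaled left annihilation operator `√(1 - q) a(e)`. -/
def leftAnn (e : H) : Fock q H →L[ℂ] Fock q H := (scale q : ℂ) • annihilation q e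

/-- The rescaled right creation operator `√(1 - q) c_r(e)`. -/
def rightCre (e : H) : Fock q H →L[ℂ] Fock q H := (scale q : ℂ) • creationRight q e

/-- The rescaled right annihilation operator `√(1 - q) a_r(e)`. -/
def rightAnn (e : H) : Fock q H →L[ℂ] Fock q H := (scale q : ℂ) • annihilationRight q e

/-- The rescaled vector `(1 - q) ^ ((r + s) / 2) e^{⊗ r} ⊗ ξ ⊗ e^{⊗ s}`. -/
def scaledPad (e : H) (r s : ℕ) (ξ : Fock q H) : Fock q H :=
  (leftCre q e ^ r) ((rightCre q e ^ s) ξ)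

variable (e : H)

theorem inner_leftCre (x y : Fock q H) : ⟪leftCre q e x, y⟫_ℂ = ⟪x, leftAnn q e y⟫_ℂ := by
  rw [leftCre, leftAnn, smul_apply, smul_apply, inner_smul_left,
    inner_smul_right, annihilation, ContinuousLinearMap.adjoint_inner_right, Complex.conj_ofReal]

theorem inner_rightCre (x y : Fock q H) : ⟪rightCre q e x, y⟫_ℂ = ⟪x, rightAnn q e y⟫_ℂ := by
  rw [rightCre, rightAnn, smul_apply, smul_apply, inner_smul_left,
    inner_smul_right, annihilationRight, ContinuousLinearMap.adjoint_inner_right,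
    Complex.conj_ofReal]

theorem inner_leftCre_pow (n : ℕ) (x y : Fock q H) :
    ⟪(leftCre q e ^ n) x, y⟫_ℂ = ⟪x, (leftAnn q e ^ n) y⟫_ℂ := by
  induction n generalizing x with
  | zero => simp
  | succ n ih =>
    rw [pow_succ, mul_apply_eq_comp, ih, inner_leftCre, pow_succ',
      mul_apply_eq_comp]

theorem scaledPad_eq (r s : ℕ) (ξ : Fock q H) :
    scaledPad q e r s ξ = ((scale q ^ (r + s) : ℝ) : ℂ) • pad q e r s ξ := by
  simp only [scaledPad, pad, leftCre, rightCre, smul_pow, smul_apply, map_smul, smul_smul,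
    pow_add, Complex.ofReal_mul, Complex.ofReal_pow]
  rw [mul_comm]

theorem leftCre_scaledPad (r s : ℕ) (ξ : Fock q H) :
    leftCre q e (scaledPad q e r s ξ) = scaledPad q e (r + 1) s ξ := by
  simp [scaledPad, pow_succ']

theorem leftCre_rightCre_comm : Commute (leftCre q e) (rightCre q e) := by
  have := creation_comm_creationRight q e e
  change leftCre q e ∘L rightCre q e = rightCre q e ∘L leftCre q e
  simp [leftCre, rightCre, this]

theorem scaledPad_eq' (r s : ℕ) (ξ : Fock q H) :
    scaledPad q e r s ξ = (rightCre q e ^ s) ((leftCre q e ^ r) ξ) :=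
  DFunLike.congr_fun ((leftCre_rightCre_comm q e).pow_pow r s) ξ

theorem rightCre_scaledPad (r s : ℕ) (ξ : Fock q H) :
    rightCre q e (scaledPad q e r s ξ) = scaledPad q e r (s + 1) ξ := by
  simp [scaledPad_eq', pow_succ']

theorem flip_leftCre (x : Fock q H) :
    flip q H (leftCre q e x) = rightCre q e (flip q H x) := by
  simp [leftCre, rightCre, flip_creation]

theorem flip_rightCre (x : Fock q H) :
    flip q H (rightCre q e x) = leftCre q e (flip q H x) := by
  simp [leftCre, rightCre, flip_creationRight]

theorem flip_leftAnn (x : Fock q H) :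
    flip q H (leftAnn q e x) = rightAnn q e (flip q H x) := by
  simp [leftAnn, rightAnn, flip_annihilation]

theorem flip_scaledPad (r s : ℕ) (ξ : Fock q H) :
    flip q H (scaledPad q e r s ξ) = scaledPad q e s r (flip q H ξ) := by
  have h1 : ∀ n x, flip q H ((leftCre q e ^ n) x) = (rightCre q e ^ n) (flip q H x) := by
    intro n
    induction n with
    | zero => simp
    | succ n ih => intro x; simp only [pow_succ', mul_apply_eq_comp, flip_leftCre, ih]
  have h2 : ∀ n x, flip q H ((rightCre q e ^ n) x) = (leftCre q e ^ n) (flip q H x) := by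
    intro n
    induction n with
    | zero => simp
    | succ n ih => intro x; simp only [pow_succ', mul_apply_eq_comp, flip_rightCre, ih]
  rw [scaledPad, h1, h2, scaledPad_eq']

variable {q e}

theorem flip_mem_kernelSpace {k : ℕ} {ξ : Fock q H} (hξ : ξ ∈ kernelSpace q e k) :
    flip q H ξ ∈ kernelSpace q e k := by
  obtain ⟨⟨h1, h2⟩, h3⟩ := hξ
  have h2' : annihilation q e ξ = 0 := h2
  have h3' : annihilationRight q e ξ = 0 := h3
  refine ⟨⟨flip_mem_particleSpace h1, ?_⟩, ?_⟩
  · change annihilation q e (flip q H ξ) = 0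
    rw [← flip_annihilationRight, h3', map_zero]
  · change annihilationRight q e (flip q H ξ) = 0
    rw [← flip_annihilation, h2', map_zero]

theorem leftAnn_eq_zero {k : ℕ} {ξ : Fock q H} (hξ : ξ ∈ kernelSpace q e k) :
    leftAnn q e ξ = 0 := by
  have h : annihilation q e ξ = 0 := hξ.1.2
  simp [leftAnn, h]

theorem rightAnn_eq_zero {k : ℕ} {ξ : Fock q H} (hξ : ξ ∈ kernelSpace q e k) :
    rightAnn q e ξ = 0 := by
  have h : annihilationRight q e ξ = 0 := hξ.2
  simp [rightAnn, h]

theorem leftCre_mem {k : ℕ} {x : Fock q H} (hx : x ∈ particleSpace q H k) :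
    leftCre q e x ∈ particleSpace q H (k + 1) := by
  rw [leftCre, smul_apply]
  exact Submodule.smul_mem _ _ (creation_mem_particleSpace e hx)

theorem rightCre_mem {k : ℕ} {x : Fock q H} (hx : x ∈ particleSpace q H k) :
    rightCre q e x ∈ particleSpace q H (k + 1) := by
  rw [rightCre, smul_apply]
  exact Submodule.smul_mem _ _ (creationRight_mem_particleSpace e hx)

theorem rightCre_pow_mem {k : ℕ} {ξ : Fock q H} (hξ : ξ ∈ particleSpace q H k) (s : ℕ) :
    (rightCre q e ^ s) ξ ∈ particleSpace q H (k + s) := by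
  induction s with
  | zero => simpa
  | succ s ih =>
    rw [pow_succ', mul_apply_eq_comp, ← add_assoc]
    exact rightCre_mem ih

theorem scaledPad_mem {k : ℕ} {ξ : Fock q H} (hξ : ξ ∈ particleSpace q H k) (r s : ℕ) :
    scaledPad q e r s ξ ∈ particleSpace q H (k + s + r) := by
  induction r with
  | zero => 
    rw [scaledPad, pow_zero, add_zero]
    exact rightCre_pow_mem hξ s
  | succ r ih =>
    rw [← leftCre_scaledPad, ← add_assoc]
    exact leftCre_mem ih

theorem leftAnn_leftCre (he : ‖e‖ = 1) (x : Fock q H) :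
    leftAnn q e (leftCre q e x) =
      (1 - ((q : ℝ) : ℂ)) • x + ((q : ℝ) : ℂ) • leftCre q e (leftAnn q e x) := by
  have h := DFunLike.congr_fun (annihilation_comp_creation q e) x
  simp only [ContinuousLinearMap.comp_apply, add_apply,
    smul_apply, ContinuousLinearMap.id_apply, he, one_pow,
    Complex.ofReal_one, one_smul] at h
  simp only [leftAnn, leftCre, smul_apply, map_smul, h, ← scale_mul_scale]
  module

/-- The rescaled commutation relation `a c ^ n = q ^ n c ^ n a + (1 - q ^ n) c ^ (n - 1)`. -/
theorem leftAnn_leftCre_pow (he : ‖e‖ = 1) (n : ℕ) (x : Fock q H) :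
    leftAnn q e ((leftCre q e ^ n) x) =
      ((q : ℝ) : ℂ) ^ n • (leftCre q e ^ n) (leftAnn q e x) +
        (1 - ((q : ℝ) : ℂ) ^ n) • (leftCre q e ^ (n - 1)) x := by
  induction n with
  | zero => simp
  | succ n ih =>
    rw [pow_succ', mul_apply_eq_comp, leftAnn_leftCre he, ih, map_add, map_smul,
      map_smul, mul_apply_eq_comp, Nat.add_sub_cancel]
    cases n with
    | zero => simp; module
    | succ n =>
      have : leftCre q e ((leftCre q e ^ (n + 1 - 1)) x) = (leftCre q e ^ (n + 1)) x := by
        rw [pow_succ', mul_apply_eq_comp, Nat.add_sub_cancel]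
      rw [this, pow_succ _ (n + 1)]
      module

/-- On the `k`-particle space, `a(e)` and `c_r(e)` commute up to the scalar `q ^ k`, which in the
rescaled form becomes `(1 - q) q ^ k`. -/
theorem leftAnn_rightCre (he : ‖e‖ = 1) {k : ℕ} {x : Fock q H} (hx : x ∈ particleSpace q H k) :
    leftAnn q e (rightCre q e x) =
      rightCre q e (leftAnn q e x) + ((1 - ((q : ℝ) : ℂ)) * ((q : ℝ) : ℂ) ^ k) • x := by
  have h := annihilation_creationRight e e hx
  simp only [real_inner_self_eq_norm_sq, he, one_pow, mul_one] at h
  simp only [leftAnn, rightCre, smul_apply, map_smul, h, ← scale_mul_scale]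
  push_cast
  module

theorem leftAnn_rightCre_pow (he : ‖e‖ = 1) {k : ℕ} {ξ : Fock q H}
    (hξ : ξ ∈ kernelSpace q e k) (s : ℕ) :
    leftAnn q e ((rightCre q e ^ s) ξ) =
      (((q : ℝ) : ℂ) ^ k * (1 - ((q : ℝ) : ℂ) ^ s)) • (rightCre q e ^ (s - 1)) ξ := by
  induction s with
  | zero => simp [leftAnn_eq_zero hξ]
  | succ s ih =>
    rw [pow_succ', mul_apply_eq_comp,
      leftAnn_rightCre he (rightCre_pow_mem hξ.1.1 s), ih, map_smul, Nat.add_sub_cancel]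
    cases s with
    | zero => simp; module
    | succ s =>
      have : rightCre q e ((rightCre q e ^ (s + 1 - 1)) ξ) = (rightCre q e ^ (s + 1)) ξ := by
        rw [pow_succ', mul_apply_eq_comp, Nat.add_sub_cancel]
      rw [this, pow_succ _ (s + 1), pow_add _ k]
      module

/-- The left annihilation operator removes a letter `e` on the left, or, with a factor that decays
in `r` and `k`, one on the right. -/
theorem leftAnn_scaledPad (he : ‖e‖ = 1) {k : ℕ} {ξ : Fock q H}
    (hξ : ξ ∈ kernelSpace q e k) (r s : ℕ) :
    leftAnn q e (scaledPad q e r s ξ) =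
      (1 - ((q : ℝ) : ℂ) ^ r) • scaledPad q e (r - 1) s ξ +
        (((q : ℝ) : ℂ) ^ (r + k) * (1 - ((q : ℝ) : ℂ) ^ s)) • scaledPad q e r (s - 1) ξ := by
  rw [scaledPad, leftAnn_leftCre_pow he, leftAnn_rightCre_pow he hξ, map_smul, scaledPad, scaledPad,
    pow_add]
  module

theorem rightAnn_scaledPad (he : ‖e‖ = 1) {k : ℕ} {ξ : Fock q H}
    (hξ : ξ ∈ kernelSpace q e k) (r s : ℕ) :
    rightAnn q e (scaledPad q e r s ξ) =
      (1 - ((q : ℝ) : ℂ) ^ s) • scaledPad q e r (s - 1) ξ +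
        (((q : ℝ) : ℂ) ^ (s + k) * (1 - ((q : ℝ) : ℂ) ^ r)) • scaledPad q e (r - 1) s ξ := by
  have h := congrArg (flip q H) (leftAnn_scaledPad he (flip_mem_kernelSpace hξ) s r)
  simpa only [flip_leftAnn, map_add, map_smul, flip_scaledPad, flip_flip] using h

/-! ### Inner products of padded vectors -/

theorem inner_scaledPad_succ_left (he : ‖e‖ = 1) {k : ℕ} (ξ : Fock q H) {η : Fock q H}
    (hη : η ∈ kernelSpace q e k) (r s r' s' : ℕ) :
    ⟪scaledPad q e (r + 1) s ξ, scaledPad q e r' s' η⟫_ℂ =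
      (1 - ((q : ℝ) : ℂ) ^ r') * ⟪scaledPad q e r s ξ, scaledPad q e (r' - 1) s' η⟫_ℂ +
      (((q : ℝ) : ℂ) ^ (r' + k) * (1 - ((q : ℝ) : ℂ) ^ s')) *
        ⟪scaledPad q e r s ξ, scaledPad q e r' (s' - 1) η⟫_ℂ := by
  rw [← leftCre_scaledPad, inner_leftCre, leftAnn_scaledPad he hη, inner_add_right,
    inner_smul_right, inner_smul_right]

theorem inner_scaledPad_succ_right (he : ‖e‖ = 1) {k : ℕ} (ξ : Fock q H) {η : Fock q H}
    (hη : η ∈ kernelSpace q e k) (r s r' s' : ℕ) :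
    ⟪scaledPad q e r (s + 1) ξ, scaledPad q e r' s' η⟫_ℂ =
      (1 - ((q : ℝ) : ℂ) ^ s') * ⟪scaledPad q e r s ξ, scaledPad q e r' (s' - 1) η⟫_ℂ +
      (((q : ℝ) : ℂ) ^ (s' + k) * (1 - ((q : ℝ) : ℂ) ^ r')) *
        ⟪scaledPad q e r s ξ, scaledPad q e (r' - 1) s' η⟫_ℂ := by
  rw [← rightCre_scaledPad, inner_rightCre, rightAnn_scaledPad he hη, inner_add_right,
    inner_smul_right, inner_smul_right]

theorem inner_scaledPad_zero {k : ℕ} {ξ : Fock q H} (hξ : ξ ∈ kernelSpace q e k) (η : Fock q H)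
    {r s : ℕ} (h : r + s ≠ 0) : ⟪ξ, scaledPad q e r s η⟫_ℂ = 0 := by
  rw [← inner_conj_symm]
  cases r with
  | succ r => rw [← leftCre_scaledPad, inner_leftCre, leftAnn_eq_zero hξ]; simp
  | zero =>
    cases s with
    | zero => exact absurd rfl h
    | succ s => rw [← rightCre_scaledPad, inner_rightCre, rightAnn_eq_zero hξ]; simp

/-- Padded vectors of different particle numbers, or built on orthogonal vectors, are orthogonal. -/
theorem inner_scaledPad_eq_zero (he : ‖e‖ = 1) {k l : ℕ} {ξ η : Fock q H}
    (hξ : ξ ∈ kernelSpace q e k) (hη : η ∈ kernelSpace q e l) :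
    ∀ (n r s r' s' : ℕ), r + s = n → (r + s ≠ r' + s' ∨ ⟪ξ, η⟫_ℂ = 0) →
      ⟪scaledPad q e r s ξ, scaledPad q e r' s' η⟫_ℂ = 0 := by
  intro n
  induction n with
  | zero =>
    intro r s r' s' hn h
    obtain ⟨rfl, rfl⟩ : r = 0 ∧ s = 0 := by omega
    by_cases h0 : r' + s' = 0
    · obtain ⟨rfl, rfl⟩ : r' = 0 ∧ s' = 0 := by omega
      exact h.resolve_left (by omega)
    · exact inner_scaledPad_zero hξ η h0
  | succ n ih =>
    intro r s r' s' hn h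
    have h1 : ∀ r s, r + s = n → r + s + 1 ≠ r' + s' ∨ ⟪ξ, η⟫_ℂ = 0 →
        (1 - ((q : ℝ) : ℂ) ^ r') * ⟪scaledPad q e r s ξ, scaledPad q e (r' - 1) s' η⟫_ℂ = 0 := by
      intro r s hn h
      rcases Nat.eq_zero_or_pos r' with h0 | h0
      · simp [h0]
      · rw [ih r s _ _ hn (h.imp_left fun h => by omega), mul_zero]
    have h2 : ∀ r s, r + s = n → r + s + 1 ≠ r' + s' ∨ ⟪ξ, η⟫_ℂ = 0 →
        (1 - ((q : ℝ) : ℂ) ^ s') * ⟪scaledPad q e r s ξ, scaledPad q e r' (s' - 1) η⟫_ℂ = 0 := by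
      intro r s hn h
      rcases Nat.eq_zero_or_pos s' with h0 | h0
      · simp [h0]
      · rw [ih r s _ _ hn (h.imp_left fun h => by omega), mul_zero]
    cases r with
    | succ r =>
      have hn' : r + s = n := by omega
      have h' : r + s + 1 ≠ r' + s' ∨ ⟪ξ, η⟫_ℂ = 0 := h.imp_left fun h => by omega
      rw [inner_scaledPad_succ_left he ξ hη, h1 r s hn' h', mul_assoc, h2 r s hn' h', mul_zero,
        add_zero]
    | zero =>
      cases s with
      | zero => omega
      | succ s =>
        have hn' : 0 + s = n := by omega
        have h' : 0 + s + 1 ≠ r' + s' ∨ ⟪ξ, η⟫_ℂ = 0 := h.imp_left fun h => by omega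
        rw [inner_scaledPad_succ_right he ξ hη, h2 0 s hn' h', mul_assoc, h1 0 s hn' h', mul_zero,
          add_zero]

theorem vacuum_mem_kernelSpace (e : H) : vacuum q H ∈ kernelSpace q e 0 := by
  refine ⟨⟨vacuum_mem_particleSpace, annihilation_vacuum q e⟩, ?_⟩
  change annihilationRight q e (vacuum q H) = 0
  rw [← flip_vacuum, ← flip_annihilation, annihilation_vacuum, map_zero]

theorem norm_vacuum : ‖vacuum q H‖ = 1 := by
  have h : ⟪vacuum q H, vacuum q H⟫_ℂ = 1 := by
    rw [vacuum, inner_tensor, wordInner_mk]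
    simp [inversions]
  rw [inner_self_eq_norm_sq_to_K, RCLike.ofReal_eq_complex_ofReal] at h
  have h' : ‖vacuum q H‖ ^ 2 = 1 := by exact_mod_cast h
  exact (pow_eq_one_iff_of_nonneg (norm_nonneg _) two_ne_zero).1 h'

/-! ### Totality of the padded vectors -/

/-- A vector of the `n`-particle space that is orthogonal to all `ξ_{r,s}` vanishes: its images
under `a(e)` and `a_r(e)` have the same property one level down, so it lies in `T^n` itself. -/
theorem eq_zero_of_mem_particleSpace (n : ℕ) : ∀ x ∈ particleSpace q H n,
    (∀ k r s, ∀ ξ ∈ kernelSpace q e k, ⟪scaledPad q e r s ξ, x⟫_ℂ = 0) → x = 0 := by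
  induction n with
  | zero =>
    intro x hx h
    have hx' : x ∈ kernelSpace q e 0 := by
      refine ⟨⟨hx, annihilation_eq_zero_of_mem e hx⟩, ?_⟩
      change annihilationRight q e x = 0
      rw [← flip_flip q x, ← flip_annihilation,
        annihilation_eq_zero_of_mem e (flip_mem_particleSpace hx), map_zero]
    exact inner_self_eq_zero.1 (h 0 0 0 x hx')
  | succ n ih =>
    intro x hx h
    have hl : leftAnn q e x = 0 := by
      refine ih _ (Submodule.smul_mem _ _ (annihilation_mem_particleSpace e hx)) ?_
      intro k r s ξ hξ
      rw [← inner_leftCre, leftCre_scaledPad]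
      exact h k (r + 1) s ξ hξ
    have hr : rightAnn q e x = 0 := by
      refine ih _ ?_ ?_
      · rw [← flip_flip q x, ← flip_leftAnn]
        exact flip_mem_particleSpace
          (Submodule.smul_mem _ _ (annihilation_mem_particleSpace e (flip_mem_particleSpace hx)))
      · intro k r s ξ hξ
        rw [← inner_rightCre, rightCre_scaledPad]
        exact h k r (s + 1) ξ hξ
    have h0 : ((scale q : ℝ) : ℂ) ≠ 0 := by exact_mod_cast (scale_pos q).ne'
    have hx' : x ∈ kernelSpace q e (n + 1) :=
      ⟨⟨hx, (smul_eq_zero.1 hl).resolve_left h0⟩, (smul_eq_zero.1 hr).resolve_left h0⟩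
    exact inner_self_eq_zero.1 (h (n + 1) 0 0 x hx')

instance (k : ℕ) : CompleteSpace (particleSpace q H k) :=
  (Submodule.isClosed_topologicalClosure _).completeSpace_coe

theorem eq_zero_of_forall_inner_scaledPad {x : Fock q H}
    (h : ∀ k r s, ∀ ξ ∈ kernelSpace q e k, ⟪scaledPad q e r s ξ, x⟫_ℂ = 0) : x = 0 := by
  have h1 : ∀ n, (particleSpace q H n).starProjection x = 0 := by
    intro n
    refine eq_zero_of_mem_particleSpace (e := e) n _ (Submodule.starProjection_apply_mem _ _) ?_
    intro k r s ξ hξ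
    rw [← Submodule.inner_starProjection_left_eq_right]
    by_cases hn : k + s + r = n
    · subst hn
      rw [Submodule.starProjection_eq_self_iff.2 (scaledPad_mem hξ.1.1 r s), h k r s ξ hξ]
    · rw [Submodule.inner_starProjection_left_eq_right]
      exact inner_eq_zero_of_particleSpace hn (scaledPad_mem hξ.1.1 r s)
        (Submodule.starProjection_apply_mem _ _)
  refine eq_zero_of_forall_inner_particleSpace fun k y hy => ?_
  rw [← Submodule.starProjection_eq_self_iff.2 hy, ← Submodule.inner_starProjection_left_eq_right,
    h1, inner_zero_left]

end

/-! ### Products `∏ (1 - q ^ j)` -/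

section

/-- The finite Euler product `∏_{j = 1}^n (1 - q ^ j)`. -/
def eulerProd (q : ℝ) (n : ℕ) : ℝ := ∏ j ∈ Finset.range n, (1 - q ^ (j + 1))

theorem eulerProd_succ (q : ℝ) (n : ℕ) :
    eulerProd q (n + 1) = eulerProd q n * (1 - q ^ (n + 1)) := Finset.prod_range_succ _ _

theorem eulerProd_zero (q : ℝ) : eulerProd q 0 = 1 := Finset.prod_range_zero _

theorem sum_pow_succ_le {t : ℝ} (h0 : 0 ≤ t) (h1 : t < 1) (n : ℕ) :
    ∑ j ∈ Finset.range n, t ^ (j + 1) ≤ t / (1 - t) := by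
  simp only [pow_succ']
  rw [← Finset.mul_sum, div_eq_mul_inv, ← tsum_geometric_of_lt_one h0 h1]
  exact mul_le_mul_of_nonneg_left ((summable_geometric_of_lt_one h0 h1).sum_le_tsum _
    fun i _ => pow_nonneg h0 i) h0

theorem pow_le_abs_pow (q : ℝ) (n : ℕ) : q ^ n ≤ |q| ^ n :=
  (le_abs_self _).trans_eq (abs_pow q n)

theorem eulerProd_le {q : ℝ} (h : |q| < 1) (n : ℕ) :
    eulerProd q n ≤ Real.exp (|q| / (1 - |q|)) := by
  calc eulerProd q n ≤ ∏ j ∈ Finset.range n, Real.exp (|q| ^ (j + 1)) := by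
        refine Finset.prod_le_prod (fun j _ => ?_) fun j _ => ?_
        · have := (pow_le_abs_pow q (j + 1)).trans
            (pow_le_one₀ (n := j + 1) (abs_nonneg q) h.le)
          linarith
        · have h1 := Real.add_one_le_exp (|q| ^ (j + 1))
          have h2 := neg_abs_le (q ^ (j + 1))
          rw [abs_pow] at h2
          linarith
    _ = Real.exp (∑ j ∈ Finset.range n, |q| ^ (j + 1)) := (Real.exp_sum _ _).symm
    _ ≤ _ := Real.exp_le_exp.2 (sum_pow_succ_le (abs_nonneg q) h n)

theorem le_eulerProd {q : ℝ} (h : |q| < 1) (n : ℕ) :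
    Real.exp (-(|q| / (1 - |q|) ^ 2)) ≤ eulerProd q n := by
  have h' : 0 < 1 - |q| := sub_pos.2 h
  calc Real.exp (-(|q| / (1 - |q|) ^ 2))
      ≤ Real.exp (∑ j ∈ Finset.range n, -(|q| ^ (j + 1) / (1 - |q|))) := by
        refine Real.exp_le_exp.2 ?_
        rw [Finset.sum_neg_distrib, ← Finset.sum_div, neg_le_neg_iff, sq, ← div_div]
        exact div_le_div_of_nonneg_right (sum_pow_succ_le (abs_nonneg q) h n) h'.le
    _ = ∏ j ∈ Finset.range n, Real.exp (-(|q| ^ (j + 1) / (1 - |q|))) := Real.exp_sum _ _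
    _ ≤ eulerProd q n := by
        refine Finset.prod_le_prod (fun j _ => (Real.exp_pos _).le) fun j _ => ?_
        have hq : |q| ^ (j + 1) ≤ |q| := pow_le_of_le_one (abs_nonneg q) h.le (by omega)
        have h1 : 0 < 1 - |q| ^ (j + 1) := by linarith
        have h2 := Real.one_sub_inv_le_log_of_pos h1
        have h3 : -(|q| ^ (j + 1) / (1 - |q|)) ≤ 1 - (1 - |q| ^ (j + 1))⁻¹ := by
          have h4 : 1 - (1 - |q| ^ (j + 1))⁻¹ = -(|q| ^ (j + 1) / (1 - |q| ^ (j + 1))) := by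
            field_simp
            ring
          rw [h4, neg_le_neg_iff]
          exact div_le_div_of_nonneg_left (by positivity) h' (by linarith)
        calc _ ≤ Real.exp (Real.log (1 - |q| ^ (j + 1))) := Real.exp_le_exp.2 (h3.trans h2)
          _ = 1 - |q| ^ (j + 1) := Real.exp_log h1
          _ ≤ _ := by linarith [pow_le_abs_pow q (j + 1)]

theorem eulerProd_pos {q : ℝ} (h : |q| < 1) (n : ℕ) : 0 < eulerProd q n :=
  (Real.exp_pos _).trans_le (le_eulerProd h n)

theorem exp_le_one_div {x : ℝ} (hx : x < 1) : Real.exp x ≤ 1 / (1 - x) := by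
  rw [le_div_iff₀ (by linarith)]
  have h1 := Real.one_sub_le_exp_neg x
  calc Real.exp x * (1 - x) ≤ Real.exp x * Real.exp (-x) :=
        mul_le_mul_of_nonneg_left h1 (Real.exp_pos _).le
    _ = 1 := by rw [← Real.exp_add]; simp

theorem eulerProd_mem_of_small {q : ℝ} (h : |q| ≤ 1 / 100) (n : ℕ) :
    49 / 50 ≤ eulerProd q n ∧ eulerProd q n ≤ 51 / 50 := by
  have h0 := abs_nonneg q
  have h1 : |q| / (1 - |q|) ≤ 1 / 99 := by
    rw [div_le_iff₀ (by linarith)]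
    linarith
  have h2 : |q| / (1 - |q|) ^ 2 ≤ 1 / 50 := by
    rw [div_le_iff₀ (by nlinarith)]
    nlinarith
  constructor
  · refine le_trans ?_ (le_eulerProd (by linarith) n)
    have := Real.one_sub_le_exp_neg (|q| / (1 - |q|) ^ 2)
    linarith
  · refine (eulerProd_le (by linarith) n).trans ((Real.exp_le_exp.2 h1).trans
      ((exp_le_one_div (by norm_num)).trans (by norm_num)))

/-! ### Decay of the Gram matrix -/

/-- The two recursions satisfied by the inner products of `ξ_{r,s}` and `η_{r',s'}`. -/
def IsPadGram (Q : ℂ) (k : ℕ) (f : ℕ → ℕ → ℕ → ℕ → ℂ) : Prop :=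
  (∀ r s r' s', f (r + 1) s r' s' =
    (1 - Q ^ r') * f r s (r' - 1) s' + Q ^ (r' + k) * (1 - Q ^ s') * f r s r' (s' - 1)) ∧
  ∀ r s r' s', f r (s + 1) r' s' =
    (1 - Q ^ s') * f r s r' (s' - 1) + Q ^ (s' + k) * (1 - Q ^ r') * f r s (r' - 1) s'

theorem IsPadGram.swap {Q : ℂ} {k : ℕ} {f : ℕ → ℕ → ℕ → ℕ → ℂ} (h : IsPadGram Q k f) :
    IsPadGram Q k fun r s r' s' => f s r s' r' :=
  ⟨fun r s r' s' => h.2 s r s' r', fun r s r' s' => h.1 s r s' r'⟩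

/-- The product `∏_{j = 1}^m (1 + 4 t ^ j)`, which absorbs the error terms of the recursion. -/
def growth (t : ℝ) (m : ℕ) : ℝ := ∏ j ∈ Finset.range m, (1 + 4 * t ^ (j + 1))

theorem growth_succ (t : ℝ) (m : ℕ) :
    growth t (m + 1) = growth t m * (1 + 4 * t ^ (m + 1)) := Finset.prod_range_succ _ _

theorem growth_pos {t : ℝ} (h0 : 0 ≤ t) (m : ℕ) : 0 < growth t m :=
  Finset.prod_pos fun j _ => by positivity

theorem growth_le_succ {t : ℝ} (h0 : 0 ≤ t) (m : ℕ) : growth t m ≤ growth t (m + 1) := by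
  rw [growth_succ]
  exact le_mul_of_one_le_right (growth_pos h0 m).le (by linarith [pow_nonneg h0 (m + 1)])

theorem growth_le_of_small {t : ℝ} (h0 : 0 ≤ t) (h1 : t ≤ 1 / 100) (m : ℕ) :
    growth t m ≤ 11 / 10 := by
  calc growth t m ≤ ∏ j ∈ Finset.range m, Real.exp (4 * t ^ (j + 1)) := by
        refine Finset.prod_le_prod (fun j _ => by positivity) fun j _ => ?_
        linarith [Real.add_one_le_exp (4 * t ^ (j + 1))]
    _ = Real.exp (4 * ∑ j ∈ Finset.range m, t ^ (j + 1)) := by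
        rw [← Real.exp_sum, Finset.mul_sum]
    _ ≤ Real.exp (4 / 99) := by
        refine Real.exp_le_exp.2 ?_
        have h2 := sum_pow_succ_le h0 (by linarith) m
        have h3 : t / (1 - t) ≤ 1 / 99 := by
          rw [div_le_iff₀ (by linarith)]
          linarith
        linarith
    _ ≤ _ := (exp_le_one_div (by norm_num)).trans (by norm_num)

theorem norm_one_sub_pow_le (Q : ℂ) (n : ℕ) : ‖1 - Q ^ n‖ ≤ 1 + ‖Q‖ ^ n := by
  simpa using norm_sub_le 1 (Q ^ n)

/-- The bound on the Gram matrix passes from particle number `n` to `n + 1`, for entries whose first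
vector starts with a letter `e` that can be removed and with `r' ≤ r + 1`. -/
theorem IsPadGram.norm_le_step {Q : ℂ} {k : ℕ} (hk : 1 ≤ k) {f : ℕ → ℕ → ℕ → ℕ → ℂ}
    (h : IsPadGram Q k f) (hQ : ‖Q‖ ≤ 1 / 4) {K : ℝ} (hK : 0 ≤ K) {n : ℕ}
    (ih : ∀ r s r' s', r + s = n → r' + s' = n → ‖f r s r' s'‖ ≤
      K * ‖Q‖ ^ ((r - r') + (r' - r)) *
        (growth ‖Q‖ r * growth ‖Q‖ s * growth ‖Q‖ r' * growth ‖Q‖ s'))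
    {r s r' s' : ℕ} (h1 : r + 1 + s = n + 1) (h2 : r' + s' = n + 1) (hr : r' ≤ r + 1) :
    ‖f (r + 1) s r' s'‖ ≤ K * ‖Q‖ ^ ((r + 1 - r') + (r' - (r + 1))) *
      (growth ‖Q‖ (r + 1) * growth ‖Q‖ s * growth ‖Q‖ r' * growth ‖Q‖ s') := by
  set t := ‖Q‖ with ht
  have ht0 : 0 ≤ t := norm_nonneg _
  have ht1 : t ≤ 1 := by linarith
  have g0 := fun m => (growth_pos ht0 m).le
  have hrs : r + s = n := by omega
  have hsm : ∀ m, (1 + t ^ (m + 1)) * growth t m ≤ growth t (m + 1) := by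
    intro m
    rw [growth_succ, mul_comm]
    exact mul_le_mul_of_nonneg_left (by linarith [pow_nonneg ht0 (m + 1)]) (g0 m)
  -- the second summand of the recursion
  have second : s' ≠ 0 → ∀ D : ℕ, D + r' ≤ r' + k + ((r - r') + (r' - r)) →
      ‖Q ^ (r' + k) * (1 - Q ^ s') * f r s r' (s' - 1)‖ ≤
      K * t ^ (D + r') * (growth t r * growth t s * growth t r' * growth t s') := by
    intro hs' D hD
    obtain ⟨m, rfl⟩ := Nat.exists_eq_succ_of_ne_zero hs'
    have h3 := ih r s r' m hrs (by omega)
    have h4 := norm_one_sub_pow_le Q (m + 1)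
    rw [norm_mul, norm_mul, norm_pow, ← ht]
    rw [← ht] at h4
    calc t ^ (r' + k) * ‖1 - Q ^ (m + 1)‖ * ‖f r s r' m‖
        ≤ t ^ (r' + k) * (1 + t ^ (m + 1)) * (K * t ^ ((r - r') + (r' - r)) *
          (growth t r * growth t s * growth t r' * growth t m)) := by gcongr
      _ = K * t ^ (r' + k + ((r - r') + (r' - r))) *
          (growth t r * growth t s * growth t r' * ((1 + t ^ (m + 1)) * growth t m)) := by
          rw [pow_add t (r' + k)]; ring
      _ ≤ K * t ^ (D + r') * (growth t r * growth t s * growth t r' * growth t (m + 1)) := by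
          have := pow_le_pow_of_le_one ht0 ht1 hD
          have := hsm m
          have := g0 r
          have := g0 s
          have := g0 r'
          have := g0 m
          gcongr
  rw [h.1]
  cases r' with
  | zero =>
    have h5 := second (by omega) (r + 1) (by omega)
    have g1 := growth_le_succ ht0 r
    simp only [pow_zero, sub_self, zero_mul, zero_add, Nat.sub_zero, Nat.zero_sub, add_zero] at h5 ⊢
    refine h5.trans ?_
    have := g0 s
    have := g0 0
    have := g0 s'
    gcongr
  | succ p =>
    have e1 : (r + 1 - (p + 1)) + (p + 1 - (r + 1)) = r - p := by omega
    rw [e1]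
    have h6 : ‖(1 - Q ^ (p + 1)) * f r s (p + 1 - 1) s'‖ ≤ K * t ^ (r - p) *
        (growth t r * growth t s * ((1 + t ^ (p + 1)) * growth t p) * growth t s') := by
      have h7 := ih r s p s' hrs (by omega)
      have h8 := norm_one_sub_pow_le Q (p + 1)
      rw [← ht] at h8
      have e2 : (r - p) + (p - r) = r - p := by omega
      rw [e2] at h7
      rw [norm_mul, Nat.add_sub_cancel]
      calc _ ≤ (1 + t ^ (p + 1)) * (K * t ^ (r - p) *
          (growth t r * growth t s * growth t p * growth t s')) := by gcongr
        _ = _ := by ring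
    have h9 : ‖Q ^ (p + 1 + k) * (1 - Q ^ s') * f r s (p + 1) (s' - 1)‖ ≤
        K * t ^ (r - p) * (growth t r * growth t s * (t ^ (p + 1) * growth t (p + 1)) *
          growth t s') := by
      rcases eq_or_ne s' 0 with h0 | h0
      · subst h0
        simp only [pow_zero, sub_self, mul_zero, zero_mul, norm_zero]
        have := g0 r
        have := g0 s
        have := g0 (p + 1)
        have := g0 0
        positivity
      · refine (second h0 (r - p) (by omega)).trans_eq ?_
        rw [pow_add]
        ring
    -- `(1 + x) + x (1 + 4 x) ≤ 1 + 4 x` for `x ≤ 1 / 4`: this is why `growth` has the factor `4`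
    have h10 : (1 + t ^ (p + 1)) * growth t p + t ^ (p + 1) * growth t (p + 1) ≤
        growth t (p + 1) := by
      have h11 : t ^ (p + 1) ≤ 1 / 4 := (pow_le_of_le_one ht0 ht1 (by omega)).trans hQ
      have h12 := pow_nonneg ht0 (p + 1)
      rw [growth_succ]
      nlinarith [growth_pos ht0 p, mul_nonneg (g0 p) h12,
        mul_nonneg (mul_nonneg (g0 p) h12) (sub_nonneg.2 h11)]
    calc _ ≤ K * t ^ (r - p) * (growth t r * growth t s *
          ((1 + t ^ (p + 1)) * growth t p + t ^ (p + 1) * growth t (p + 1)) * growth t s') := by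
          refine (norm_add_le _ _).trans ((add_le_add h6 h9).trans_eq ?_)
          ring
      _ ≤ _ := by
          have := g0 r
          have := g0 s
          have := g0 s'
          have := g0 (p + 1)
          have := g0 (r + 1)
          have := g0 p
          have := growth_le_succ ht0 r
          gcongr

/-- Off-diagonal decay of the Gram matrix of the vectors `ξ_{r,s}`: the exponent is `|r - r'|`,
written with truncated subtraction. -/
theorem IsPadGram.norm_le {Q : ℂ} {k : ℕ} (hk : 1 ≤ k) {f : ℕ → ℕ → ℕ → ℕ → ℂ}
    (h : IsPadGram Q k f) (hQ : ‖Q‖ ≤ 1 / 4) (n : ℕ) :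
    ∀ r s r' s', r + s = n → r' + s' = n → ‖f r s r' s'‖ ≤
      ‖f 0 0 0 0‖ * ‖Q‖ ^ ((r - r') + (r' - r)) *
        (growth ‖Q‖ r * growth ‖Q‖ s * growth ‖Q‖ r' * growth ‖Q‖ s') := by
  induction n with
  | zero =>
    intro r s r' s' h1 h2
    obtain ⟨rfl, rfl⟩ : r = 0 ∧ s = 0 := by omega
    obtain ⟨rfl, rfl⟩ : r' = 0 ∧ s' = 0 := by omega
    simp [growth]
  | succ n ih =>
    intro r s r' s' h1 h2
    by_cases hr : r' ≤ r ∧ r ≠ 0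
    · obtain ⟨m, rfl⟩ := Nat.exists_eq_succ_of_ne_zero hr.2
      exact h.norm_le_step hk hQ (norm_nonneg _) ih h1 h2 hr.1
    -- otherwise `s' ≤ s`, and the roles of left and right letters are exchanged
    · obtain ⟨m, rfl⟩ := Nat.exists_eq_succ_of_ne_zero (show s ≠ 0 by omega)
      have ih' : ∀ r s r' s', r + s = n → r' + s' = n → ‖f s r s' r'‖ ≤
          ‖f 0 0 0 0‖ * ‖Q‖ ^ ((r - r') + (r' - r)) *
          (growth ‖Q‖ r * growth ‖Q‖ s * growth ‖Q‖ r' * growth ‖Q‖ s') := by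
        intro r s r' s' h1 h2
        have h3 := ih s r s' r' (by omega) (by omega)
        have e : (s - s') + (s' - s) = (r - r') + (r' - r) := by omega
        rw [e] at h3
        refine h3.trans_eq ?_
        ring
      have h4 := h.swap.norm_le_step hk hQ (norm_nonneg _) ih' (r := m) (s := r) (r' := s')
        (s' := r') (by omega) (by omega) (by omega)
      have e : (m + 1 - s') + (s' - (m + 1)) = (r - r') + (r' - r) := by omega
      rw [e] at h4
      refine h4.trans_eq ?_
      simp only [Nat.succ_eq_add_one]
      ring

theorem IsPadGram.norm_le_of_small {Q : ℂ} {k : ℕ} (hk : 1 ≤ k) {f : ℕ → ℕ → ℕ → ℕ → ℂ}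
    (h : IsPadGram Q k f) (hQ : ‖Q‖ ≤ 1 / 100) {r s r' s' : ℕ} (hrs : r + s = r' + s') :
    ‖f r s r' s'‖ ≤ 2 * ‖f 0 0 0 0‖ * ‖Q‖ ^ ((r - r') + (r' - r)) := by
  refine (h.norm_le hk (by linarith) _ r s r' s' hrs rfl).trans ?_
  have g0 := fun m => (growth_pos (norm_nonneg Q) m).le
  have g1 := fun m => growth_le_of_small (norm_nonneg Q) hQ m
  have : growth ‖Q‖ r * growth ‖Q‖ s * growth ‖Q‖ r' * growth ‖Q‖ s' ≤ 2 := by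
    calc _ ≤ (11 / 10 : ℝ) * (11 / 10) * (11 / 10) * (11 / 10) := by
          have := g0 r
          have := g0 s
          have := g0 r'
          have := g0 s'
          gcongr <;> apply g1
      _ ≤ 2 := by norm_num
  calc _ ≤ ‖f 0 0 0 0‖ * ‖Q‖ ^ ((r - r') + (r' - r)) * 2 := by gcongr
    _ = _ := by ring

theorem IsPadGram.norm_diag_step {Q : ℂ} {k : ℕ} (hk : 1 ≤ k) {f : ℕ → ℕ → ℕ → ℕ → ℂ}
    (h : IsPadGram Q k f) (hQ : ‖Q‖ ≤ 1 / 100) (r s : ℕ) :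
    ‖f (r + 1) s (r + 1) s - f r s r s‖ ≤ 4 * ‖f 0 0 0 0‖ * ‖Q‖ ^ (r + 1) := by
  have hQ1 : ‖Q‖ ≤ 1 := by linarith
  have h1 : ‖f r s r s‖ ≤ 2 * ‖f 0 0 0 0‖ := by
    simpa using h.norm_le_of_small hk hQ (rfl : r + s = r + s)
  have h2 : ‖Q ^ (r + 1 + k) * (1 - Q ^ s) * f r s (r + 1) (s - 1)‖ ≤
      2 * ‖f 0 0 0 0‖ * ‖Q‖ ^ (r + 1) := by
    cases s with
    | zero => simp; positivity
    | succ s =>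
      have h3 := h.norm_le_of_small hk hQ (show r + (s + 1) = r + 1 + s by omega)
      have h4 : ‖1 - Q ^ (s + 1)‖ ≤ 2 :=
        (norm_one_sub_pow_le Q (s + 1)).trans (by
          linarith [pow_le_one₀ (n := s + 1) (norm_nonneg Q) hQ1])
      have h5 : ‖Q‖ ^ ((r - (r + 1)) + (r + 1 - r)) ≤ 1 / 2 := by
        have : (r - (r + 1)) + (r + 1 - r) = 1 := by omega
        rw [this, pow_one]
        linarith
      have h6 : ‖Q‖ ^ (r + 1 + k) ≤ ‖Q‖ ^ (r + 1) :=
        pow_le_pow_of_le_one (norm_nonneg _) hQ1 (by omega)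
      rw [norm_mul, norm_mul, norm_pow, Nat.add_sub_cancel]
      calc _ ≤ ‖Q‖ ^ (r + 1) * 2 * (2 * ‖f 0 0 0 0‖ * (1 / 2)) := by
            gcongr
            exact h3.trans (by gcongr)
        _ = _ := by ring
  rw [h.1, Nat.add_sub_cancel]
  have e : (1 - Q ^ (r + 1)) * f r s r s + Q ^ (r + 1 + k) * (1 - Q ^ s) * f r s (r + 1) (s - 1) -
      f r s r s = -(Q ^ (r + 1) * f r s r s) +
      Q ^ (r + 1 + k) * (1 - Q ^ s) * f r s (r + 1) (s - 1) := by ring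
  rw [e]
  refine (norm_add_le _ _).trans ?_
  rw [norm_neg, norm_mul, norm_pow]
  have := mul_le_mul_of_nonneg_left h1 (pow_nonneg (norm_nonneg Q) (r + 1))
  linarith

/-- Diagonal entries stay close to `f 0 0 0 0`, because consecutive ones differ by a geometrically
decaying amount. -/
theorem IsPadGram.norm_diag {Q : ℂ} {k : ℕ} (hk : 1 ≤ k) {f : ℕ → ℕ → ℕ → ℕ → ℂ}
    (h : IsPadGram Q k f) (hQ : ‖Q‖ ≤ 1 / 100) (r s : ℕ) :
    ‖f r s r s - f 0 0 0 0‖ ≤ 1 / 10 * ‖f 0 0 0 0‖ := by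
  have aux : ∀ g : ℕ → ℕ → ℕ → ℕ → ℂ, IsPadGram Q k g → ∀ r s,
      ‖g r s r s - g 0 s 0 s‖ ≤ 4 * ‖g 0 0 0 0‖ * ∑ j ∈ Finset.range r, ‖Q‖ ^ (j + 1) := by
    intro g hg r s
    induction r with
    | zero => simp
    | succ r ih =>
      have h1 := hg.norm_diag_step hk hQ r s
      rw [Finset.sum_range_succ, mul_add]
      calc _ = ‖(g r s r s - g 0 s 0 s) + (g (r + 1) s (r + 1) s - g r s r s)‖ := by
            congr 1; ring
        _ ≤ _ := (norm_add_le _ _).trans (add_le_add ih h1)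
  have h3 : ∀ m, ∑ j ∈ Finset.range m, ‖Q‖ ^ (j + 1) ≤ 1 / 99 := by
    intro m
    refine (sum_pow_succ_le (norm_nonneg Q) (by linarith) m).trans ?_
    rw [div_le_iff₀ (by linarith)]
    linarith
  have h1 := aux f h r s
  have h2 : ‖f 0 s 0 s - f 0 0 0 0‖ ≤
      4 * ‖f 0 0 0 0‖ * ∑ j ∈ Finset.range s, ‖Q‖ ^ (j + 1) := aux _ h.swap s 0
  have h4 := mul_le_mul_of_nonneg_left (h3 r) (show 0 ≤ 4 * ‖f 0 0 0 0‖ by positivity)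
  have h5 := mul_le_mul_of_nonneg_left (h3 s) (show 0 ≤ 4 * ‖f 0 0 0 0‖ by positivity)
  have h6 := norm_add_le (f r s r s - f 0 s 0 s) (f 0 s 0 s - f 0 0 0 0)
  rw [sub_add_sub_cancel] at h6
  linarith [norm_nonneg (f 0 0 0 0)]

end

/-! ### Small `q`: norms and Riesz bounds -/

section

variable {H : Type*} [NormedAddCommGroup H] [InnerProductSpace ℝ H]
variable {q : Set.Ioo (-1 : ℝ) 1} {e : H}

theorem qFactorial_mul_scale (q : Set.Ioo (-1 : ℝ) 1) (n : ℕ) :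
    (scale q ^ n) ^ 2 * qFactorial q n = eulerProd q n := by
  rw [← pow_mul, mul_comm n 2, pow_mul, scale_sq, qFactorial, eulerProd, Finset.prod_div_distrib,
    Finset.prod_const, Finset.card_range]
  have := (pow_pos (one_sub_pos q) n).ne'
  field_simp

theorem norm_scaledPad (r s : ℕ) (ξ : Fock q H) :
    ‖scaledPad q e r s ξ‖ = scale q ^ (r + s) * ‖pad q e r s ξ‖ := by
  rw [scaledPad_eq, norm_smul, Complex.norm_real, Real.norm_of_nonneg (pow_pos (scale_pos q) _).le]

/-- The norm bounds of `IsSmall`, in rescaled form. -/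
theorem pad_bounds_iff (r s : ℕ) (ξ : Fock q H) (a b : ℝ) :
    (a * qFactorial q (r + s) ≤ ‖pad q e r s ξ‖ ^ 2 ∧
      ‖pad q e r s ξ‖ ^ 2 ≤ b * qFactorial q (r + s)) ↔
    (a * eulerProd q (r + s) ≤ ‖scaledPad q e r s ξ‖ ^ 2 ∧
      ‖scaledPad q e r s ξ‖ ^ 2 ≤ b * eulerProd q (r + s)) := by
  have h := pow_pos (pow_pos (scale_pos q) (r + s)) 2
  rw [norm_scaledPad, mul_pow, ← qFactorial_mul_scale, mul_left_comm, mul_left_comm b,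
    mul_le_mul_iff_right₀ h, mul_le_mul_iff_right₀ h]

theorem isPadGram_scaledPad (he : ‖e‖ = 1) {k : ℕ} (ξ : Fock q H) {η : Fock q H}
    (hη : η ∈ kernelSpace q e k) :
    IsPadGram ((q : ℝ) : ℂ) k fun r s r' s' =>
      ⟪scaledPad q e r s ξ, scaledPad q e r' s' η⟫_ℂ :=
  ⟨inner_scaledPad_succ_left he ξ hη, inner_scaledPad_succ_right he ξ hη⟩

theorem scaledPad_zero_zero (ξ : Fock q H) : scaledPad q e 0 0 ξ = ξ := by
  rw [scaledPad, pow_zero, pow_zero]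
  rfl

theorem norm_coe_q (q : Set.Ioo (-1 : ℝ) 1) : ‖((q : ℝ) : ℂ)‖ = |(q : ℝ)| := by
  rw [Complex.norm_real, Real.norm_eq_abs]

theorem scaledPad_of_mem_zero {ξ : Fock q H} (hξ : ξ ∈ particleSpace q H 0) (r s : ℕ) :
    scaledPad q e r s ξ = scaledPad q e (r + s) 0 ξ := by
  induction s generalizing r with
  | zero => rfl
  | succ s ih =>
    have h : scaledPad q e r (s + 1) ξ = scaledPad q e (r + 1) s ξ := by
      have h1 : rightCre q e ξ = leftCre q e ξ := by
        rw [rightCre, leftCre, smul_apply, smul_apply, creation_eq_creationRight_of_mem e hξ]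
      have h2 : (rightCre q e ^ s) (leftCre q e ξ) = leftCre q e ((rightCre q e ^ s) ξ) :=
        DFunLike.congr_fun ((leftCre_rightCre_comm q e).pow_right s).eq.symm ξ
      rw [scaledPad, pow_succ, mul_apply_eq_comp, h1, h2, scaledPad, pow_succ, mul_apply_eq_comp]
    rw [h, ih, add_right_comm, add_assoc]

theorem norm_scaledPad_zero (he : ‖e‖ = 1) {ξ : Fock q H} (hξ : ξ ∈ kernelSpace q e 0) (r : ℕ) :
    ‖scaledPad q e r 0 ξ‖ ^ 2 = eulerProd q r * ‖ξ‖ ^ 2 := by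
  have h : ⟪scaledPad q e r 0 ξ, scaledPad q e r 0 ξ⟫_ℂ = (eulerProd q r : ℂ) * ⟪ξ, ξ⟫_ℂ := by
    induction r with
    | zero => simp [eulerProd_zero, scaledPad_zero_zero]
    | succ r ih =>
      rw [inner_scaledPad_succ_left he ξ hξ, Nat.add_sub_cancel, ih, eulerProd_succ]
      push_cast
      simp
      ring
  simp only [inner_self_eq_norm_sq_to_K, RCLike.ofReal_eq_complex_ofReal] at h
  exact_mod_cast h

theorem norm_sq_scaledPad_mem_of_small (hq : |(q : ℝ)| ≤ 1 / 100) (he : ‖e‖ = 1) {k : ℕ}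
    (hk : 1 ≤ k) {ξ : Fock q H} (hξ : ξ ∈ kernelSpace q e k) (h1 : ‖ξ‖ = 1) (r s : ℕ) :
    9 / 10 ≤ ‖scaledPad q e r s ξ‖ ^ 2 ∧ ‖scaledPad q e r s ξ‖ ^ 2 ≤ 11 / 10 := by
  have h := (isPadGram_scaledPad he ξ hξ).norm_diag hk (by rwa [norm_coe_q]) r s
  simp only [scaledPad_zero_zero, inner_self_eq_norm_sq_to_K, h1,
    RCLike.ofReal_eq_complex_ofReal] at h
  have h' : |‖scaledPad q e r s ξ‖ ^ 2 - 1| ≤ 1 / 10 := by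
    rw [← Real.norm_eq_abs, ← Complex.norm_real]
    simpa using h
  rw [abs_le] at h'
  constructor <;> linarith

/-- A family of unit vectors whose Gram matrix has off-diagonal row sums at most `1 / 2` satisfies
Riesz bounds. -/
theorem riesz_bounds_of_row_sums {E ι : Type*} [DecidableEq ι] [NormedAddCommGroup E]
    [InnerProductSpace ℂ E] {v : ι → E} (h1 : ∀ i, ‖v i‖ = 1)
    (h2 : ∀ (s : Finset ι) (i : ι), ∑ j ∈ s with j ≠ i, ‖⟪v i, v j⟫_ℂ‖ ≤ 1 / 2)
    (s : Finset ι) (c : ι → ℂ) :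
    1 / 2 * ∑ i ∈ s, ‖c i‖ ^ 2 ≤ ‖∑ i ∈ s, c i • v i‖ ^ 2 ∧
      ‖∑ i ∈ s, c i • v i‖ ^ 2 ≤ 3 / 2 * ∑ i ∈ s, ‖c i‖ ^ 2 := by
  set S := ∑ i ∈ s, ‖c i‖ ^ 2 with hS
  let w : ι → ι → ℝ := fun i j => if j ≠ i then ‖⟪v i, v j⟫_ℂ‖ else 0
  have hw0 : ∀ i j, 0 ≤ w i j := by
    intro i j
    simp only [w]
    split_ifs <;> positivity
  have hwc : ∀ i j, w i j = w j i := by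
    intro i j
    simp only [w, ne_comm (a := j), norm_inner_symm (v i)]
  have hrow : ∀ i, ∑ j ∈ s, w i j ≤ 1 / 2 := by
    intro i
    simp only [w]
    rw [← Finset.sum_filter]
    exact h2 s i
  have hexp : ⟪∑ i ∈ s, c i • v i, ∑ i ∈ s, c i • v i⟫_ℂ =
      ∑ i ∈ s, ∑ j ∈ s, conj (c i) * c j * ⟪v i, v j⟫_ℂ := by
    rw [sum_inner]
    refine Finset.sum_congr rfl fun i _ => ?_
    rw [inner_sum]
    refine Finset.sum_congr rfl fun j _ => ?_
    rw [inner_smul_left, inner_smul_right]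
    ring
  have hdiag : ∑ i ∈ s, ∑ j ∈ s, (if j ≠ i then conj (c i) * c j * ⟪v i, v j⟫_ℂ else 0) =
      ((‖∑ i ∈ s, c i • v i‖ ^ 2 - S : ℝ) : ℂ) := by
    have h3 : ∀ i ∈ s, ∑ j ∈ s, conj (c i) * c j * ⟪v i, v j⟫_ℂ =
        ((‖c i‖ ^ 2 : ℝ) : ℂ) +
          ∑ j ∈ s, (if j ≠ i then conj (c i) * c j * ⟪v i, v j⟫_ℂ else 0) := by
      intro i hi
      rw [← Finset.sum_filter, Finset.filter_ne' s i, ← Finset.add_sum_erase _ _ hi]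
      congr 1
      rw [inner_self_eq_norm_sq_to_K, h1 i, mul_comm (conj (c i)), Complex.mul_conj,
        Complex.normSq_eq_norm_sq]
      simp
    have h4 : ((‖∑ i ∈ s, c i • v i‖ ^ 2 : ℝ) : ℂ) =
        ∑ i ∈ s, ∑ j ∈ s, conj (c i) * c j * ⟪v i, v j⟫_ℂ := by
      rw [← hexp, inner_self_eq_norm_sq_to_K, RCLike.ofReal_eq_complex_ofReal]
      push_cast
      rfl
    rw [Complex.ofReal_sub, h4, Finset.sum_congr rfl h3, Finset.sum_add_distrib, hS]
    push_cast
    ring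
  have hle : |‖∑ i ∈ s, c i • v i‖ ^ 2 - S| ≤ 1 / 2 * S := by
    rw [← Real.norm_eq_abs, ← Complex.norm_real, ← hdiag]
    calc _ ≤ ∑ i ∈ s, ∑ j ∈ s, ‖c i‖ * ‖c j‖ * w i j := by
          refine (norm_sum_le _ _).trans (Finset.sum_le_sum fun i _ => (norm_sum_le _ _).trans
            (Finset.sum_le_sum fun j _ => ?_))
          by_cases h : j = i <;> simp [w, h]
      _ ≤ ∑ i ∈ s, ∑ j ∈ s, (‖c i‖ ^ 2 * w i j / 2 + ‖c j‖ ^ 2 * w j i / 2) := by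
          refine Finset.sum_le_sum fun i _ => Finset.sum_le_sum fun j _ => ?_
          rw [hwc j i]
          nlinarith [mul_nonneg (sq_nonneg (‖c i‖ - ‖c j‖)) (hw0 i j)]
      _ = ∑ i ∈ s, ‖c i‖ ^ 2 * ∑ j ∈ s, w i j := by
          simp only [Finset.sum_add_distrib]
          rw [Finset.sum_comm (f := fun i j => ‖c j‖ ^ 2 * w j i / 2), ← Finset.sum_add_distrib]
          refine Finset.sum_congr rfl fun i _ => ?_
          rw [← Finset.sum_add_distrib, Finset.mul_sum]
          exact Finset.sum_congr rfl fun j _ => by ring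
      _ ≤ ∑ i ∈ s, ‖c i‖ ^ 2 * (1 / 2) :=
          Finset.sum_le_sum fun i _ => mul_le_mul_of_nonneg_left (hrow i) (sq_nonneg _)
      _ = 1 / 2 * S := by rw [← Finset.sum_mul, mul_comm]
  rw [abs_le] at hle
  constructor <;> linarith

theorem sum_pow_injOn_le {ι : Type*} {t : ℝ} (h0 : 0 ≤ t) (h1 : t < 1) (s : Finset ι) (g : ι → ℕ)
    (hg : Set.InjOn g s) (hpos : ∀ i ∈ s, 1 ≤ g i) : ∑ i ∈ s, t ^ g i ≤ t / (1 - t) := by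
  classical
  have h2 : ∑ i ∈ s, t ^ g i = t * ∑ i ∈ s, t ^ (g i - 1) := by
    rw [Finset.mul_sum]
    refine Finset.sum_congr rfl fun i hi => ?_
    rw [← pow_succ', Nat.sub_add_cancel (hpos i hi)]
  have h3 : Set.InjOn (fun i => g i - 1) (s : Set ι) := by
    intro i hi j hj h
    have := hpos i hi
    have := hpos j hj
    exact hg hi hj (by simp only at h; omega)
  rw [h2, ← Finset.sum_image (f := fun n => t ^ n) h3, div_eq_mul_inv,
    ← tsum_geometric_of_lt_one h0 h1]
  exact mul_le_mul_of_nonneg_left ((summable_geometric_of_lt_one h0 h1).sum_le_tsum _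
    fun i _ => pow_nonneg h0 i) h0

section Basis

variable {κ : ℕ → Type*}

/-- The rescaled version of `basisVector`. -/
def scaledBasisVector (b : ∀ k, HilbertBasis (κ k) ℂ (kernelSpace q e (k + 1)))
    (p : (Σ k, κ k) × ℕ × ℕ) : Fock q H :=
  scaledPad q e p.2.1 p.2.2 (b p.1.1 p.1.2 : kernelSpace q e (p.1.1 + 1))

variable (b : ∀ k, HilbertBasis (κ k) ℂ (kernelSpace q e (k + 1)))

theorem scaledBasisVector_eq (p : (Σ k, κ k) × ℕ × ℕ) :
    scaledBasisVector b p = ((scale q ^ (p.2.1 + p.2.2) : ℝ) : ℂ) • basisVector q b p :=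
  scaledPad_eq q e _ _ _

theorem norm_basis (i : Σ k, κ k) : ‖((b i.1 i.2 : kernelSpace q e (i.1 + 1)) : Fock q H)‖ = 1 :=
  (b i.1).orthonormal.1 i.2

theorem normalized_basisVector (p : (Σ k, κ k) × ℕ × ℕ) :
    ((‖basisVector q b p‖⁻¹ : ℝ) : ℂ) • basisVector q b p =
      ((‖scaledBasisVector b p‖⁻¹ : ℝ) : ℂ) • scaledBasisVector b p := by
  have h := pow_pos (scale_pos q) (p.2.1 + p.2.2)
  rw [scaledBasisVector_eq, norm_smul, Complex.norm_real, Real.norm_of_nonneg h.le, smul_smul,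
    ← Complex.ofReal_mul, mul_inv, mul_right_comm, inv_mul_cancel₀ h.ne', one_mul]

theorem inner_basis_eq_zero {i j : Σ k, κ k} (hij : i ≠ j) :
    ⟪((b i.1 i.2 : kernelSpace q e (i.1 + 1)) : Fock q H),
      ((b j.1 j.2 : kernelSpace q e (j.1 + 1)) : Fock q H)⟫_ℂ = 0 := by
  obtain ⟨k, i⟩ := i
  obtain ⟨l, j⟩ := j
  by_cases h : k = l
  · subst h
    exact (b k).orthonormal.2 fun h => hij (congrArg (Sigma.mk k) h)
  · exact inner_eq_zero_of_particleSpace (k := k + 1) (m := l + 1) (by omega) (b k i).2.1.1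
      (b l j).2.1.1

theorem inner_scaledBasisVector_eq_zero (he : ‖e‖ = 1) {p p' : (Σ k, κ k) × ℕ × ℕ}
    (h : p.1 ≠ p'.1 ∨ p.2.1 + p.2.2 ≠ p'.2.1 + p'.2.2) :
    ⟪scaledBasisVector b p, scaledBasisVector b p'⟫_ℂ = 0 :=
  inner_scaledPad_eq_zero he (b p.1.1 p.1.2).2 (b p'.1.1 p'.1.2).2 _ _ _ _ _ rfl
    (h.symm.imp_right fun h => inner_basis_eq_zero b h)

theorem fockLine_eq : fockLine q e =
    (Submodule.span ℂ (Set.range fun n => scaledPad q e n 0 (vacuum q H))).topologicalClosure := by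
  have h : Submodule.span ℂ (Set.range fun n => (creation q e ^ n) (vacuum q H)) =
      Submodule.span ℂ (Set.range fun n => scaledPad q e n 0 (vacuum q H)) := by
    have h1 : ∀ n, scaledPad q e n 0 (vacuum q H) =
        ((scale q ^ n : ℝ) : ℂ) • (creation q e ^ n) (vacuum q H) := by
      intro n
      rw [scaledPad_eq, pad, pow_zero]
      rfl
    have h2 : ∀ n, (((scale q ^ n : ℝ) : ℂ)) ≠ 0 := fun n => by
      exact_mod_cast (pow_pos (scale_pos q) n).ne'
    apply le_antisymm
    · refine Submodule.span_le.2 ?_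
      rintro _ ⟨n, rfl⟩
      have h3 : (creation q e ^ n) (vacuum q H) =
          (((scale q ^ n : ℝ) : ℂ))⁻¹ • scaledPad q e n 0 (vacuum q H) := by
        rw [h1, smul_smul, inv_mul_cancel₀ (h2 n), one_smul]
      change (creation q e ^ n) (vacuum q H) ∈ _
      rw [h3]
      exact Submodule.smul_mem _ _ (Submodule.subset_span ⟨n, rfl⟩)
    · refine Submodule.span_le.2 ?_
      rintro _ ⟨n, rfl⟩
      change scaledPad q e n 0 (vacuum q H) ∈ _
      rw [h1]
      exact Submodule.smul_mem _ _ (Submodule.subset_span ⟨n, rfl⟩)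
  rw [fockLine, h]

theorem mem_orthogonal_closure_span {E ι : Type*} [NormedAddCommGroup E] [InnerProductSpace ℂ E]
    {v : ι → E} {x : E} :
    x ∈ (Submodule.span ℂ (Set.range v)).topologicalClosureᗮ ↔ ∀ i, ⟪v i, x⟫_ℂ = 0 := by
  rw [Submodule.orthogonal_closure]
  constructor
  · intro h i
    exact (Submodule.mem_orthogonal _ _).1 h _ (Submodule.subset_span ⟨i, rfl⟩)
  · intro h
    rw [Submodule.mem_orthogonal]
    intro u hu
    induction hu using Submodule.span_induction with
    | mem y hy => obtain ⟨i, rfl⟩ := hy; exact h i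
    | zero => exact inner_zero_left _
    | add y z _ _ hy hz => rw [inner_add_left, hy, hz, add_zero]
    | smul c y _ hy => rw [inner_smul_left, hy, mul_zero]

theorem mem_fockLine_orthogonal {x : Fock q H} :
    x ∈ (fockLine q e)ᗮ ↔ ∀ n, ⟪scaledPad q e n 0 (vacuum q H), x⟫_ℂ = 0 := by
  rw [fockLine_eq, mem_orthogonal_closure_span]

theorem scaledPad_mem_fockLine_orthogonal (he : ‖e‖ = 1) {k : ℕ} (hk : k ≠ 0) {ξ : Fock q H}
    (hξ : ξ ∈ kernelSpace q e k) (r s : ℕ) : scaledPad q e r s ξ ∈ (fockLine q e)ᗮ := by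
  rw [mem_fockLine_orthogonal]
  exact fun n => inner_scaledPad_eq_zero he (vacuum_mem_kernelSpace e) hξ n n 0 r s rfl
    (Or.inr (inner_eq_zero_of_particleSpace hk.symm vacuum_mem_particleSpace hξ.1.1))

theorem exists_smul_vacuum {ξ : Fock q H} (hξ : ξ ∈ particleSpace q H 0) :
    ∃ c : ℂ, ξ = c • vacuum q H := by
  have h : particleSpace q H 0 ≤ Submodule.span ℂ {vacuum q H} := by
    refine particleSpace_le (Submodule.closed_of_finiteDimensional _) fun w hw => ?_
    obtain ⟨n, w⟩ := w
    obtain rfl : n = 0 := hw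
    obtain rfl : w = Fin.elim0 := Subsingleton.elim _ _
    exact Submodule.mem_span_singleton_self _
  obtain ⟨c, hc⟩ := Submodule.mem_span_singleton.1 (h hξ)
  exact ⟨c, hc.symm⟩

/-- The vectors `ξ^i_{r,s}` span a dense subspace of `L²(M) ⊖ L²(A)`. -/
theorem closure_span_scaledBasisVector (he : ‖e‖ = 1) :
    (Submodule.span ℂ (Set.range (scaledBasisVector b))).topologicalClosure =
      (fockLine q e)ᗮ := by
  set U := (Submodule.span ℂ (Set.range (scaledBasisVector b))).topologicalClosure with hU
  have hle : U ≤ (fockLine q e)ᗮ := by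
    refine Submodule.topologicalClosure_minimal _ (Submodule.span_le.2 ?_)
      (Submodule.isClosed_orthogonal _)
    rintro _ ⟨p, rfl⟩
    exact scaledPad_mem_fockLine_orthogonal he (Nat.succ_ne_zero _) (b p.1.1 p.1.2).2 _ _
  have hc : CompleteSpace U := (Submodule.isClosed_topologicalClosure _).completeSpace_coe
  refine le_antisymm hle fun x hx => ?_
  suffices h : x - U.starProjection x = 0 by
    rw [sub_eq_zero.1 h]
    exact Submodule.starProjection_apply_mem _ _
  set y := x - U.starProjection x with hy
  have hy1 : y ∈ Uᗮ := Submodule.sub_starProjection_mem_orthogonal x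
  have hy2 : y ∈ (fockLine q e)ᗮ :=
    Submodule.sub_mem _ hx (hle (Submodule.starProjection_apply_mem _ _))
  rw [hU, mem_orthogonal_closure_span] at hy1
  refine eq_zero_of_forall_inner_scaledPad (e := e) fun k r s ξ hξ => ?_
  cases k with
  | zero =>
    obtain ⟨c, rfl⟩ := exists_smul_vacuum hξ.1.1
    have h1 : scaledPad q e r s (c • vacuum q H) =
        c • scaledPad q e (r + s) 0 (vacuum q H) := by
      rw [← scaledPad_of_mem_zero vacuum_mem_particleSpace, scaledPad,
        scaledPad, map_smul, map_smul]
    rw [h1, inner_smul_left, mem_fockLine_orthogonal.1 hy2, mul_zero]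
  | succ k =>
    let T : kernelSpace q e (k + 1) →L[ℂ] ℂ :=
      innerSL ℂ y ∘L ((leftCre q e ^ r) ∘L (rightCre q e ^ s)) ∘L (kernelSpace q e (k + 1)).subtypeL
    have hT : T.ker = ⊤ := by
      rw [eq_top_iff, ← (b k).dense_span]
      refine Submodule.topologicalClosure_minimal _ (Submodule.span_le.2 ?_) T.isClosed_ker
      rintro _ ⟨i, rfl⟩
      change ⟪y, scaledPad q e r s (b k i : kernelSpace q e (k + 1))⟫_ℂ = 0
      rw [← inner_conj_symm, show ⟪scaledPad q e r s (b k i : kernelSpace q e (k + 1)), y⟫_ℂ = 0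
        from hy1 (⟨k, i⟩, r, s), map_zero]
    have h2 : (⟨ξ, hξ⟩ : kernelSpace q e (k + 1)) ∈ T.ker := by rw [hT]; trivial
    have h3 : ⟪y, scaledPad q e r s ξ⟫_ℂ = 0 := h2
    rw [← inner_conj_symm, h3, map_zero]

theorem span_smul_eq {ι E : Type*} [AddCommGroup E] [Module ℂ E] {v : ι → E} {c : ι → ℂ}
    (hc : ∀ i, c i ≠ 0) :
    Submodule.span ℂ (Set.range fun i => c i • v i) = Submodule.span ℂ (Set.range v) := by
  apply le_antisymm
  · refine Submodule.span_le.2 ?_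
    rintro _ ⟨i, rfl⟩
    exact Submodule.smul_mem _ _ (Submodule.subset_span ⟨i, rfl⟩)
  · refine Submodule.span_le.2 ?_
    rintro _ ⟨i, rfl⟩
    have : v i = (c i)⁻¹ • c i • v i := by rw [smul_smul, inv_mul_cancel₀ (hc i), one_smul]
    rw [SetLike.mem_coe, this]
    exact Submodule.smul_mem _ _ (Submodule.subset_span ⟨i, rfl⟩)

/-- For `|q| ≤ 1 / 100`, the normalized vectors `ξ^i_{r,s}` are orthogonal for different `i` or
`r + s`, and within a block the Gram matrix is dominated by `3 |q| ^ |r - r'|`, so that its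
off-diagonal row sums are small. -/
theorem isSmall_of_small (hq : |(q : ℝ)| ≤ 1 / 100) (he : ‖e‖ = 1) : IsSmall q b := by
  classical
  have hbasis : ∀ p, 9 / 10 ≤ ‖scaledBasisVector b p‖ ^ 2 ∧ ‖scaledBasisVector b p‖ ^ 2 ≤ 11 / 10 :=
    fun p => norm_sq_scaledPad_mem_of_small hq he (by omega) (b p.1.1 p.1.2).2
      (norm_basis b p.1) _ _
  have hpos : ∀ p, 0 < ‖scaledBasisVector b p‖ := by
    intro p
    have := (hbasis p).1
    by_contra h
    have h0 : ‖scaledBasisVector b p‖ = 0 := le_antisymm (not_lt.1 h) (norm_nonneg _)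
    rw [h0] at this
    norm_num at this
  refine ⟨fun k ξ hξ h1 r s => ?_, ?_, ?_⟩
  · rw [pad_bounds_iff]
    cases k with
    | zero =>
      rw [scaledPad_of_mem_zero hξ.1.1, norm_scaledPad_zero he hξ, h1]
      have := eulerProd_pos (show |(q : ℝ)| < 1 by linarith) (r + s)
      constructor <;> linarith
    | succ k =>
      have h2 := norm_sq_scaledPad_mem_of_small hq he (Nat.succ_pos k) hξ h1 r s
      have h3 := eulerProd_mem_of_small hq (r + s)
      constructor <;> linarith [h2.1, h2.2, h3.1, h3.2]
  · simp only [normalized_basisVector]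
    rw [span_smul_eq fun p => by exact_mod_cast (inv_pos.2 (hpos p)).ne']
    exact closure_span_scaledBasisVector b he
  · simp only [normalized_basisVector]
    refine ⟨1 / 2, by norm_num, 3 / 2, by norm_num, riesz_bounds_of_row_sums (fun p => ?_) ?_⟩
    · rw [norm_smul, Complex.norm_real, Real.norm_of_nonneg (inv_pos.2 (hpos p)).le,
        inv_mul_cancel₀ (hpos p).ne']
    intro S p
    set t := |(q : ℝ)| with ht
    have ht0 : 0 ≤ t := abs_nonneg _
    -- an entry in the block of `p` is small, any other entry vanishes
    obtain ⟨good, hgood⟩ : ∃ good : (Σ k, κ k) × ℕ × ℕ → Prop,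
        ∀ p', good p' ↔ p.1 = p'.1 ∧ p.2.1 + p.2.2 = p'.2.1 + p'.2.2 := ⟨_, fun _ => Iff.rfl⟩
    have hentry : ∀ p', ‖⟪((‖scaledBasisVector b p‖⁻¹ : ℝ) : ℂ) • scaledBasisVector b p,
        ((‖scaledBasisVector b p'‖⁻¹ : ℝ) : ℂ) • scaledBasisVector b p'⟫_ℂ‖ ≤
        if good p' then 3 * t ^ ((p.2.1 - p'.2.1) + (p'.2.1 - p.2.1)) else 0 := by
      intro p'
      rw [inner_smul_left, inner_smul_right, norm_mul, norm_mul, Complex.conj_ofReal,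
        Complex.norm_real, Complex.norm_real, Real.norm_of_nonneg (inv_pos.2 (hpos p)).le,
        Real.norm_of_nonneg (inv_pos.2 (hpos p')).le]
      by_cases hg : good p'
      · rw [if_pos hg]
        obtain ⟨i, r, s⟩ := p
        obtain ⟨i', r', s'⟩ := p'
        obtain ⟨h1, h2⟩ := (hgood _).1 hg
        simp only at h1 h2
        subst h1
        have h3 := (isPadGram_scaledPad he (b i.1 i.2 : kernelSpace q e (i.1 + 1))
          (b i.1 i.2).2).norm_le_of_small (by omega) (by rwa [norm_coe_q]) h2
        simp only [scaledPad_zero_zero, inner_self_eq_norm_sq_to_K, norm_basis, norm_coe_q] at h3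
        norm_num at h3
        have h4 : ∀ p, ‖scaledBasisVector b p‖⁻¹ ≤ 11 / 10 := by
          intro p
          have h5 := (hbasis p).1
          rw [inv_le_comm₀ (hpos p) (by norm_num)]
          nlinarith [hpos p]
        have h5 := pow_nonneg ht0 ((r - r') + (r' - r))
        calc _ ≤ 11 / 10 * (11 / 10 * (2 * t ^ ((r - r') + (r' - r)))) := by
              gcongr
              · exact h4 _
              · exact h4 _
              · exact h3
          _ ≤ _ := by linarith
      · rw [if_neg hg, inner_scaledBasisVector_eq_zero b he
          (not_and_or.1 fun h => hg ((hgood _).2 h)), norm_zero, mul_zero, mul_zero]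
    have hthird : t / (1 - t) ≤ 1 / 99 := by
      rw [div_le_iff₀ (by linarith)]
      linarith
    calc _ ≤ ∑ p' ∈ S with p' ≠ p,
          if good p' then 3 * t ^ ((p.2.1 - p'.2.1) + (p'.2.1 - p.2.1)) else 0 :=
          Finset.sum_le_sum fun p' _ => hentry p'
      _ ≤ ∑ p' ∈ S, ((if good p' ∧ p'.2.1 < p.2.1 then 3 * t ^ (p.2.1 - p'.2.1) else 0) +
            (if good p' ∧ p.2.1 < p'.2.1 then 3 * t ^ (p'.2.1 - p.2.1) else 0)) := by
          rw [Finset.sum_filter]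
          refine Finset.sum_le_sum fun p' _ => ?_
          have h6 : ∀ n : ℕ, 0 ≤ 3 * t ^ n := fun n => by positivity
          by_cases hg : good p'
          · rcases lt_trichotomy p'.2.1 p.2.1 with h | h | h
            · have : p' ≠ p := by rintro rfl; omega
              simp [hg, h, h.not_gt, this, Nat.sub_eq_zero_of_le h.le]
            · have : p' = p := by
                obtain ⟨h7, h8⟩ := (hgood _).1 hg
                refine Prod.ext h7.symm (Prod.ext h ?_)
                omega
              simp [this]
            · have : p' ≠ p := by rintro rfl; omega
              simp [hg, h, h.not_gt, this, Nat.sub_eq_zero_of_le h.le]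
          · simp [hg]
      _ ≤ 3 * (t / (1 - t)) + 3 * (t / (1 - t)) := by
          rw [Finset.sum_add_distrib, ← Finset.sum_filter, ← Finset.sum_filter, ← Finset.mul_sum,
            ← Finset.mul_sum]
          have inj : ∀ p₁ p₂ : (Σ k, κ k) × ℕ × ℕ, good p₁ → good p₂ → p₁.2.1 = p₂.2.1 →
              p₁ = p₂ := by
            intro p₁ p₂ h1 h2 h3
            obtain ⟨h4, h5⟩ := (hgood _).1 h1
            obtain ⟨h6, h7⟩ := (hgood _).1 h2
            exact Prod.ext (h4.symm.trans h6) (Prod.ext h3 (by omega))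
          gcongr
          · refine sum_pow_injOn_le ht0 (by linarith) _ _ ?_ ?_
            · intro p₁ h1 p₂ h2 h3
              rw [Finset.mem_coe, Finset.mem_filter] at h1 h2
              simp only at h3
              exact inj p₁ p₂ h1.2.1 h2.2.1 (by omega)
            · intro p₁ h1
              rw [Finset.mem_filter] at h1
              omega
          · refine sum_pow_injOn_le ht0 (by linarith) _ _ ?_ ?_
            · intro p₁ h1 p₂ h2 h3
              rw [Finset.mem_coe, Finset.mem_filter] at h1 h2
              simp only at h3
              exact inj p₁ p₂ h1.2.1 h2.2.1 (by omega)
            · intro p₁ h1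
              rw [Finset.mem_filter] at h1
              omega
      _ ≤ 1 / 2 := by linarith

end Basis

end

/-! ### Padded Riesz bases -/

section

variable {H : Type*} [NormedAddCommGroup H] [InnerProductSpace ℝ H]
variable {q : Set.Ioo (-1 : ℝ) 1} {e : H}

theorem abs_q_lt_one (q : Set.Ioo (-1 : ℝ) 1) : |(q : ℝ)| < 1 := abs_lt.2 q.2

theorem eulerProd_q_pos (q : Set.Ioo (-1 : ℝ) 1) (n : ℕ) : 0 < eulerProd q n :=
  eulerProd_pos (abs_q_lt_one q) n

/-- The rescaled vector `ξ_{r,s}` divided by `∏_{j ≤ r} (1 - q ^ j) ∏_{j ≤ s} (1 - q ^ j)`. With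
this normalization the annihilation operators act with coefficients `1` and `q ^ (r + k)`. -/
def dividedPad (e : H) (r s : ℕ) (ξ : Fock q H) : Fock q H :=
  ((eulerProd q r * eulerProd q s : ℝ) : ℂ)⁻¹ • scaledPad q e r s ξ

theorem eulerProd_ne (q : Set.Ioo (-1 : ℝ) 1) (n : ℕ) : ((eulerProd q n : ℝ) : ℂ) ≠ 0 := by
  exact_mod_cast (eulerProd_q_pos q n).ne'

theorem eulerProd_succ_complex (q : Set.Ioo (-1 : ℝ) 1) (n : ℕ) :
    ((eulerProd q (n + 1) : ℝ) : ℂ) =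
      ((eulerProd q n : ℝ) : ℂ) * (1 - ((q : ℝ) : ℂ) ^ (n + 1)) := by
  rw [eulerProd_succ]
  push_cast
  rfl

theorem one_sub_pow_ne (q : Set.Ioo (-1 : ℝ) 1) (n : ℕ) : 1 - ((q : ℝ) : ℂ) ^ (n + 1) ≠ 0 := by
  have := eulerProd_ne q (n + 1)
  rw [eulerProd_succ_complex] at this
  exact right_ne_zero_of_mul this

theorem leftAnn_dividedPad (he : ‖e‖ = 1) {k : ℕ} {ξ : Fock q H}
    (hξ : ξ ∈ kernelSpace q e k) (r s : ℕ) :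
    leftAnn q e (dividedPad e r s ξ) =
      (if r = 0 then 0 else dividedPad e (r - 1) s ξ) +
        if s = 0 then 0 else ((q : ℝ) : ℂ) ^ (r + k) • dividedPad e r (s - 1) ξ := by
  rw [dividedPad, map_smul, leftAnn_scaledPad he hξ, smul_add]
  congr 1
  · cases r with
    | zero => simp
    | succ r =>
      simp only [Nat.succ_ne_zero, if_false, Nat.add_sub_cancel, dividedPad, smul_smul]
      congr 1
      have := one_sub_pow_ne q r
      have := eulerProd_ne q r
      have := eulerProd_ne q s
      rw [Complex.ofReal_mul, Complex.ofReal_mul, eulerProd_succ_complex]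
      field_simp
  · cases s with
    | zero => simp
    | succ s =>
      simp only [Nat.succ_ne_zero, if_false, Nat.add_sub_cancel, dividedPad, smul_smul]
      congr 1
      have := one_sub_pow_ne q s
      have := eulerProd_ne q r
      have := eulerProd_ne q s
      rw [Complex.ofReal_mul, Complex.ofReal_mul, eulerProd_succ_complex]
      field_simp

theorem leftCre_pow_dividedPad (n r s : ℕ) (ξ : Fock q H) :
    (leftCre q e ^ n) (dividedPad e r s ξ) =
      (((eulerProd q (r + n) / eulerProd q r : ℝ)) : ℂ) • dividedPad e (r + n) s ξ := by
  rw [dividedPad, map_smul, scaledPad, ← mul_apply_eq_comp, ← pow_add, dividedPad, smul_smul,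
    scaledPad, add_comm n r]
  congr 1
  have := eulerProd_ne q (r + n)
  have := eulerProd_ne q r
  have := eulerProd_ne q s
  push_cast
  field_simp

theorem flip_dividedPad (r s : ℕ) (ξ : Fock q H) :
    flip q H (dividedPad e r s ξ) = dividedPad e s r (flip q H ξ) := by
  rw [dividedPad, map_smul, flip_scaledPad, dividedPad, mul_comm (eulerProd q r)]

theorem rightCre_dividedPad (r s : ℕ) (ξ : Fock q H) :
    rightCre q e (dividedPad e r s ξ) =
      (1 - ((q : ℝ) : ℂ) ^ (s + 1)) • dividedPad e r (s + 1) ξ := by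
  rw [dividedPad, map_smul, rightCre_scaledPad, dividedPad, smul_smul]
  congr 1
  have := one_sub_pow_ne q s
  have := eulerProd_ne q r
  have := eulerProd_ne q s
  rw [Complex.ofReal_mul, Complex.ofReal_mul, eulerProd_succ_complex]
  field_simp

theorem rightAnn_dividedPad (he : ‖e‖ = 1) {k : ℕ} {ξ : Fock q H}
    (hξ : ξ ∈ kernelSpace q e k) (r s : ℕ) :
    rightAnn q e (dividedPad e r s ξ) =
      (if s = 0 then 0 else dividedPad e r (s - 1) ξ) +
        if r = 0 then 0 else ((q : ℝ) : ℂ) ^ (s + k) • dividedPad e (r - 1) s ξ := by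
  have h := congrArg (flip q H) (leftAnn_dividedPad he (flip_mem_kernelSpace hξ) s r)
  rw [flip_leftAnn, flip_dividedPad, flip_flip, map_add] at h
  rw [h]
  congr 1
  · split_ifs
    · simp
    · rw [flip_dividedPad, flip_flip]
  · split_ifs
    · simp
    · rw [map_smul, flip_dividedPad, flip_flip]

variable {I : Type*}

/-- The family of all normalized `ξ^i_{r,s}`. -/
def padFamily (e : H) (ξ : I → Fock q H) (p : I × ℕ × ℕ) : Fock q H :=
  dividedPad e p.2.1 p.2.2 (ξ p.1)

/-- A family `ξ^i ∈ T^{d_i + 1}` whose padded vectors form a Riesz basis of `L²(M) ⊖ L²(A)`. The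
Riesz bounds are stated for finitely supported families of coefficients. -/
structure PaddedBasis (e : H) (d : I → ℕ) (ξ : I → Fock q H) (α β : ℝ) : Prop where
  mem : ∀ i, ξ i ∈ kernelSpace q e (d i + 1)
  closure_span : (Submodule.span ℂ (Set.range (padFamily e ξ))).topologicalClosure =
    (fockLine q e)ᗮ
  pos_left : 0 < α
  pos_right : 0 < β
  le_norm : ∀ c : I × ℕ × ℕ →₀ ℂ,
    α * ∑' p, ‖c p‖ ^ 2 ≤ ‖Finsupp.linearCombination ℂ (padFamily e ξ) c‖ ^ 2
  norm_le : ∀ c : I × ℕ × ℕ →₀ ℂ,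
    ‖Finsupp.linearCombination ℂ (padFamily e ξ) c‖ ^ 2 ≤ β * ∑' p, ‖c p‖ ^ 2

theorem summable_weighted {ι : Type*} (w : ι → ℝ) (c : ι →₀ ℂ) :
    Summable fun p => w p * ‖c p‖ ^ 2 := by
  refine summable_of_hasFiniteSupport (c.support.finite_toSet.subset fun p hp => ?_)
  rw [Finset.mem_coe, Finsupp.mem_support_iff]
  rintro h
  exact hp (by simp [h])

theorem summable_norm_sq {ι : Type*} (c : ι →₀ ℂ) : Summable fun p => ‖c p‖ ^ 2 := by
  simpa using summable_weighted (fun _ => 1) c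

theorem summable_pow_mul_norm_sq (lam : ℝ) (c : I × ℕ × ℕ →₀ ℂ) :
    Summable fun p : I × ℕ × ℕ => lam ^ p.2.1 * ‖c p‖ ^ 2 := by
  have := summable_weighted (fun p : I × ℕ × ℕ => lam ^ p.2.1) c
  exact this

/-- The action of the left annihilation operator on coefficients. -/
def coeffAnn (q : ℝ) (d : I → ℕ) : (I × ℕ × ℕ →₀ ℂ) →ₗ[ℂ] (I × ℕ × ℕ →₀ ℂ) :=
  Finsupp.linearCombination ℂ fun p =>
    (if p.2.1 = 0 then 0 else Finsupp.single (p.1, p.2.1 - 1, p.2.2) 1) +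
      if p.2.2 = 0 then 0 else
        Finsupp.single (p.1, p.2.1, p.2.2 - 1) ((q : ℂ) ^ (p.2.1 + (d p.1 + 1)))

theorem coeffAnn_apply (q : ℝ) (d : I → ℕ) (c : I × ℕ × ℕ →₀ ℂ) (i : I) (r s : ℕ) :
    coeffAnn q d c (i, r, s) =
      c (i, r + 1, s) + (q : ℂ) ^ (r + (d i + 1)) * c (i, r, s + 1) := by
  classical
  induction c using Finsupp.induction_linear with
  | zero => simp
  | add c c' h h' => simp only [map_add, Finsupp.add_apply, h, h']; ring
  | single p a =>
    obtain ⟨j, m, n⟩ := p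
    rw [coeffAnn, Finsupp.linearCombination_single]
    simp only [Finsupp.smul_apply, Finsupp.add_apply, smul_eq_mul, mul_add]
    congr 1
    · rcases m with _ | m
      · simp
      · simp [Finsupp.single_apply]
    · rcases n with _ | n
      · simp
      · simp only [Nat.succ_ne_zero, if_false, Nat.add_sub_cancel, Finsupp.single_apply,
          Prod.mk.injEq, Nat.add_right_cancel_iff]
        split_ifs with h
        · obtain ⟨rfl, rfl, rfl⟩ := h
          ring
        · simp

theorem leftAnn_linearCombination (he : ‖e‖ = 1) {d : I → ℕ} {ξ : I → Fock q H}
    (hξ : ∀ i, ξ i ∈ kernelSpace q e (d i + 1)) (c : I × ℕ × ℕ →₀ ℂ) :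
    leftAnn q e (Finsupp.linearCombination ℂ (padFamily e ξ) c) =
      Finsupp.linearCombination ℂ (padFamily e ξ) (coeffAnn q d c) := by
  induction c using Finsupp.induction_linear with
  | zero => simp
  | add c c' h h' => simp only [map_add, h, h']
  | single p a =>
    rw [coeffAnn, Finsupp.linearCombination_single, Finsupp.linearCombination_single, map_smul,
      map_smul, padFamily, leftAnn_dividedPad he (hξ p.1), map_add]
    congr 2
    · split_ifs
      · simp
      · simp [padFamily]
    · split_ifs
      · simp
      · simp [padFamily]

/-- Young's inequality for the square of a sum. -/
theorem norm_add_sq_le_of_pos {b : ℝ} (hb : 0 < b) (x y : ℂ) :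
    ‖x + y‖ ^ 2 ≤ (1 + 1 / b) * ‖x‖ ^ 2 + (1 + b) * ‖y‖ ^ 2 := by
  have h1 := pow_le_pow_left₀ (norm_nonneg _) (norm_add_le x y) 2
  have h2 : 0 ≤ (‖x‖ - b * ‖y‖) ^ 2 / b := by positivity
  have h3 : (‖x‖ - b * ‖y‖) ^ 2 / b = 1 / b * ‖x‖ ^ 2 - 2 * ‖x‖ * ‖y‖ + b * ‖y‖ ^ 2 := by
    field_simp
    ring
  nlinarith

/-- In a weighted `ℓ²` norm that penalizes large `r`, the annihilation operator is a strict
contraction. -/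
theorem tsum_coeffAnn_le (q : Set.Ioo (-1 : ℝ) 1) (d : I → ℕ) {b lam : ℝ} (hb : 0 < b)
    (hl : 0 < lam) (c : I × ℕ × ℕ →₀ ℂ) :
    ∑' p, lam ^ p.2.1 * ‖coeffAnn q d c p‖ ^ 2 ≤
      ((1 + 1 / b) / lam + (1 + b) * |(q : ℝ)| ^ 2) * ∑' p, lam ^ p.2.1 * ‖c p‖ ^ 2 := by
  obtain ⟨φ, hφ'⟩ : ∃ φ : I × ℕ × ℕ → I × ℕ × ℕ, ∀ i r s, φ (i, r, s) = (i, r + 1, s) :=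
    ⟨fun p => (p.1, p.2.1 + 1, p.2.2), fun _ _ _ => rfl⟩
  obtain ⟨ψ, hψ'⟩ : ∃ ψ : I × ℕ × ℕ → I × ℕ × ℕ, ∀ i r s, ψ (i, r, s) = (i, r, s + 1) :=
    ⟨fun p => (p.1, p.2.1, p.2.2 + 1), fun _ _ _ => rfl⟩
  have hφ : Function.Injective φ := by
    rintro ⟨i, r, s⟩ ⟨j, r', s'⟩ h
    simpa [hφ'] using h
  have hψ : Function.Injective ψ := by
    rintro ⟨i, r, s⟩ ⟨j, r', s'⟩ h
    simpa [hψ'] using h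
  obtain ⟨g, hg'⟩ : ∃ g : I × ℕ × ℕ → ℝ, ∀ p, g p = lam ^ p.2.1 * ‖c p‖ ^ 2 := ⟨_, fun _ => rfl⟩
  have hg : Summable g := by
    rw [funext hg']
    exact summable_pow_mul_norm_sq lam c
  have hg0 : ∀ p, 0 ≤ g p := fun p => by rw [hg']; positivity
  have hpt : ∀ p, lam ^ p.2.1 * ‖coeffAnn q d c p‖ ^ 2 ≤
      (1 + 1 / b) / lam * g (φ p) + (1 + b) * |(q : ℝ)| ^ 2 * g (ψ p) := by
    rintro ⟨i, r, s⟩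
    rw [coeffAnn_apply, hφ', hψ', hg', hg']
    have h1 := norm_add_sq_le_of_pos hb (c (i, r + 1, s))
      (((q : ℝ) : ℂ) ^ (r + (d i + 1)) * c (i, r, s + 1))
    have h2 : ‖((q : ℝ) : ℂ) ^ (r + (d i + 1)) * c (i, r, s + 1)‖ ^ 2 ≤
        |(q : ℝ)| ^ 2 * ‖c (i, r, s + 1)‖ ^ 2 := by
      rw [norm_mul, mul_pow, norm_pow, norm_coe_q]
      refine mul_le_mul_of_nonneg_right (pow_le_pow_left₀ (by positivity) ?_ 2) (sq_nonneg _)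
      exact pow_le_of_le_one (abs_nonneg _) (abs_q_lt_one q).le (by omega)
    have h3 := h1.trans (add_le_add_right
      (mul_le_mul_of_nonneg_left h2 (show 0 ≤ 1 + b by linarith)) _)
    refine (mul_le_mul_of_nonneg_left h3 (pow_pos hl r).le).trans_eq ?_
    field_simp
    ring
  have hsφ := (hg.comp_injective hφ).mul_left ((1 + 1 / b) / lam)
  have hsψ := (hg.comp_injective hψ).mul_left ((1 + b) * |(q : ℝ)| ^ 2)
  have h4 := (summable_pow_mul_norm_sq lam (coeffAnn q d c)).tsum_le_tsum
    hpt (hsφ.add hsψ)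
  have h5 := Summable.tsum_add hsφ hsψ
  have h6 := tsum_comp_le_tsum_of_inj hg hg0 hφ
  have h7 := tsum_comp_le_tsum_of_inj hg hg0 hψ
  have h8 := mul_le_mul_of_nonneg_left h6 (show 0 ≤ (1 + 1 / b) / lam by positivity)
  have h9 := mul_le_mul_of_nonneg_left h7 (show 0 ≤ (1 + b) * |(q : ℝ)| ^ 2 by positivity)
  rw [tsum_mul_left, tsum_mul_left] at h5
  rw [← tsum_congr hg', add_mul]
  exact h4.trans (h5.trans_le (add_le_add h8 h9))

theorem tsum_norm_sq_le_weighted {lam : ℝ} (hl : 1 ≤ lam) (c : I × ℕ × ℕ →₀ ℂ) :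
    ∑' p, ‖c p‖ ^ 2 ≤ ∑' p, lam ^ p.2.1 * ‖c p‖ ^ 2 := by
  refine (summable_norm_sq _).tsum_le_tsum (fun p => ?_)
    (summable_pow_mul_norm_sq lam _)
  exact le_mul_of_one_le_left (sq_nonneg _) (one_le_pow₀ hl)

/-- The weight `lam` and the parameter `b` can be chosen so that the constant in
`tsum_coeffAnn_le` is smaller than `1`. -/
theorem exists_contraction (q : Set.Ioo (-1 : ℝ) 1) :
    ∃ lam ≥ (1 : ℝ), ∃ b > (0 : ℝ), ∃ θ > (0 : ℝ), θ < 1 ∧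
      (1 + 1 / b) / lam + (1 + b) * |(q : ℝ)| ^ 2 ≤ θ ^ 2 := by
  have h0 := abs_nonneg (q : ℝ)
  have h1 := abs_q_lt_one q
  set t := |(q : ℝ)| ^ 2 with ht
  have ht0 : 0 ≤ t := by positivity
  have ht1 : t < 1 := by nlinarith
  have hb : 0 < (1 - t) / 2 := by linarith
  have hlam : 1 ≤ 4 * (1 + 1 / ((1 - t) / 2)) / (1 - t) := by
    rw [le_div_iff₀ (by linarith)]
    have : 0 < 1 / ((1 - t) / 2) := by positivity
    linarith
  -- `b = (1 - t) / 2` leaves the second summand below `1`, a large `lam` makes the first one small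
  refine ⟨4 * (1 + 1 / ((1 - t) / 2)) / (1 - t), hlam, (1 - t) / 2, hb,
    √((3 + t) / 4), Real.sqrt_pos.2 (by linarith), ?_, ?_⟩
  · rw [Real.sqrt_lt' one_pos]
    linarith
  · rw [Real.sq_sqrt (by linarith)]
    have h2 : (1 + 1 / ((1 - t) / 2)) / (4 * (1 + 1 / ((1 - t) / 2)) / (1 - t)) = (1 - t) / 4 := by
      have : 0 < 1 + 1 / ((1 - t) / 2) := by positivity
      have : 0 < 1 - t := by linarith
      field_simp
    rw [h2]
    nlinarith

/-- The closed span of the `ξ^i_{r,s}` with `r ≤ N`. -/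
def lowSpace (e : H) (ξ : I → Fock q H) (N : ℕ) : Submodule ℂ (Fock q H) :=
  (Submodule.span ℂ (padFamily e ξ '' {p | p.2.1 ≤ N})).topologicalClosure

instance (ξ : I → Fock q H) (N : ℕ) : CompleteSpace (lowSpace e ξ N) :=
  (Submodule.isClosed_topologicalClosure _).completeSpace_coe

theorem padFamily_mem_lowSpace (ξ : I → Fock q H) {N : ℕ} {p : I × ℕ × ℕ} (hp : p.2.1 ≤ N) :
    padFamily e ξ p ∈ lowSpace e ξ N :=
  Submodule.le_topologicalClosure _ (Submodule.subset_span ⟨p, hp, rfl⟩)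

theorem lowSpace_le {ξ : I → Fock q H} {N : ℕ} {U : Submodule ℂ (Fock q H)}
    (hU : IsClosed (U : Set (Fock q H))) (h : ∀ p : I × ℕ × ℕ, p.2.1 ≤ N → padFamily e ξ p ∈ U) :
    lowSpace e ξ N ≤ U := by
  refine Submodule.topologicalClosure_minimal
    (Submodule.span ℂ (padFamily e ξ '' {p | p.2.1 ≤ N})) (Submodule.span_le.2 ?_) hU
  rintro _ ⟨p, hp, rfl⟩
  exact h p hp

theorem lowSpace_mono (ξ : I → Fock q H) {N N' : ℕ} (h : N ≤ N') :
    lowSpace e ξ N ≤ lowSpace e ξ N' :=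
  lowSpace_le (Submodule.isClosed_topologicalClosure _)
    fun _ hp => padFamily_mem_lowSpace ξ (hp.trans h)

namespace PaddedBasis

variable {d : I → ℕ} {ξ : I → Fock q H} {α β : ℝ}

theorem padFamily_mem (h : PaddedBasis e d ξ α β) (p : I × ℕ × ℕ) :
    padFamily e ξ p ∈ (fockLine q e)ᗮ := by
  rw [← h.closure_span]
  exact Submodule.le_topologicalClosure _ (Submodule.subset_span ⟨p, rfl⟩)

theorem lowSpace_le_orthogonal (h : PaddedBasis e d ξ α β) (N : ℕ) :
    lowSpace e ξ N ≤ (fockLine q e)ᗮ :=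
  lowSpace_le (Submodule.isClosed_orthogonal _) fun p _ => h.padFamily_mem p

/-- Powers of the annihilation operator decay geometrically on `lowSpace`, where the weighted `ℓ²`
norm, in which the annihilation operator is a strict contraction, is equivalent to the norm. -/
theorem exists_decay (h : PaddedBasis e d ξ α β) (he : ‖e‖ = 1) :
    ∃ θ > (0 : ℝ), θ < 1 ∧ ∀ N : ℕ, ∃ C ≥ (0 : ℝ), ∀ (J : ℕ), ∀ v ∈ lowSpace e ξ N,
      ‖(leftAnn q e ^ J) v‖ ≤ C * θ ^ J * ‖v‖ := by
  obtain ⟨lam, hlam, b, hb, θ, hθ, hθ1, hle⟩ := exists_contraction q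
  have hlam0 : 0 < lam := by linarith
  have hα := h.pos_left
  have hβ := h.pos_right
  refine ⟨θ, hθ, hθ1, fun N => ⟨√(β / α * lam ^ N), Real.sqrt_nonneg _, fun J v hv => ?_⟩⟩
  have hclosed : IsClosed {v : Fock q H | ‖(leftAnn q e ^ J) v‖ ≤
      √(β / α * lam ^ N) * θ ^ J * ‖v‖} := isClosed_le (by fun_prop) (by fun_prop)
  refine hclosed.closure_subset_iff.2 ?_ hv
  intro v hv
  obtain ⟨c, hc, rfl⟩ := (Finsupp.mem_span_image_iff_linearCombination ℂ).1 hv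
  have hpow : ∀ J : ℕ, (leftAnn q e ^ J) (Finsupp.linearCombination ℂ (padFamily e ξ) c) =
      Finsupp.linearCombination ℂ (padFamily e ξ) ((coeffAnn q d ^ J) c) := by
    intro J
    induction J with
    | zero => simp
    | succ J ih =>
      rw [pow_succ', mul_apply_eq_comp, ih, leftAnn_linearCombination he h.mem, pow_succ',
        Module.End.mul_apply]
  have henergy : ∀ J : ℕ, ∑' p, lam ^ p.2.1 * ‖((coeffAnn (q : ℝ) d ^ J) c) p‖ ^ 2 ≤
      (θ ^ J) ^ 2 * ∑' p, lam ^ p.2.1 * ‖c p‖ ^ 2 := by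
    intro J
    induction J with
    | zero => simp
    | succ J ih =>
      rw [pow_succ' (coeffAnn (q : ℝ) d), Module.End.mul_apply]
      have h0 : 0 ≤ ∑' p, lam ^ p.2.1 * ‖((coeffAnn (q : ℝ) d ^ J) c) p‖ ^ 2 :=
        tsum_nonneg fun p => by positivity
      calc _ ≤ _ := tsum_coeffAnn_le q d hb hlam0 _
        _ ≤ θ ^ 2 * ((θ ^ J) ^ 2 * ∑' p, lam ^ p.2.1 * ‖c p‖ ^ 2) := by gcongr
        _ = _ := by ring
  have h1 := tsum_norm_sq_le_weighted hlam ((coeffAnn (q : ℝ) d ^ J) c)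
  have h2 : ∑' p, lam ^ p.2.1 * ‖c p‖ ^ 2 ≤ lam ^ N * ∑' p, ‖c p‖ ^ 2 := by
    rw [← tsum_mul_left]
    refine (summable_pow_mul_norm_sq lam _).tsum_le_tsum (fun p => ?_)
      ((summable_norm_sq c).mul_left _)
    by_cases hp : c p = 0
    · simp [hp]
    · have : p.2.1 ≤ N := (Finsupp.mem_supported ℂ _).1 hc (Finsupp.mem_support_iff.2 hp)
      gcongr
  have h3 := h.le_norm c
  rw [Set.mem_ofPred_eq]
  refine le_of_sq_le_sq ?_ (by positivity)
  rw [mul_pow, mul_pow, Real.sq_sqrt (by positivity), hpow]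
  calc _ ≤ β * ((θ ^ J) ^ 2 * (lam ^ N * ∑' p, ‖c p‖ ^ 2)) := by
        refine (h.norm_le _).trans ?_
        gcongr
        exact h1.trans ((henergy J).trans (by gcongr))
    _ = β * (θ ^ J) ^ 2 * lam ^ N * (α * ∑' p, ‖c p‖ ^ 2) / α := by
        field_simp
    _ ≤ β * (θ ^ J) ^ 2 * lam ^ N *
          ‖Finsupp.linearCombination ℂ (padFamily e ξ) c‖ ^ 2 / α := by gcongr
    _ = _ := by ring

/-! ### Truncation operators -/

/-- A bounded operator is determined by its values on `L²(A)` and on the Riesz basis. -/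
theorem ext_clm (h : PaddedBasis e d ξ α β) {S T : Fock q H →L[ℂ] Fock q H}
    (h1 : ∀ x ∈ fockLine q e, S x = T x)
    (h2 : ∀ p, S (padFamily e ξ p) = T (padFamily e ξ p)) : S = T := by
  have hc : CompleteSpace (fockLine q e) :=
    (Submodule.isClosed_topologicalClosure _).completeSpace_coe
  have h3 : (fockLine q e)ᗮ ≤ (S - T).ker := by
    rw [← h.closure_span]
    refine Submodule.topologicalClosure_minimal _ (Submodule.span_le.2 ?_) (S - T).isClosed_ker
    rintro _ ⟨p, rfl⟩
    simp [h2 p]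
  have h4 : fockLine q e ≤ (S - T).ker := fun x hx => by simp [h1 x hx]
  have h5 : (S - T).ker = ⊤ := by
    rw [eq_top_iff, ← Submodule.sup_orthogonal_of_hasOrthogonalProjection (K := fockLine q e)]
    exact sup_le h4 h3
  ext x
  have : x ∈ (S - T).ker := by rw [h5]; trivial
  simpa [sub_eq_zero] using this

/-- The Riesz bounds give bounded operators that keep the basis vectors with index in a given set
and kill the others. -/
theorem exists_truncation (h : PaddedBasis e d ξ α β) (S : I × ℕ × ℕ → Prop) [DecidablePred S] :
    ∃ L : Fock q H →L[ℂ] Fock q H, (∀ x ∈ fockLine q e, L x = 0) ∧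
      ∀ p, L (padFamily e ξ p) = if S p then padFamily e ξ p else 0 := by
  have hα := h.pos_left
  have hβ := h.pos_right
  let T := Finsupp.linearCombination ℂ (padFamily e ξ)
  have hT : ∀ c, T c ∈ (fockLine q e)ᗮ := by
    intro c
    exact Submodule.sum_mem _ fun p _ => Submodule.smul_mem _ _ (h.padFamily_mem p)
  let T' : (I × ℕ × ℕ →₀ ℂ) →ₗ[ℂ] (fockLine q e)ᗮ := T.codRestrict _ hT
  let f : (I × ℕ × ℕ →₀ ℂ) →ₗ[ℂ] Fock q H :=
    Finsupp.linearCombination ℂ fun p => if S p then padFamily e ξ p else 0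
  have hf : ∀ c, f c = T (c.filter S) := by
    intro c
    induction c using Finsupp.induction_linear with
    | zero => rw [map_zero, Finsupp.filter_zero, map_zero]
    | add c c' h h' => rw [map_add, Finsupp.filter_add, map_add, h, h']
    | single p a =>
      by_cases hp : S p
      · simp [f, T, Finsupp.filter_single_of_pos _ hp, hp]
      · simp [f, T, Finsupp.filter_single_of_neg _ hp, hp]
  have hbound : ∀ c, ‖f c‖ ≤ √(β / α) * ‖T' c‖ := by
    intro c
    refine le_of_sq_le_sq ?_ (by positivity)
    rw [mul_pow, Real.sq_sqrt (by positivity), hf]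
    have h1 : ∑' p, ‖c.filter S p‖ ^ 2 ≤ ∑' p, ‖c p‖ ^ 2 := by
      refine (summable_norm_sq _).tsum_le_tsum (fun p => ?_) (summable_norm_sq _)
      rw [Finsupp.filter_apply]
      split_ifs
      · exact le_rfl
      · simp
    have h2 : ‖T' c‖ = ‖T c‖ := rfl
    calc _ ≤ β * ∑' p, ‖c p‖ ^ 2 := (h.norm_le _).trans (by gcongr)
      _ = β / α * (α * ∑' p, ‖c p‖ ^ 2) := by field_simp
      _ ≤ _ := by
          rw [h2]
          gcongr
          exact h.le_norm c
  have hdense : DenseRange T' := by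
    intro x
    rw [Metric.mem_closure_iff]
    intro ε hε
    have hx : (x : Fock q H) ∈ closure (Submodule.span ℂ (Set.range (padFamily e ξ)) :
        Set (Fock q H)) := by
      exact h.closure_span.ge x.2
    obtain ⟨y, hy, hxy⟩ := Metric.mem_closure_iff.1 hx ε hε
    obtain ⟨c, rfl⟩ := (Finsupp.mem_span_range_iff_exists_finsupp).1 hy
    exact ⟨T' c, ⟨c, rfl⟩, hxy⟩
  refine ⟨f.extendOfNorm T' ∘L (fockLine q e)ᗮ.orthogonalProjectionOnto, ?_, ?_⟩
  · intro x hx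
    have h1 : (fockLine q e)ᗮ.orthogonalProjectionOnto x = 0 :=
      Submodule.orthogonalProjectionOnto_eq_zero_iff.2 ((fockLine q e).le_orthogonal_orthogonal hx)
    rw [ContinuousLinearMap.comp_apply, h1, map_zero]
  · intro p
    have h1 : (fockLine q e)ᗮ.orthogonalProjectionOnto (padFamily e ξ p) =
        T' (Finsupp.single p 1) := by
      have h2 : padFamily e ξ p = (T' (Finsupp.single p 1) : Fock q H) := by
        change _ = T (Finsupp.single p 1)
        simp [T]
      conv_lhs => rw [h2]
      exact Submodule.orthogonalProjectionOnto_mem_subspace_eq_self _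
    rw [ContinuousLinearMap.comp_apply, h1, LinearMap.extendOfNorm_eq hdense ⟨_, hbound⟩]
    simp [f]

end PaddedBasis

end

/-! ### Truncations are controlled by projections onto the `lowSpace`s -/

section

variable {H : Type*} [NormedAddCommGroup H] [InnerProductSpace ℝ H]
variable {q : Set.Ioo (-1 : ℝ) 1} {e : H} {I : Type*}

/-- The coefficients of the vector from which `n` letters `e` have been removed on the left. -/
def coeffShift (q : ℝ) (n : ℕ) : (I × ℕ × ℕ →₀ ℂ) →ₗ[ℂ] (I × ℕ × ℕ →₀ ℂ) :=
  Finsupp.linearCombination ℂ fun p =>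
    if p.2.1 < n then 0 else
      Finsupp.single (p.1, p.2.1 - n, p.2.2) ((eulerProd q (p.2.1 - n) / eulerProd q p.2.1 : ℝ) : ℂ)

theorem coeffShift_apply (q : ℝ) (n : ℕ) (c : I × ℕ × ℕ →₀ ℂ) (i : I) (r s : ℕ) :
    coeffShift q n c (i, r, s) =
      ((eulerProd q r / eulerProd q (r + n) : ℝ) : ℂ) * c (i, r + n, s) := by
  classical
  induction c using Finsupp.induction_linear with
  | zero => simp
  | add c c' h h' => simp only [map_add, Finsupp.add_apply, h, h']; ring
  | single p a =>
    obtain ⟨j, m, k⟩ := p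
    rw [coeffShift, Finsupp.linearCombination_single]
    by_cases hm : m < n
    · have : ((j, m, k) : I × ℕ × ℕ) ≠ (i, r + n, s) := by
        intro h
        simp only [Prod.mk.injEq] at h
        omega
      simp [hm, this]
    · obtain ⟨m, rfl⟩ := Nat.exists_eq_add_of_le' (not_lt.1 hm)
      simp only [hm, if_false, Nat.add_sub_cancel, Finsupp.smul_apply, Finsupp.single_apply,
        Prod.mk.injEq, Nat.add_right_cancel_iff]
      split_ifs with h
      · obtain ⟨rfl, rfl, rfl⟩ := h
        rw [smul_eq_mul, mul_comm]
      · simp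

theorem eulerProd_div_le (q : Set.Ioo (-1 : ℝ) 1) :
    ∃ E > (0 : ℝ), ∀ m n : ℕ, eulerProd q m / eulerProd q n ≤ E := by
  refine ⟨Real.exp (|(q : ℝ)| / (1 - |(q : ℝ)|)) / Real.exp (-(|(q : ℝ)| / (1 - |(q : ℝ)|) ^ 2)),
    by positivity, fun m n => ?_⟩
  exact div_le_div₀ (Real.exp_pos _).le (eulerProd_le (abs_q_lt_one q) m) (Real.exp_pos _)
    (le_eulerProd (abs_q_lt_one q) n)

namespace PaddedBasis

variable {d : I → ℕ} {ξ : I → Fock q H} {α β : ℝ}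

/-- The part of a linear combination with `r ≥ n` is in the range of the `n`-th power of the
creation operator. -/
theorem leftCre_pow_coeffShift (n : ℕ) (c : I × ℕ × ℕ →₀ ℂ) :
    (leftCre q e ^ n) (Finsupp.linearCombination ℂ (padFamily e ξ) (coeffShift q n c)) =
      Finsupp.linearCombination ℂ (padFamily e ξ) (c.filter fun p => n ≤ p.2.1) := by
  induction c using Finsupp.induction_linear with
  | zero => rw [map_zero, Finsupp.filter_zero, map_zero, map_zero]
  | add c c' h h' => rw [map_add, map_add, map_add, Finsupp.filter_add, map_add, h, h']
  | single p a =>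
    obtain ⟨j, m, k⟩ := p
    rw [coeffShift, Finsupp.linearCombination_single]
    by_cases hm : m < n
    · rw [Finsupp.filter_single_of_neg _ (by simpa using hm)]
      simp [hm]
    · obtain ⟨m, rfl⟩ := Nat.exists_eq_add_of_le' (not_lt.1 hm)
      rw [Finsupp.filter_single_of_pos _ (by simp)]
      have h1 := eulerProd_ne q m
      have h2 := eulerProd_ne q (m + n)
      simp only [hm, if_false, Nat.add_sub_cancel, map_smul, Finsupp.linearCombination_single,
        padFamily, leftCre_pow_dividedPad, smul_smul]
      congr 1
      push_cast
      field_simp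

theorem tsum_coeffShift_le {E : ℝ} (hE : ∀ m n : ℕ, eulerProd q m / eulerProd q n ≤ E)
    (n : ℕ) (c : I × ℕ × ℕ →₀ ℂ) :
    ∑' p, ‖coeffShift q n c p‖ ^ 2 ≤ E ^ 2 * ∑' p, ‖c p‖ ^ 2 := by
  obtain ⟨φ, hφ'⟩ : ∃ φ : I × ℕ × ℕ → I × ℕ × ℕ, ∀ i r s, φ (i, r, s) = (i, r + n, s) :=
    ⟨fun p => (p.1, p.2.1 + n, p.2.2), fun _ _ _ => rfl⟩
  have hφ : Function.Injective φ := by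
    rintro ⟨i, r, s⟩ ⟨j, r', s'⟩ h
    simpa [hφ'] using h
  have hs := (summable_norm_sq c).comp_injective hφ
  have h1 : ∑' p, ‖coeffShift q n c p‖ ^ 2 ≤ ∑' p, E ^ 2 * ‖c (φ p)‖ ^ 2 := by
    refine (summable_norm_sq _).tsum_le_tsum ?_ (hs.mul_left _)
    rintro ⟨i, r, s⟩
    have h2 : 0 < eulerProd q r / eulerProd q (r + n) :=
      div_pos (eulerProd_q_pos q _) (eulerProd_q_pos q _)
    rw [coeffShift_apply, hφ', norm_mul, mul_pow, Complex.norm_real, Real.norm_of_nonneg h2.le]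
    exact mul_le_mul_of_nonneg_right (pow_le_pow_left₀ h2.le (hE _ _) 2) (sq_nonneg _)
  refine h1.trans ?_
  rw [tsum_mul_left]
  exact mul_le_mul_of_nonneg_left
    (tsum_comp_le_tsum_of_inj (summable_norm_sq c) (fun p => by positivity) hφ) (sq_nonneg E)

/-- `L` acts on the Riesz basis as the truncation to `r ≤ N`, and vanishes on `L²(A)`. -/
structure IsTruncation (e : H) (ξ : I → Fock q H) (N : ℕ) (L : Fock q H →L[ℂ] Fock q H) :
    Prop where
  on_line : ∀ x ∈ fockLine q e, L x = 0
  on_family : ∀ p, L (padFamily e ξ p) = if p.2.1 ≤ N then padFamily e ξ p else 0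

namespace IsTruncation

variable {N : ℕ} {L : Fock q H →L[ℂ] Fock q H}

theorem apply_linearCombination (hL : IsTruncation e ξ N L) (c : I × ℕ × ℕ →₀ ℂ) :
    L (Finsupp.linearCombination ℂ (padFamily e ξ) c) =
      Finsupp.linearCombination ℂ (padFamily e ξ) (c.filter fun p => p.2.1 ≤ N) := by
  induction c using Finsupp.induction_linear with
  | zero => rw [map_zero, Finsupp.filter_zero, map_zero, map_zero]
  | add c c' h h' => rw [map_add, map_add, Finsupp.filter_add, map_add, h, h']
  | single p a =>
    rw [Finsupp.linearCombination_single, map_smul, hL.on_family]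
    by_cases hp : p.2.1 ≤ N
    · rw [if_pos hp,
        Finsupp.filter_single_of_pos (fun p : I × ℕ × ℕ => p.2.1 ≤ N) hp,
        Finsupp.linearCombination_single]
    · rw [if_neg hp,
        Finsupp.filter_single_of_neg (fun p : I × ℕ × ℕ => p.2.1 ≤ N) hp, map_zero, smul_zero]

theorem linearCombination_filter_mem (N : ℕ) (c : I × ℕ × ℕ →₀ ℂ) :
    Finsupp.linearCombination ℂ (padFamily e ξ) (c.filter fun p => p.2.1 ≤ N) ∈
      lowSpace e ξ N := by
  refine Submodule.sum_mem _ fun p hp => Submodule.smul_mem _ _ ?_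
  rw [Finsupp.support_filter, Finset.mem_filter] at hp
  exact padFamily_mem_lowSpace ξ hp.2

end IsTruncation

/-- A closed condition on `L²(M) ⊖ L²(A)` can be checked on finite linear combinations. -/
theorem orthogonal_induction (h : PaddedBasis e d ξ α β) {P : Fock q H → Prop}
    (hP : IsClosed {x | P x})
    (hc : ∀ c : I × ℕ × ℕ →₀ ℂ, P (Finsupp.linearCombination ℂ (padFamily e ξ) c))
    {x : Fock q H} (hx : x ∈ (fockLine q e)ᗮ) : P x := by
  refine hP.closure_subset_iff.2 ?_ (h.closure_span.ge hx)
  intro v hv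
  obtain ⟨c, rfl⟩ := (Finsupp.mem_span_range_iff_exists_finsupp).1 hv
  exact hc c

/-- Vectors of `lowSpace m` are almost orthogonal to the combinations of the `ξ^i_{r,s}` with `r`
large. -/
theorem exists_cross_decay (h : PaddedBasis e d ξ α β) (he : ‖e‖ = 1) :
    ∃ θ > (0 : ℝ), θ < 1 ∧ ∀ m : ℕ, ∃ D ≥ (0 : ℝ), ∀ (n : ℕ), ∀ v ∈ lowSpace e ξ m,
      ∀ c : I × ℕ × ℕ →₀ ℂ,
      ‖⟪v, Finsupp.linearCombination ℂ (padFamily e ξ) (c.filter fun p => n ≤ p.2.1)⟫_ℂ‖ ≤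
        D * θ ^ n * ‖v‖ * ‖Finsupp.linearCombination ℂ (padFamily e ξ) c‖ := by
  obtain ⟨θ, hθ, hθ1, hdecay⟩ := h.exists_decay he
  obtain ⟨E, hE, hEle⟩ := eulerProd_div_le q
  have hα := h.pos_left
  have hβ := h.pos_right
  refine ⟨θ, hθ, hθ1, fun m => ?_⟩
  obtain ⟨C, hC, hCle⟩ := hdecay m
  refine ⟨C * √(β / α * E ^ 2), by positivity, fun n v hv c => ?_⟩
  rw [← leftCre_pow_coeffShift, norm_inner_symm, inner_leftCre_pow]
  have h1 : ‖Finsupp.linearCombination ℂ (padFamily e ξ) (coeffShift q n c)‖ ≤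
      √(β / α * E ^ 2) * ‖Finsupp.linearCombination ℂ (padFamily e ξ) c‖ := by
    refine le_of_sq_le_sq ?_ (by positivity)
    rw [mul_pow, Real.sq_sqrt (by positivity)]
    calc _ ≤ β * (E ^ 2 * ∑' p, ‖c p‖ ^ 2) :=
          (h.norm_le _).trans (mul_le_mul_of_nonneg_left (tsum_coeffShift_le hEle n c) hβ.le)
      _ = β / α * E ^ 2 * (α * ∑' p, ‖c p‖ ^ 2) := by field_simp
      _ ≤ _ := mul_le_mul_of_nonneg_left (h.le_norm c) (by positivity)
  calc _ ≤ ‖Finsupp.linearCombination ℂ (padFamily e ξ) (coeffShift q n c)‖ *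
        ‖(leftAnn q e ^ n) v‖ := norm_inner_le_norm _ _
    _ ≤ (√(β / α * E ^ 2) * ‖Finsupp.linearCombination ℂ (padFamily e ξ) c‖) *
        (C * θ ^ n * ‖v‖) := by
        gcongr
        exact hCle n v hv
    _ = _ := by ring

theorem norm_sq_filter_sub_le (h : PaddedBasis e d ξ α β) {n n' : ℕ} (hn : n ≤ n')
    (c : I × ℕ × ℕ →₀ ℂ) :
    ‖Finsupp.linearCombination ℂ (padFamily e ξ) (c.filter fun p => p.2.1 ≤ n') -
      Finsupp.linearCombination ℂ (padFamily e ξ) (c.filter fun p => p.2.1 ≤ n)‖ ^ 2 ≤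
      β * (∑' p, ‖c.filter (fun p => p.2.1 ≤ n') p‖ ^ 2) -
        β * ∑' p, ‖c.filter (fun p => p.2.1 ≤ n) p‖ ^ 2 := by
  rw [← map_sub, ← mul_sub, ← Summable.tsum_sub (summable_norm_sq _) (summable_norm_sq _)]
  refine (h.norm_le _).trans_eq ?_
  congr 1
  refine tsum_congr fun p => ?_
  simp only [Finsupp.sub_apply, Finsupp.filter_apply]
  by_cases h1 : p.2.1 ≤ n
  · simp [h1, h1.trans hn]
  · by_cases h2 : p.2.1 ≤ n' <;> simp [h1, h2]

/-- The truncation `L_N` is small on vectors that are almost orthogonal to all `lowSpace`s. In a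
long increasing sequence of truncation levels there are two neighbours between which a given vector
has little mass, and the Gram matrix decays away from the diagonal. -/
theorem exists_norm_truncation_le (h : PaddedBasis e d ξ α β) (he : ‖e‖ = 1) {N : ℕ}
    {L : Fock q H →L[ℂ] Fock q H} (hL : IsTruncation e ξ N L) {δ : ℝ} (hδ : 0 < δ) :
    ∃ N' : ℕ, ∃ K ≥ (0 : ℝ), ∀ x,
      ‖L x‖ ^ 2 ≤ K * ‖x‖ * ‖(lowSpace e ξ N').starProjection x‖ + δ * ‖x‖ ^ 2 := by
  have hα := h.pos_left
  have hβ := h.pos_right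
  obtain ⟨θ, hθ, hθ1, hcross⟩ := h.exists_cross_decay he
  choose D hD0 hD using hcross
  set B := β / α with hB
  have hB0 : 0 < B := by positivity
  obtain ⟨ε, hε, hεδ⟩ : ∃ ε > (0 : ℝ), B * (√B * ε + √B * ε) ≤ δ := by
    refine ⟨δ / (2 * B * √B), by positivity, le_of_eq ?_⟩
    have := Real.sqrt_pos.2 hB0
    field_simp
    ring
  -- a number of levels so large that one gap carries at most `ε ^ 2` of the mass
  obtain ⟨Q, hQ⟩ := exists_nat_gt (B / ε ^ 2)
  have hQ0 : (0 : ℝ) < Q := lt_of_le_of_lt (by positivity) hQ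
  have hstep : ∀ m : ℕ, ∃ n : ℕ, m ≤ n ∧ D m * θ ^ (n + 1) ≤ ε := by
    intro m
    have hlim : Tendsto (fun n : ℕ => D m * θ ^ (n + 1)) atTop (𝓝 0) := by
      have := ((tendsto_pow_atTop_nhds_zero_of_lt_one hθ.le hθ1).comp
        (tendsto_add_atTop_nat 1)).const_mul (D m)
      simpa using this
    obtain ⟨n, hn1, hn2⟩ := ((eventually_ge_atTop m).and (hlim.eventually (ge_mem_nhds hε))).exists
    exact ⟨n, hn1, hn2⟩
  choose g hg1 hg2 using hstep
  let f : ℕ → ℕ := fun j => g^[j] N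
  have hf_succ : ∀ j, f (j + 1) = g (f j) := fun j => Function.iterate_succ_apply' g j N
  have hmono : Monotone f := monotone_nat_of_le_succ fun j => by rw [hf_succ]; exact hg1 _
  refine ⟨f Q, B * √B, by positivity, fun x => ?_⟩
  -- the inequality on finite linear combinations
  have key : ∀ c : I × ℕ × ℕ →₀ ℂ,
      ‖L (Finsupp.linearCombination ℂ (padFamily e ξ) c)‖ ^ 2 ≤
      B * √B * ‖Finsupp.linearCombination ℂ (padFamily e ξ) c‖ *
        ‖(lowSpace e ξ (f Q)).starProjection (Finsupp.linearCombination ℂ (padFamily e ξ) c)‖ +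
      δ * ‖Finsupp.linearCombination ℂ (padFamily e ξ) c‖ ^ 2 := by
    intro c
    set T := Finsupp.linearCombination ℂ (padFamily e ξ) with hT
    set X := ‖T c‖ with hX
    let tr : ℕ → (I × ℕ × ℕ →₀ ℂ) := fun n => c.filter fun p => p.2.1 ≤ n
    have henergy : ∀ n, ∑' p, ‖tr n p‖ ^ 2 ≤ ∑' p, ‖c p‖ ^ 2 := by
      intro n
      refine (summable_norm_sq _).tsum_le_tsum (fun p => ?_) (summable_norm_sq _)
      simp only [tr, Finsupp.filter_apply]
      split_ifs
      · exact le_rfl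
      · simp
    have hcX : β * ∑' p, ‖c p‖ ^ 2 ≤ B * X ^ 2 := by
      calc _ = B * (α * ∑' p, ‖c p‖ ^ 2) := by rw [hB]; field_simp
        _ ≤ _ := mul_le_mul_of_nonneg_left (h.le_norm c) hB0.le
    have hnorm : ∀ n, ‖T (tr n)‖ ≤ √B * X := by
      intro n
      refine le_of_sq_le_sq ?_ (by positivity)
      rw [mul_pow, Real.sq_sqrt hB0.le]
      exact (h.norm_le _).trans ((mul_le_mul_of_nonneg_left (henergy n) hβ.le).trans hcX)
    -- the masses of the gaps between consecutive levels sum up to at most `B X ^ 2`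
    obtain ⟨j, hj, hgap⟩ : ∃ j ∈ Finset.range Q, ‖T (tr (f (j + 1))) - T (tr (f j))‖ ^ 2 ≤
        ε ^ 2 * X ^ 2 := by
      by_contra! hcon
      have h1 : ∑ j ∈ Finset.range Q, ε ^ 2 * X ^ 2 ≤ B * X ^ 2 := by
        calc _ ≤ ∑ j ∈ Finset.range Q, (β * (∑' p, ‖tr (f (j + 1)) p‖ ^ 2) -
              β * ∑' p, ‖tr (f j) p‖ ^ 2) :=
              Finset.sum_le_sum fun j hj => (hcon j hj).le.trans
                (h.norm_sq_filter_sub_le (hmono j.le_succ) c)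
          _ = β * (∑' p, ‖tr (f Q) p‖ ^ 2) - β * ∑' p, ‖tr (f 0) p‖ ^ 2 :=
              Finset.sum_range_sub (fun j => β * ∑' p, ‖tr (f j) p‖ ^ 2) Q
          _ ≤ β * ∑' p, ‖c p‖ ^ 2 := by
              have h2 : 0 ≤ ∑' p, ‖tr (f 0) p‖ ^ 2 := tsum_nonneg fun p => by positivity
              have h3 := mul_le_mul_of_nonneg_left (henergy (f Q)) hβ.le
              have h4 := mul_nonneg hβ.le h2
              linarith
          _ ≤ _ := hcX
      rw [Finset.sum_const, Finset.card_range, nsmul_eq_mul] at h1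
      have hX0 : X ^ 2 = 0 := by
        by_contra h0
        have h5 : 0 < X ^ 2 := lt_of_le_of_ne (sq_nonneg _) (Ne.symm h0)
        rw [div_lt_iff₀ (by positivity)] at hQ
        nlinarith
      have h0Q : 0 ∈ Finset.range Q := Finset.mem_range.2 (by exact_mod_cast hQ0)
      have h6 := (hcon 0 h0Q).trans_le ((h.norm_sq_filter_sub_le (hmono (Nat.le_succ 0)) c).trans
        (sub_le_self _ (mul_nonneg hβ.le (tsum_nonneg fun p => by positivity))))
      have h7 := mul_le_mul_of_nonneg_left (henergy (f (0 + 1))) hβ.le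
      have h8 := h6.trans_le (h7.trans hcX)
      rw [hX0] at h8
      simp at h8
    have hgap' : ‖T (tr (f (j + 1))) - T (tr (f j))‖ ≤ ε * X := by
      refine le_of_sq_le_sq ?_ (by positivity)
      rwa [mul_pow]
    set y := T (tr (f j)) with hy
    have hyV : y ∈ lowSpace e ξ (f j) := IsTruncation.linearCombination_filter_mem _ c
    have hLy : L (T c) = L y := by
      rw [hL.apply_linearCombination, hy, hL.apply_linearCombination]
      congr 1
      ext p
      simp only [tr, Finsupp.filter_apply]
      have h9 : N ≤ f j := hmono (Nat.zero_le j)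
      by_cases h10 : p.2.1 ≤ N
      · simp [h10, h10.trans h9]
      · simp [h10]
    have hLn : ‖L y‖ ^ 2 ≤ B * ‖y‖ ^ 2 := by
      rw [hy, hL.apply_linearCombination]
      refine (h.norm_le _).trans ?_
      have h11 : ∑' p, ‖(tr (f j)).filter (fun p => p.2.1 ≤ N) p‖ ^ 2 ≤
          ∑' p, ‖tr (f j) p‖ ^ 2 := by
        refine (summable_norm_sq _).tsum_le_tsum (fun p => ?_) (summable_norm_sq _)
        rw [Finsupp.filter_apply]
        split_ifs
        · exact le_rfl
        · simp
      calc _ ≤ β * ∑' p, ‖tr (f j) p‖ ^ 2 := mul_le_mul_of_nonneg_left h11 hβ.le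
        _ = B * (α * ∑' p, ‖tr (f j) p‖ ^ 2) := by rw [hB]; field_simp
        _ ≤ _ := mul_le_mul_of_nonneg_left (h.le_norm _) hB0.le
    -- the part of the vector beyond the next level is almost orthogonal to `y`
    have hsplit : T c = T (tr (f (j + 1))) + T (c.filter fun p => f (j + 1) + 1 ≤ p.2.1) := by
      rw [← map_add]
      congr 1
      ext p
      simp only [tr, Finsupp.add_apply, Finsupp.filter_apply]
      by_cases h12 : p.2.1 ≤ f (j + 1)
      · have : ¬ f (j + 1) + 1 ≤ p.2.1 := by omega
        simp [h12, this]
      · have : f (j + 1) + 1 ≤ p.2.1 := by omega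
        simp [h12, this]
    have hcr : ‖⟪y, T (c.filter fun p => f (j + 1) + 1 ≤ p.2.1)⟫_ℂ‖ ≤ ε * ‖y‖ * X := by
      refine (hD (f j) (f (j + 1) + 1) y hyV c).trans ?_
      have h13 := hg2 (f j)
      rw [← hf_succ] at h13
      gcongr
    have hproj : ‖⟪y, T c⟫_ℂ‖ ≤ ‖y‖ * ‖(lowSpace e ξ (f Q)).starProjection (T c)‖ := by
      have h14 : y ∈ lowSpace e ξ (f Q) :=
        lowSpace_mono ξ (hmono (Finset.mem_range.1 hj).le) hyV
      rw [← Submodule.starProjection_eq_self_iff.2 h14,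
        Submodule.inner_starProjection_left_eq_right, Submodule.starProjection_eq_self_iff.2 h14]
      exact norm_inner_le_norm _ _
    have hyy : ‖y‖ ^ 2 ≤ ‖y‖ * ‖(lowSpace e ξ (f Q)).starProjection (T c)‖ +
        ε * ‖y‖ * X + ‖y‖ * (ε * X) := by
      have e1 : ⟪y, y⟫_ℂ = ⟪y, T c⟫_ℂ - ⟪y, T (c.filter fun p => f (j + 1) + 1 ≤ p.2.1)⟫_ℂ -
          ⟪y, T (tr (f (j + 1))) - y⟫_ℂ := by
        conv_rhs => rw [hsplit]
        rw [inner_add_right, inner_sub_right]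
        ring
      have e2 : ‖⟪y, y⟫_ℂ‖ = ‖y‖ ^ 2 := by
        rw [inner_self_eq_norm_sq_to_K, norm_pow, RCLike.norm_ofReal, abs_norm]
      rw [← e2, e1]
      refine (norm_sub_le _ _).trans (add_le_add ((norm_sub_le _ _).trans
        (add_le_add hproj hcr)) ((norm_inner_le_norm _ _).trans ?_))
      gcongr
    have hyB := hnorm (f j)
    rw [← hy] at hyB
    set Pn := ‖(lowSpace e ξ (f Q)).starProjection (T c)‖ with hPn
    have hP0 : 0 ≤ Pn := norm_nonneg _
    have hX0 : 0 ≤ X := norm_nonneg _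
    rw [hLy]
    calc ‖L y‖ ^ 2 ≤ B * ‖y‖ ^ 2 := hLn
      _ ≤ B * (‖y‖ * (Pn + ε * X + ε * X)) := by
          refine mul_le_mul_of_nonneg_left (hyy.trans_eq ?_) hB0.le
          ring
      _ ≤ B * (√B * X * (Pn + ε * X + ε * X)) := by gcongr
      _ = B * √B * X * Pn + B * (√B * ε + √B * ε) * X ^ 2 := by ring
      _ ≤ _ := by gcongr
  -- extension to all vectors
  have hcl : CompleteSpace (fockLine q e) :=
    (Submodule.isClosed_topologicalClosure _).completeSpace_coe
  have horth : ∀ x ∈ (fockLine q e)ᗮ, ‖L x‖ ^ 2 ≤ B * √B * ‖x‖ *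
      ‖(lowSpace e ξ (f Q)).starProjection x‖ + δ * ‖x‖ ^ 2 := fun x hx =>
    h.orthogonal_induction (P := fun x => ‖L x‖ ^ 2 ≤ B * √B * ‖x‖ *
      ‖(lowSpace e ξ (f Q)).starProjection x‖ + δ * ‖x‖ ^ 2)
      (isClosed_le (by fun_prop) (by fun_prop)) key hx
  set x₀ := (fockLine q e).starProjection x with hx₀
  have h1 := horth _ (Submodule.sub_starProjection_mem_orthogonal (K := fockLine q e) x)
  have h2 : L (x - x₀) = L x := by
    rw [map_sub, hL.on_line _ (Submodule.starProjection_apply_mem _ _), sub_zero]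
  have h3 : (lowSpace e ξ (f Q)).starProjection (x - x₀) =
      (lowSpace e ξ (f Q)).starProjection x := by
    rw [map_sub, sub_eq_self, Submodule.starProjection_apply_eq_zero_iff]
    exact Submodule.orthogonal_le (h.lowSpace_le_orthogonal _)
      ((fockLine q e).le_orthogonal_orthogonal (Submodule.starProjection_apply_mem _ _))
  have h4 : ‖x - x₀‖ ≤ ‖x‖ := by
    rw [hx₀, ← Submodule.starProjection_orthogonal_val]
    exact Submodule.norm_starProjection_apply_le _ x
  rw [← hx₀, h2, h3] at h1
  refine h1.trans ?_
  gcongr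

end PaddedBasis

end

/-! ### The von Neumann algebra generated by a self-adjoint operator -/

section

variable {H : Type*} [NormedAddCommGroup H] [InnerProductSpace ℝ H]
variable {q : Set.Ioo (-1 : ℝ) 1} {e : H} {I : Type*}

section Generated

variable {K : Type*} [NormedAddCommGroup K] [InnerProductSpace ℂ K] [CompleteSpace K]

theorem generated_commute {S : Set (K →L[ℂ] K)} {w T : K →L[ℂ] K} (hw : w ∈ generated S)
    (hT : ∀ s ∈ S, s * T = T * s ∧ star s * T = T * star s) : T * w = w * T := by
  have h : T ∈ StarSubalgebra.centralizer ℂ S :=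
    (StarSubalgebra.mem_centralizer_iff ℂ).2 hT
  exact ((StarSubalgebra.mem_centralizer_iff ℂ).1 hw T h).1

/-- The projection onto a closed subspace commutes with every symmetric operator leaving the
subspace invariant. -/
theorem starProjection_comm {E : Type*} [NormedAddCommGroup E] [InnerProductSpace ℂ E]
    {U : Submodule ℂ E} [U.HasOrthogonalProjection] {T : E →L[ℂ] E}
    (hT : ∀ x y, ⟪T x, y⟫_ℂ = ⟪x, T y⟫_ℂ) (hU : ∀ x ∈ U, T x ∈ U) (x : E) :
    U.starProjection (T x) = T (U.starProjection x) := by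
  refine (Submodule.eq_starProjection_of_mem_of_inner_eq_zero
    (hU _ (Submodule.starProjection_apply_mem _ _)) fun w hw => ?_)
  rw [← map_sub, hT]
  exact Submodule.inner_left_of_mem_orthogonal (hU w hw)
    (Submodule.sub_starProjection_mem_orthogonal x)

/-- Two-dimensional amplification of the double commutant theorem: a closed subspace of `K ⊕ K`
invariant under `S ⊕ S`, for `S` self-adjoint, is invariant under `w ⊕ w` for all `w` in the von
Neumann algebra generated by `S`. -/
theorem generated_prod_mem {S w : K →L[ℂ] K} (hS : ∀ x y, ⟪S x, y⟫_ℂ = ⟪x, S y⟫_ℂ)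
    (hw : w ∈ generated {S}) {U : Submodule ℂ (WithLp 2 (K × K))}
    (hUc : IsClosed (U : Set (WithLp 2 (K × K))))
    (hU : ∀ x y : K, WithLp.toLp 2 (x, y) ∈ U → WithLp.toLp 2 (S x, S y) ∈ U) {x y : K}
    (hxy : WithLp.toLp 2 (x, y) ∈ U) : WithLp.toLp 2 (w x, w y) ∈ U := by
  have hcomp : CompleteSpace U := hUc.completeSpace_coe
  let φ := WithLp.prodContinuousLinearEquiv 2 ℂ K K
  let P := U.starProjection
  let D : WithLp 2 (K × K) →L[ℂ] WithLp 2 (K × K) :=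
    (φ.symm : K × K →L[ℂ] WithLp 2 (K × K)) ∘L (S.prodMap S) ∘L
      (φ : WithLp 2 (K × K) →L[ℂ] K × K)
  have hD : ∀ a b : K, D (WithLp.toLp 2 (a, b)) = WithLp.toLp 2 (S a, S b) := fun a b => rfl
  have hDP : ∀ z, P (D z) = D (P z) := by
    intro z
    refine starProjection_comm ?_ ?_ z
    · rintro ⟨a, b⟩ ⟨a', b'⟩
      rw [hD, hD, WithLp.prod_inner_apply, WithLp.prod_inner_apply]
      exact congrArg₂ (· + ·) (hS a a') (hS b b')
    · rintro ⟨a, b⟩ h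
      exact hU a b h
  -- the matrix entries of the projection commute with `S`
  have hblock : ∀ T : K →L[ℂ] K, (∀ a, T (S a) = S (T a)) → ∀ a, T (w a) = w (T a) := by
    intro T hT a
    have hS' : star S = S := by
      rw [ContinuousLinearMap.star_eq_adjoint]
      exact ((ContinuousLinearMap.eq_adjoint_iff S S).2 hS).symm
    have h := generated_commute hw (T := T) fun s hs => by
      obtain rfl : s = S := hs
      have : s * T = T * s := by
        ext a
        exact (hT a).symm
      exact ⟨this, by rw [hS', this]⟩
    exact DFunLike.congr_fun h a
  let F : WithLp 2 (K × K) →L[ℂ] K := ContinuousLinearMap.fst ℂ K K ∘L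
    (φ : WithLp 2 (K × K) →L[ℂ] K × K)
  let G : WithLp 2 (K × K) →L[ℂ] K := ContinuousLinearMap.snd ℂ K K ∘L
    (φ : WithLp 2 (K × K) →L[ℂ] K × K)
  let i₁ : K →L[ℂ] WithLp 2 (K × K) := (φ.symm : K × K →L[ℂ] WithLp 2 (K × K)) ∘L
    ContinuousLinearMap.inl ℂ K K
  let i₂ : K →L[ℂ] WithLp 2 (K × K) := (φ.symm : K × K →L[ℂ] WithLp 2 (K × K)) ∘L
    ContinuousLinearMap.inr ℂ K K
  have hsum : ∀ a b : K, WithLp.toLp 2 (a, b) = i₁ a + i₂ b := fun a b => by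
    apply φ.injective
    change (a, b) = (a, 0) + (0, b)
    simp
  have hD₁ : ∀ a, i₁ (S a) = D (i₁ a) := fun a => by
    change WithLp.toLp 2 (S a, 0) = WithLp.toLp 2 (S a, S 0)
    rw [map_zero]
  have hD₂ : ∀ a, i₂ (S a) = D (i₂ a) := fun a => by
    change WithLp.toLp 2 (0, S a) = WithLp.toLp 2 (S 0, S a)
    rw [map_zero]
  have key : ∀ Q : WithLp 2 (K × K) →L[ℂ] K, (∀ z, Q (D z) = S (Q z)) →
      Q (P (WithLp.toLp 2 (w x, w y))) = w (Q (P (WithLp.toLp 2 (x, y)))) := by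
    intro Q hQ
    have h1 := hblock (Q ∘L P ∘L i₁) (fun a => by
      simp only [ContinuousLinearMap.comp_apply, hD₁, hDP, hQ]) x
    have h2 := hblock (Q ∘L P ∘L i₂) (fun a => by
      simp only [ContinuousLinearMap.comp_apply, hD₂, hDP, hQ]) y
    simp only [ContinuousLinearMap.comp_apply] at h1 h2
    rw [hsum, hsum, map_add, map_add, map_add, map_add, map_add, h1, h2]
  have hP : P (WithLp.toLp 2 (x, y)) = WithLp.toLp 2 (x, y) :=
    Submodule.starProjection_eq_self_iff.2 hxy
  have h1 := key F fun _ => rfl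
  have h2 := key G fun _ => rfl
  rw [hP] at h1 h2
  refine Submodule.starProjection_eq_self_iff.1 (φ.injective (Prod.ext h1 h2))

end Generated

/-! ### Normally ordered polynomials -/

open Finset.HasAntidiagonal (antidiagonal mem_antidiagonal)

/-- The normally ordered polynomial `∑_{i + l = j} c^i a^l / (F_i F_l)` in the rescaled creation and
annihilation operators, where `F_n = ∏_{m ≤ n} (1 - q ^ m)`. It is the `j`-th `q`-Hermite
polynomial of `s(e)`, up to normalization. -/
def wick (q : Set.Ioo (-1 : ℝ) 1) (e : H) (j : ℕ) : Fock q H →L[ℂ] Fock q H :=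
  ∑ p ∈ antidiagonal j,
    ((eulerProd q p.1 : ℂ)⁻¹ • leftCre q e ^ p.1) * ((eulerProd q p.2 : ℂ)⁻¹ • leftAnn q e ^ p.2)

theorem wick_zero : wick q e 0 = 1 := by
  simp [wick, eulerProd_zero]

theorem leftCre_mul_divided (i : ℕ) :
    leftCre q e * ((eulerProd q i : ℂ)⁻¹ • leftCre q e ^ i) =
      (1 - ((q : ℝ) : ℂ) ^ (i + 1)) • ((eulerProd q (i + 1) : ℂ)⁻¹ • leftCre q e ^ (i + 1)) := by
  have := one_sub_pow_ne q i
  have := eulerProd_ne q i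
  rw [mul_smul_comm, ← pow_succ', smul_smul, eulerProd_succ_complex]
  congr 1
  field_simp

theorem leftAnn_mul_divided (i : ℕ) :
    leftAnn q e * ((eulerProd q i : ℂ)⁻¹ • leftAnn q e ^ i) =
      (1 - ((q : ℝ) : ℂ) ^ (i + 1)) • ((eulerProd q (i + 1) : ℂ)⁻¹ • leftAnn q e ^ (i + 1)) := by
  have := one_sub_pow_ne q i
  have := eulerProd_ne q i
  rw [mul_smul_comm, ← pow_succ', smul_smul, eulerProd_succ_complex]
  congr 1
  field_simp

theorem leftAnn_mul_divided_leftCre (he : ‖e‖ = 1) (i : ℕ) :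
    leftAnn q e * ((eulerProd q i : ℂ)⁻¹ • leftCre q e ^ i) =
      ((q : ℝ) : ℂ) ^ i • (((eulerProd q i : ℂ)⁻¹ • leftCre q e ^ i) * leftAnn q e) +
        if i = 0 then 0 else (eulerProd q (i - 1) : ℂ)⁻¹ • leftCre q e ^ (i - 1) := by
  have h : leftAnn q e * leftCre q e ^ i = ((q : ℝ) : ℂ) ^ i • (leftCre q e ^ i * leftAnn q e) +
      (1 - ((q : ℝ) : ℂ) ^ i) • leftCre q e ^ (i - 1) := by
    refine ContinuousLinearMap.ext fun x => ?_
    exact leftAnn_leftCre_pow he i x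
  rw [mul_smul_comm, h, smul_add, smul_smul, smul_smul, smul_mul_assoc, smul_smul,
    mul_comm (((q : ℝ) : ℂ) ^ i)]
  congr 1
  cases i with
  | zero => simp
  | succ i =>
    rw [if_neg i.succ_ne_zero, Nat.add_sub_cancel]
    have := one_sub_pow_ne q i
    have := eulerProd_ne q i
    rw [eulerProd_succ_complex]
    congr 1
    field_simp

/-- The three-term recursion of the `q`-Hermite polynomials. -/
theorem add_mul_wick (he : ‖e‖ = 1) (j : ℕ) :
    (leftCre q e + leftAnn q e) * wick q e j =
      (1 - ((q : ℝ) : ℂ) ^ (j + 1)) • wick q e (j + 1) + if j = 0 then 0 else wick q e (j - 1) := by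
  set γ : ℕ → Fock q H →L[ℂ] Fock q H := fun i => (eulerProd q i : ℂ)⁻¹ • leftCre q e ^ i with hγ
  set δ : ℕ → Fock q H →L[ℂ] Fock q H := fun i => (eulerProd q i : ℂ)⁻¹ • leftAnn q e ^ i with hδ
  have hw : ∀ j, wick q e j = ∑ p ∈ antidiagonal j, γ p.1 * δ p.2 := fun _ => rfl
  have h1 : leftCre q e * wick q e j = ∑ p ∈ antidiagonal (j + 1),
      (1 - ((q : ℝ) : ℂ) ^ p.1) • (γ p.1 * δ p.2) := by
    rw [Finset.Nat.sum_antidiagonal_succ, pow_zero, sub_self, zero_smul, zero_add, hw,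
      Finset.mul_sum]
    refine Finset.sum_congr rfl fun p _ => ?_
    rw [← mul_assoc, leftCre_mul_divided, smul_mul_assoc]
  have h2 : ∑ p ∈ antidiagonal j, ((q : ℝ) : ℂ) ^ p.1 • (γ p.1 * leftAnn q e * δ p.2) =
      ∑ p ∈ antidiagonal (j + 1),
        (((q : ℝ) : ℂ) ^ p.1 * (1 - ((q : ℝ) : ℂ) ^ p.2)) • (γ p.1 * δ p.2) := by
    rw [Finset.Nat.sum_antidiagonal_succ', pow_zero, sub_self, mul_zero, zero_smul, zero_add]
    refine Finset.sum_congr rfl fun p _ => ?_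
    rw [mul_assoc, leftAnn_mul_divided, mul_smul_comm, smul_smul]
  have h3 : ∑ p ∈ antidiagonal j, (if p.1 = 0 then 0 else γ (p.1 - 1)) * δ p.2 =
      if j = 0 then 0 else wick q e (j - 1) := by
    cases j with
    | zero => simp
    | succ j =>
      rw [if_neg j.succ_ne_zero, Nat.add_sub_cancel, hw, Finset.Nat.sum_antidiagonal_succ,
        if_pos rfl, zero_mul, zero_add]
      rfl
  have h4 : leftAnn q e * wick q e j =
      ∑ p ∈ antidiagonal j, ((q : ℝ) : ℂ) ^ p.1 • (γ p.1 * leftAnn q e * δ p.2) +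
      ∑ p ∈ antidiagonal j, (if p.1 = 0 then 0 else γ (p.1 - 1)) * δ p.2 := by
    rw [hw, Finset.mul_sum, ← Finset.sum_add_distrib]
    refine Finset.sum_congr rfl fun p _ => ?_
    rw [← mul_assoc, leftAnn_mul_divided_leftCre he, add_mul, smul_mul_assoc]
  rw [add_mul, h1, h4, h2, h3, ← add_assoc, ← Finset.sum_add_distrib, hw (j + 1),
    Finset.smul_sum]
  congr 1
  refine Finset.sum_congr rfl fun p hp => ?_
  rw [← add_smul, ← mem_antidiagonal.1 hp, pow_add]
  congr 1
  ring

theorem leftAnn_vacuum : leftAnn q e (vacuum q H) = 0 :=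
  leftAnn_eq_zero (vacuum_mem_kernelSpace e)

theorem wick_vacuum (j : ℕ) : wick q e j (vacuum q H) =
    (eulerProd q j : ℂ)⁻¹ • (leftCre q e ^ j) (vacuum q H) := by
  rw [wick, sum_apply, Finset.sum_eq_single (j, 0)]
  · simp [eulerProd_zero]
  · rintro ⟨i, l⟩ h1 h2
    obtain ⟨l, rfl⟩ : ∃ l', l = l' + 1 := by
      refine Nat.exists_eq_add_one_of_ne_zero ?_
      rintro rfl
      rw [mem_antidiagonal] at h1
      exact h2 (by simpa using h1)
    rw [mul_apply_eq_comp, smul_apply, smul_apply, pow_succ, mul_apply_eq_comp, leftAnn_vacuum,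
      map_zero, smul_zero, map_zero, smul_zero]
  · simp

theorem inner_leftCre_pow_vacuum (he : ‖e‖ = 1) (i j : ℕ) :
    ⟪(leftCre q e ^ i) (vacuum q H), (leftCre q e ^ j) (vacuum q H)⟫_ℂ =
      if i = j then (eulerProd q i : ℂ) else 0 := by
  have h : ∀ i, (leftCre q e ^ i) (vacuum q H) = scaledPad q e i 0 (vacuum q H) := fun i => by
    simp [scaledPad]
  rw [h, h]
  split_ifs with hij
  · subst hij
    rw [inner_self_eq_norm_sq_to_K, RCLike.ofReal_eq_complex_ofReal, ← Complex.ofReal_pow,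
      norm_scaledPad_zero he (vacuum_mem_kernelSpace e), norm_vacuum, one_pow, mul_one]
  · exact inner_scaledPad_eq_zero he (vacuum_mem_kernelSpace e) (vacuum_mem_kernelSpace e) _ _ _ _ _
      rfl (Or.inl (by simpa using hij))

theorem gaussian_symm (h : H) (x y : Fock q H) :
    ⟪gaussian q h x, y⟫_ℂ = ⟪x, gaussian q h y⟫_ℂ := by
  rw [gaussian, add_apply, add_apply, inner_add_left, inner_add_right, annihilation,
    ContinuousLinearMap.adjoint_inner_right, ContinuousLinearMap.adjoint_inner_left, add_comm,
    add_comm]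

theorem gaussian_eq (e : H) :
    gaussian q e = ((scale q : ℝ) : ℂ)⁻¹ • (leftCre q e + leftAnn q e) := by
  have h : ((scale q : ℝ) : ℂ) ≠ 0 := by exact_mod_cast (scale_pos q).ne'
  rw [leftCre, leftAnn, ← smul_add, smul_smul, inv_mul_cancel₀ h, one_smul, gaussian]

/-- `(w x, w Ω)` is a limit of pairs `(X x, X Ω)`, with `X` running through the linear span of the
normally ordered polynomials. -/
theorem mem_closure_wick (he : ‖e‖ = 1) {w : Fock q H →L[ℂ] Fock q H}
    (hw : w ∈ generatorSubalgebra q e) (x : Fock q H) :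
    WithLp.toLp 2 (w x, w (vacuum q H)) ∈ (Submodule.span ℂ (Set.range fun j =>
      (WithLp.toLp 2 (wick q e j x, wick q e j (vacuum q H)) :
        WithLp 2 (Fock q H × Fock q H)))).topologicalClosure := by
  set g : ℕ → WithLp 2 (Fock q H × Fock q H) := fun j =>
    WithLp.toLp 2 (wick q e j x, wick q e j (vacuum q H)) with hg
  refine generated_prod_mem (gaussian_symm e) hw (Submodule.isClosed_topologicalClosure _) ?_ ?_
  · let φ := WithLp.prodContinuousLinearEquiv 2 ℂ (Fock q H) (Fock q H)
    let D : WithLp 2 (Fock q H × Fock q H) →L[ℂ] WithLp 2 (Fock q H × Fock q H) :=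
      (φ.symm : Fock q H × Fock q H →L[ℂ] WithLp 2 (Fock q H × Fock q H)) ∘L
        ((gaussian q e).prodMap (gaussian q e)) ∘L
        (φ : WithLp 2 (Fock q H × Fock q H) →L[ℂ] Fock q H × Fock q H)
    have hspan : ∀ z ∈ Submodule.span ℂ (Set.range g), D z ∈ Submodule.span ℂ (Set.range g) := by
      intro z hz
      refine (Submodule.span_le (p := (Submodule.span ℂ (Set.range g)).comap
        (D : WithLp 2 (Fock q H × Fock q H) →ₗ[ℂ] WithLp 2 (Fock q H × Fock q H)))).2 ?_ hz
      rintro _ ⟨j, rfl⟩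
      have h1 : D (g j) = ((scale q : ℝ) : ℂ)⁻¹ • ((1 - ((q : ℝ) : ℂ) ^ (j + 1)) • g (j + 1) +
          if j = 0 then 0 else g (j - 1)) := by
        have h2 : ∀ y, gaussian q e (wick q e j y) = ((scale q : ℝ) : ℂ)⁻¹ •
            ((1 - ((q : ℝ) : ℂ) ^ (j + 1)) • wick q e (j + 1) y +
              if j = 0 then 0 else wick q e (j - 1) y) := by
          intro y
          rw [gaussian_eq, smul_apply, ← mul_apply_eq_comp, add_mul_wick he, add_apply, smul_apply]
          split_ifs <;> rfl
        apply φ.injective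
        change (gaussian q e (wick q e j x), gaussian q e (wick q e j (vacuum q H))) = _
        rw [h2, h2]
        split_ifs
        · simp [φ, g]
        · simp [φ, g]
      change D (g j) ∈ Submodule.span ℂ (Set.range g)
      rw [h1]
      refine Submodule.smul_mem _ _ (Submodule.add_mem _ (Submodule.smul_mem _ _
        (Submodule.subset_span ⟨_, rfl⟩)) ?_)
      split_ifs
      · exact Submodule.zero_mem _
      · exact Submodule.subset_span ⟨_, rfl⟩
    intro a b hab
    exact (show Set.MapsTo D _ _ from hspan).closure D.continuous hab
  · refine Submodule.le_topologicalClosure _ (Submodule.subset_span ⟨0, ?_⟩)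
    change WithLp.toLp 2 (wick q e 0 x, wick q e 0 (vacuum q H)) = _
    rw [wick_zero]
    rfl

namespace PaddedBasis

variable {d : I → ℕ} {ξ : I → Fock q H} {α β : ℝ}

/-- The matrix entries `⟪c^i a^l v, v'⟫ = ⟪a^l v, a^i v'⟫` decay geometrically in `i + l` on
`lowSpace`. -/
theorem exists_inner_wick_le (h : PaddedBasis e d ξ α β) (he : ‖e‖ = 1) (N : ℕ) :
    ∃ u : ℕ → ℝ, Summable u ∧ (∀ j, 0 ≤ u j) ∧ ∀ j, ∀ v ∈ lowSpace e ξ N, ∀ v' ∈ lowSpace e ξ N,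
      ‖⟪wick q e j v, v'⟫_ℂ‖ ≤ u j * (‖v‖ * ‖v'‖) := by
  obtain ⟨θ, hθ, hθ1, hdecay⟩ := h.exists_decay he
  obtain ⟨C, hC, hdecay⟩ := hdecay N
  obtain ⟨E, hE, hdiv⟩ := eulerProd_div_le q
  have hinv : ∀ n, ‖((eulerProd q n : ℝ) : ℂ)⁻¹‖ ≤ E := fun n => by
    rw [norm_inv, Complex.norm_real, Real.norm_of_nonneg (eulerProd_q_pos q n).le]
    have h1 := hdiv 0 n
    rwa [eulerProd_zero, one_div] at h1
  refine ⟨fun j => (E * C) ^ 2 * ((j + 1 : ℕ) * θ ^ j), ?_, fun j => by positivity, ?_⟩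
  · refine Summable.mul_left _ ?_
    have h1 := (summable_nat_add_iff 1).2 (summable_pow_mul_geometric_of_norm_lt_one (R := ℝ) 1
      (r := θ) (by rwa [Real.norm_of_nonneg hθ.le]))
    refine (h1.mul_left θ⁻¹).congr fun j => ?_
    rw [pow_one, pow_succ]
    field_simp
  · intro j v hv v' hv'
    rw [wick, sum_apply, sum_inner]
    refine (norm_sum_le _ _).trans ?_
    have h2 : ∀ p ∈ antidiagonal j,
        ‖⟪((eulerProd q p.1 : ℂ)⁻¹ • leftCre q e ^ p.1 *
          ((eulerProd q p.2 : ℂ)⁻¹ • leftAnn q e ^ p.2)) v, v'⟫_ℂ‖ ≤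
        (E * C) ^ 2 * θ ^ j * (‖v‖ * ‖v'‖) := by
      intro p hp
      rw [mul_apply_eq_comp, smul_apply, smul_apply, map_smul, inner_smul_left, inner_smul_left,
        inner_leftCre_pow, norm_mul, norm_mul, RCLike.norm_conj, RCLike.norm_conj]
      calc _ ≤ E * (E * (‖(leftAnn q e ^ p.2) v‖ * ‖(leftAnn q e ^ p.1) v'‖)) := by
            gcongr
            · exact hinv _
            · exact hinv _
            · exact norm_inner_le_norm _ _
        _ ≤ E * (E * ((C * θ ^ p.2 * ‖v‖) * (C * θ ^ p.1 * ‖v'‖))) := by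
            gcongr
            · exact hdecay _ v hv
            · exact hdecay _ v' hv'
        _ = _ := by
            rw [← mem_antidiagonal.1 hp, pow_add]
            ring
    refine (Finset.sum_le_card_nsmul _ _ _ h2).trans_eq ?_
    rw [Finset.Nat.card_antidiagonal, nsmul_eq_mul]
    ring

/-- The coefficients of a combination of normally ordered polynomials are recovered from its
value at the vacuum by orthogonality. -/
theorem norm_coeff_le (he : ‖e‖ = 1) {E : ℝ} (hE : ∀ m, eulerProd q m ≤ E) (c : ℕ →₀ ℂ) (j : ℕ) :
    ‖c j‖ ≤ √E * ‖∑ i ∈ c.support, c i • wick q e i (vacuum q H)‖ := by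
  have h1 : ⟪(leftCre q e ^ j) (vacuum q H),
      ∑ i ∈ c.support, c i • wick q e i (vacuum q H)⟫_ℂ = c j := by
    rw [inner_sum]
    have h2 : ∀ i, ⟪(leftCre q e ^ j) (vacuum q H), c i • wick q e i (vacuum q H)⟫_ℂ =
        if i = j then c j else 0 := by
      intro i
      rw [wick_vacuum, inner_smul_right, inner_smul_right, inner_leftCre_pow_vacuum he]
      by_cases hij : i = j
      · subst hij
        rw [if_pos rfl, if_pos rfl, inv_mul_cancel₀ (eulerProd_ne q i), mul_one]
      · rw [if_neg (Ne.symm hij), if_neg hij, mul_zero, mul_zero]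
    rw [Finset.sum_congr rfl fun i _ => h2 i, Finset.sum_ite_eq']
    split_ifs with h3
    · rfl
    · exact (Finsupp.notMem_support_iff.1 h3).symm
  have h4 : (leftCre q e ^ j) (vacuum q H) = scaledPad q e j 0 (vacuum q H) := by
    simp [scaledPad]
  rw [← congrArg norm h1]
  refine (norm_inner_le_norm _ _).trans (mul_le_mul_of_nonneg_right ?_ (norm_nonneg _))
  refine Real.le_sqrt_of_sq_le ?_
  rw [h4, norm_scaledPad_zero he (vacuum_mem_kernelSpace e), norm_vacuum, one_pow, mul_one]
  exact hE j

theorem norm_inner_le_of_mem_closure_span {W K : Type*} [NormedAddCommGroup W] [NormedSpace ℂ W]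
    [NormedAddCommGroup K] [InnerProductSpace ℂ K] (F G : W →L[ℂ] K) (g : ℕ → W) (y : K) (a b : ℝ)
    (h : ∀ c : ℕ →₀ ℂ, ‖⟪∑ j ∈ c.support, c j • F (g j), y⟫_ℂ‖ ≤
      a * ‖∑ j ∈ c.support, c j • G (g j)‖ * b) (z : W)
    (hz : z ∈ (Submodule.span ℂ (Set.range g)).topologicalClosure) :
    ‖⟪F z, y⟫_ℂ‖ ≤ a * ‖G z‖ * b := by
  have hclosed : IsClosed {z | ‖⟪F z, y⟫_ℂ‖ ≤ a * ‖G z‖ * b} :=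
    isClosed_le (by fun_prop) (by fun_prop)
  refine hclosed.closure_subset_iff.2 ?_ hz
  intro z hz
  obtain ⟨c, rfl⟩ := (Finsupp.mem_span_range_iff_exists_finsupp).1 hz
  rw [Set.mem_ofPred_eq, Finsupp.sum, map_sum, map_sum]
  simpa only [map_smul] using h c

/-- Elements of `A` act on `lowSpace` as multiplication by square integrable functions would: their
matrix entries are controlled by the trace norm `‖w Ω‖`. -/
theorem exists_inner_le (h : PaddedBasis e d ξ α β) (he : ‖e‖ = 1) (N : ℕ) :
    ∃ C ≥ (0 : ℝ), ∀ w ∈ generatorSubalgebra q e, ∀ v ∈ lowSpace e ξ N, ∀ v' ∈ lowSpace e ξ N,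
      ‖⟪w v, v'⟫_ℂ‖ ≤ C * ‖w (vacuum q H)‖ * (‖v‖ * ‖v'‖) := by
  obtain ⟨u, hu, hu0, hle⟩ := h.exists_inner_wick_le he N
  obtain ⟨E, hE, hdiv⟩ := eulerProd_div_le q
  have hE' : ∀ m, eulerProd q m ≤ E := fun m => by
    have h1 := hdiv m 0
    rwa [eulerProd_zero, div_one] at h1
  have hC : 0 ≤ √E * ∑' j, u j := mul_nonneg (Real.sqrt_nonneg _) (tsum_nonneg hu0)
  refine ⟨√E * ∑' j, u j, hC, fun w hw v hv v' hv' => ?_⟩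
  have hfin : ∀ c : ℕ →₀ ℂ, ‖⟪∑ j ∈ c.support, c j • wick q e j v, v'⟫_ℂ‖ ≤
      (√E * ∑' j, u j) * ‖∑ j ∈ c.support, c j • wick q e j (vacuum q H)‖ * (‖v‖ * ‖v'‖) := by
    intro c
    rw [sum_inner]
    set Y := ‖∑ j ∈ c.support, c j • wick q e j (vacuum q H)‖ with hY
    have hY0 : 0 ≤ Y := norm_nonneg _
    calc _ ≤ ∑ j ∈ c.support, √E * Y * (u j * (‖v‖ * ‖v'‖)) := by
          refine (norm_sum_le _ _).trans (Finset.sum_le_sum fun j _ => ?_)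
          rw [inner_smul_left, norm_mul, RCLike.norm_conj]
          exact mul_le_mul (norm_coeff_le he hE' c j) (hle j v hv v' hv') (norm_nonneg _)
            (by positivity)
      _ = √E * (∑ j ∈ c.support, u j) * Y * (‖v‖ * ‖v'‖) := by
          rw [Finset.mul_sum, Finset.sum_mul, Finset.sum_mul]
          exact Finset.sum_congr rfl fun j _ => by ring
      _ ≤ _ := by
          gcongr
          exact hu.sum_le_tsum _ fun j _ => hu0 j
  let φ := WithLp.prodContinuousLinearEquiv 2 ℂ (Fock q H) (Fock q H)
  let F : WithLp 2 (Fock q H × Fock q H) →L[ℂ] Fock q H :=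
    ContinuousLinearMap.fst ℂ (Fock q H) (Fock q H) ∘L
      (φ : WithLp 2 (Fock q H × Fock q H) →L[ℂ] Fock q H × Fock q H)
  let G : WithLp 2 (Fock q H × Fock q H) →L[ℂ] Fock q H :=
    ContinuousLinearMap.snd ℂ (Fock q H) (Fock q H) ∘L
      (φ : WithLp 2 (Fock q H × Fock q H) →L[ℂ] Fock q H × Fock q H)
  have hF : ∀ a b, F (WithLp.toLp 2 (a, b)) = a := fun a b => rfl
  have hG : ∀ a b, G (WithLp.toLp 2 (a, b)) = b := fun a b => rfl
  clear_value F G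
  have hbound := norm_inner_le_of_mem_closure_span F G (fun j =>
    WithLp.toLp 2 (wick q e j v, wick q e j (vacuum q H))) v' (√E * ∑' j, u j) (‖v‖ * ‖v'‖)
    (fun c => by simpa only [hF, hG] using hfin c) _ (mem_closure_wick he hw v)
  rwa [hF, hG] at hbound

end PaddedBasis

end

/-! ### The right action of `A` -/

section

variable {H : Type*} [NormedAddCommGroup H] [InnerProductSpace ℝ H]
variable {q : Set.Ioo (-1 : ℝ) 1} {e : H} {I : Type*}

theorem star_gaussian (h : H) : star (gaussian q h) = gaussian q h := by
  rw [ContinuousLinearMap.star_eq_adjoint]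
  exact ((ContinuousLinearMap.eq_adjoint_iff _ _).2 (gaussian_symm h)).symm

theorem generated_gaussian_commute {S : Set H} {w T : Fock q H →L[ℂ] Fock q H}
    (hw : w ∈ generated (gaussian q '' S))
    (hT : ∀ h ∈ S, ∀ x, gaussian q h (T x) = T (gaussian q h x)) (x : Fock q H) :
    T (w x) = w (T x) := by
  refine DFunLike.congr_fun (generated_commute hw (T := T) ?_) x
  rintro _ ⟨h, hh, rfl⟩
  rw [star_gaussian, and_self]
  exact ContinuousLinearMap.ext fun x => hT h hh x

theorem generatorSubalgebra_commute {w T : Fock q H →L[ℂ] Fock q H}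
    (hw : w ∈ generatorSubalgebra q e)
    (hT : ∀ x, gaussian q e (T x) = T (gaussian q e x)) (x : Fock q H) :
    T (w x) = w (T x) := by
  have h : ({gaussian q e} : Set _) = gaussian q '' {e} := Set.image_singleton.symm
  rw [generatorSubalgebra, h] at hw
  refine generated_gaussian_commute hw ?_ x
  rintro _ rfl
  exact hT

/-- `A` is commutative. -/
theorem generatorSubalgebra_mul_comm {u w : Fock q H →L[ℂ] Fock q H}
    (hu : u ∈ generatorSubalgebra q e) (hw : w ∈ generatorSubalgebra q e) : u * w = w * u := by
  refine ContinuousLinearMap.ext fun x => ?_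
  refine generatorSubalgebra_commute hw (fun x => ?_) x
  exact generatorSubalgebra_commute hu (fun x => rfl) x

/-- Right multiplication by `u`, for `u` in the commutative algebra `A`: conjugation by the flip
turns the action of `s(e)` from the left into its action from the right. -/
def rightAct (u : Fock q H →L[ℂ] Fock q H) : Fock q H →L[ℂ] Fock q H :=
  flip q H ∘L u ∘L flip q H

theorem rightAct_apply (u : Fock q H →L[ℂ] Fock q H) (x : Fock q H) :
    rightAct u x = flip q H (u (flip q H x)) := rfl

theorem rightAct_rightAct (u : Fock q H →L[ℂ] Fock q H) : rightAct (rightAct u) = u := by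
  refine ContinuousLinearMap.ext fun x => ?_
  rw [rightAct_apply, rightAct_apply, flip_flip, flip_flip]

theorem rightAct_mul (u w : Fock q H →L[ℂ] Fock q H) :
    rightAct (u * w) = rightAct u * rightAct w := by
  refine ContinuousLinearMap.ext fun x => ?_
  rw [mul_apply_eq_comp, rightAct_apply, rightAct_apply, rightAct_apply, flip_flip,
    mul_apply_eq_comp]

theorem rightAct_add (u w : Fock q H →L[ℂ] Fock q H) :
    rightAct (u + w) = rightAct u + rightAct w := by
  refine ContinuousLinearMap.ext fun x => ?_
  rw [add_apply, rightAct_apply, rightAct_apply, rightAct_apply, add_apply, map_add]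

theorem rightAct_one : rightAct (1 : Fock q H →L[ℂ] Fock q H) = 1 := by
  refine ContinuousLinearMap.ext fun x => ?_
  rw [rightAct_apply, one_apply_eq_self, flip_flip, one_apply_eq_self]

theorem gaussian_rightAct_gaussian (h h' : H) (x : Fock q H) :
    gaussian q h (rightAct (gaussian q h') x) = rightAct (gaussian q h') (gaussian q h x) :=
  DFunLike.congr_fun (gaussian_comm_flip_gaussian q h h') x

/-- If `T` commutes with the right action of `s(e)`, it commutes with the right action of `A`. -/
theorem rightAct_commute {u T : Fock q H →L[ℂ] Fock q H} (hu : u ∈ generatorSubalgebra q e)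
    (hT : ∀ x, rightAct (gaussian q e) (T x) = T (rightAct (gaussian q e) x)) (x : Fock q H) :
    T (rightAct u x) = rightAct u (T x) := by
  have h := generatorSubalgebra_commute hu (T := rightAct T) (fun x => by
    have h1 := congrArg (flip q H) (hT (flip q H x))
    simp only [rightAct_apply, flip_flip] at h1
    simp only [rightAct_apply]
    exact h1) (flip q H x)
  have h2 := congrArg (flip q H) h
  simp only [rightAct_apply, flip_flip] at h2
  exact h2

/-- The right action of `A` commutes with `M`. -/
theorem gaussianAlgebra_commute_rightAct {u w : Fock q H →L[ℂ] Fock q H}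
    (hw : w ∈ gaussianAlgebra q H) (hu : u ∈ generatorSubalgebra q e) (x : Fock q H) :
    rightAct u (w x) = w (rightAct u x) := by
  have h : Set.range (gaussian q : H → _) = gaussian q '' Set.univ := Set.image_univ.symm
  rw [gaussianAlgebra, h] at hw
  refine generated_gaussian_commute hw (fun h _ x => ?_) x
  exact rightAct_commute hu (fun x => (gaussian_rightAct_gaussian h e x).symm) x

theorem flip_leftCre_pow_vacuum (j : ℕ) :
    flip q H ((leftCre q e ^ j) (vacuum q H)) = (leftCre q e ^ j) (vacuum q H) := by
  have h1 : (leftCre q e ^ j) (vacuum q H) = scaledPad q e j 0 (vacuum q H) := by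
    simp [scaledPad]
  have h2 := scaledPad_of_mem_zero (e := e) (vacuum_mem_kernelSpace (q := q) e).1.1 0 j
  rw [h1, flip_scaledPad, flip_vacuum, h2, zero_add]

/-- `Ω u = u Ω` for `u ∈ A`. -/
theorem flip_apply_vacuum (he : ‖e‖ = 1) {u : Fock q H →L[ℂ] Fock q H}
    (hu : u ∈ generatorSubalgebra q e) : flip q H (u (vacuum q H)) = u (vacuum q H) := by
  let φ := WithLp.prodContinuousLinearEquiv 2 ℂ (Fock q H) (Fock q H)
  let G : WithLp 2 (Fock q H × Fock q H) →L[ℂ] Fock q H :=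
    ContinuousLinearMap.snd ℂ (Fock q H) (Fock q H) ∘L
      (φ : WithLp 2 (Fock q H × Fock q H) →L[ℂ] Fock q H × Fock q H)
  have hG : ∀ a b, G (WithLp.toLp 2 (a, b)) = b := fun a b => rfl
  clear_value G
  have h : (Submodule.span ℂ (Set.range fun j =>
      (WithLp.toLp 2 (wick q e j (vacuum q H), wick q e j (vacuum q H)) :
        WithLp 2 (Fock q H × Fock q H)))).topologicalClosure ≤
      (flip q H ∘L G - G).ker := by
    refine Submodule.topologicalClosure_minimal _ (Submodule.span_le.2 ?_)
      (flip q H ∘L G - G).isClosed_ker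
    rintro _ ⟨j, rfl⟩
    change flip q H (G _) - G _ = 0
    rw [hG, wick_vacuum, map_smul, flip_leftCre_pow_vacuum, sub_self]
  have h1 : flip q H (G _) - G _ = 0 := h (mem_closure_wick he hu (vacuum q H))
  rw [hG] at h1
  exact sub_eq_zero.1 h1

theorem rightAct_vacuum (he : ‖e‖ = 1) {u : Fock q H →L[ℂ] Fock q H}
    (hu : u ∈ generatorSubalgebra q e) : rightAct u (vacuum q H) = u (vacuum q H) := by
  rw [rightAct_apply, flip_vacuum, flip_apply_vacuum he hu]

theorem rightAct_gaussian (e : H) :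
    rightAct (gaussian q e) = ((scale q : ℝ) : ℂ)⁻¹ • (rightCre q e + rightAnn q e) := by
  refine ContinuousLinearMap.ext fun x => ?_
  rw [rightAct_apply, gaussian_eq, smul_apply, map_smul, add_apply, map_add, flip_leftCre,
    flip_leftAnn, flip_flip, smul_apply, add_apply]

theorem rightAct_symm {u : Fock q H →L[ℂ] Fock q H} (hu : ∀ x y, ⟪u x, y⟫_ℂ = ⟪x, u y⟫_ℂ)
    (x y : Fock q H) : ⟪rightAct u x, y⟫_ℂ = ⟪x, rightAct u y⟫_ℂ := by
  rw [rightAct_apply, rightAct_apply, inner_flip, hu, inner_flip]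

namespace PaddedBasis

variable {d : I → ℕ} {ξ : I → Fock q H} {α β : ℝ}

theorem rightAct_gaussian_mem_lowSpace (h : PaddedBasis e d ξ α β) (he : ‖e‖ = 1) (N : ℕ)
    {v : Fock q H} (hv : v ∈ lowSpace e ξ N) : rightAct (gaussian q e) v ∈ lowSpace e ξ N := by
  refine (lowSpace_le (U := (lowSpace e ξ N).comap
    (rightAct (gaussian q e) : Fock q H →ₗ[ℂ] Fock q H)) ?_ ?_) hv
  · exact (Submodule.isClosed_topologicalClosure _).preimage
      (rightAct (gaussian q e) : Fock q H →L[ℂ] Fock q H).continuous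
  · rintro ⟨i, r, s⟩ hp
    change rightAct (gaussian q e) (dividedPad e r s (ξ i)) ∈ lowSpace e ξ N
    have hmem : ∀ r' s', r' ≤ r → dividedPad e r' s' (ξ i) ∈ lowSpace e ξ N := fun r' s' hr =>
      padFamily_mem_lowSpace ξ (p := (i, r', s')) (hr.trans hp)
    rw [rightAct_gaussian, smul_apply, add_apply, rightCre_dividedPad,
      rightAnn_dividedPad he (h.mem i)]
    refine Submodule.smul_mem _ _ (Submodule.add_mem _ (Submodule.smul_mem _ _ (hmem _ _ le_rfl))
      (Submodule.add_mem _ ?_ ?_))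
    · split_ifs
      · exact Submodule.zero_mem _
      · exact hmem _ _ le_rfl
    · split_ifs
      · exact Submodule.zero_mem _
      · exact Submodule.smul_mem _ _ (hmem _ _ (Nat.sub_le _ _))

/-- `lowSpace` is a right `A`-module. -/
theorem rightAct_mem_lowSpace (h : PaddedBasis e d ξ α β) (he : ‖e‖ = 1) (N : ℕ)
    {u : Fock q H →L[ℂ] Fock q H} (hu : u ∈ generatorSubalgebra q e) {v : Fock q H}
    (hv : v ∈ lowSpace e ξ N) : rightAct u v ∈ lowSpace e ξ N := by
  have h1 := rightAct_commute hu (T := (lowSpace e ξ N).starProjection)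
    (fun x => (starProjection_comm (rightAct_symm (gaussian_symm e))
      (fun y hy => h.rightAct_gaussian_mem_lowSpace he N hy) x).symm) v
  rw [Submodule.starProjection_eq_self_iff.2 hv] at h1
  exact Submodule.starProjection_eq_self_iff.1 h1

end PaddedBasis

end

/-! ### Partitions of unity in diffuse abelian von Neumann algebras -/

section

section Diffuse

variable {K : Type*} [NormedAddCommGroup K] [InnerProductSpace ℂ K] [CompleteSpace K]

theorem isStarProjection_inner {p : K →L[ℂ] K} (hp : IsStarProjection p) (x y : K) :
    ⟪p x, y⟫_ℂ = ⟪x, p y⟫_ℂ := by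
  have h : ContinuousLinearMap.adjoint p = p := hp.isSelfAdjoint
  nth_rw 1 [← h]
  exact ContinuousLinearMap.adjoint_inner_left p y x

theorem norm_sq_add_norm_sq_sub {p r : K →L[ℂ] K} (hr : IsStarProjection r)
    (h : r * p = r) (x : K) :
    ‖r x‖ ^ 2 + ‖(p - r) x‖ ^ 2 = ‖p x‖ ^ 2 := by
  have h1 : r * (p - r) = 0 := by rw [mul_sub, h, hr.isIdempotentElem.eq, sub_self]
  have h2 : ⟪r x, (p - r) x⟫_ℂ = 0 := by
    rw [isStarProjection_inner hr, ← mul_apply_eq_comp, h1, zero_apply, inner_zero_right]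
  have h3 := norm_add_sq_eq_norm_sq_add_norm_sq_of_inner_eq_zero _ _ h2
  rw [sub_apply, add_sub_cancel] at h3
  rw [sub_apply]
  nlinarith [h3]

/-- Repeated halving produces nonzero projections of arbitrarily small trace. -/
theorem IsDiffuse.exists_small {C : VonNeumannAlgebra K} (hC : IsDiffuse C) {p : K →L[ℂ] K}
    (hpC : p ∈ C) (hp : IsStarProjection p) (hp0 : p ≠ 0) (Ω : K) {η : ℝ} (hη : 0 < η) :
    ∃ r ∈ C, IsStarProjection r ∧ r * p = r ∧ r ≠ 0 ∧ ‖r Ω‖ ≤ η := by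
  have halve : ∀ n : ℕ, ∃ r ∈ C, IsStarProjection r ∧ r * p = r ∧ r ≠ 0 ∧
      ‖r Ω‖ ^ 2 ≤ (1 / 2) ^ n * ‖p Ω‖ ^ 2 := by
    intro n
    induction n with
    | zero => exact ⟨p, hpC, hp, hp.isIdempotentElem.eq, hp0, by simp⟩
    | succ n ih =>
      obtain ⟨r, hrC, hr, hrp, hr0, hle⟩ := ih
      obtain ⟨t, htC, ht, htr, ht0, htr0⟩ := hC r hrC hr hr0
      have hsum := norm_sq_add_norm_sq_sub ht htr Ω
      have htp : t * p = t := by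
        rw [← htr, mul_assoc, hrp]
      rcases le_total (‖t Ω‖ ^ 2) (‖(r - t) Ω‖ ^ 2) with h | h
      · refine ⟨t, htC, ht, htp, ht0, ?_⟩
        rw [pow_succ (1 / 2 : ℝ)]
        linarith
      · refine ⟨r - t, sub_mem hrC htC, ht.sub_of_mul_eq_left hr htr, ?_,
          sub_ne_zero.2 htr0.symm, ?_⟩
        · rw [sub_mul, hrp, htp]
        · rw [pow_succ (1 / 2 : ℝ)]
          linarith
  have hlim : Tendsto (fun n : ℕ => (1 / 2 : ℝ) ^ n * ‖p Ω‖ ^ 2) atTop (𝓝 0) := by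
    simpa using (tendsto_pow_atTop_nhds_zero_of_lt_one (by norm_num : (0 : ℝ) ≤ 1 / 2)
      (by norm_num)).mul_const (‖p Ω‖ ^ 2)
  obtain ⟨n, hn⟩ := (hlim.eventually (gt_mem_nhds (pow_pos hη 2))).exists
  obtain ⟨r, hrC, hr, hrp, hr0, hle⟩ := halve n
  exact ⟨r, hrC, hr, hrp, hr0, le_of_lt (lt_of_pow_lt_pow_left₀ 2 hη.le (hle.trans_lt hn))⟩

/-- The projections that are finite sums of mutually orthogonal projections `p ∈ C` with
`‖p Ω‖ ≤ η`. -/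
inductive IsFineSum (C : VonNeumannAlgebra K) (Ω : K) (η : ℝ) : (K →L[ℂ] K) → Prop
  | small {p : K →L[ℂ] K} : p ∈ C → IsStarProjection p → ‖p Ω‖ ≤ η → IsFineSum C Ω η p
  | add {p r : K →L[ℂ] K} : IsFineSum C Ω η p → IsFineSum C Ω η r → p * r = 0 →
      IsFineSum C Ω η (p + r)

namespace IsFineSum

variable {C : VonNeumannAlgebra K} {Ω : K} {η : ℝ} {p r : K →L[ℂ] K}

theorem mem (h : IsFineSum C Ω η p) : p ∈ C := by
  induction h with
  | small h _ _ => exact h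
  | add _ _ _ h h' => exact add_mem h h'

theorem isStarProjection (h : IsFineSum C Ω η p) : IsStarProjection p := by
  induction h with
  | small _ h _ => exact h
  | add _ _ h0 h h' => exact h.add h' h0

variable (hcomm : ∀ x ∈ C, ∀ y ∈ C, x * y = y * x)
include hcomm

theorem mul_right (h : IsFineSum C Ω η p) (hrC : r ∈ C) (hr : IsStarProjection r) :
    IsFineSum C Ω η (p * r) := by
  induction h with
  | @small p hpC hp hle =>
    refine small (mul_mem hpC hrC) (hp.mul hr (hcomm p hpC r hrC)) ?_
    rw [hcomm p hpC r hrC, mul_apply_eq_comp]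
    refine le_trans ?_ hle
    have h := norm_sq_add_norm_sq_sub hr (mul_one r) (p Ω)
    rw [one_apply_eq_self] at h
    refine le_of_sq_le_sq ?_ (norm_nonneg _)
    nlinarith [sq_nonneg ‖(1 - r) (p Ω)‖]
  | @add p p' hp hp' h0 h h' =>
    rw [add_mul]
    refine add h h' ?_
    rw [mul_assoc, ← mul_assoc r, hcomm r hrC p' hp'.mem, mul_assoc p', ← mul_assoc, h0, zero_mul]

theorem sup (hp : IsFineSum C Ω η p) (hr : IsFineSum C Ω η r) :
    IsFineSum C Ω η (p + r * (1 - p)) := by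
  refine add hp (hr.mul_right hcomm (sub_mem (one_mem C) hp.mem) hp.isStarProjection.one_sub) ?_
  rw [hcomm r hr.mem _ (sub_mem (one_mem C) hp.mem), ← mul_assoc,
    hp.isStarProjection.mul_one_sub_self, zero_mul]

end IsFineSum

/-- In a diffuse abelian von Neumann algebra, the identity is a sum of finitely many projections
of small trace. -/
theorem IsDiffuse.isFineSum_one {C : VonNeumannAlgebra K} (hC : IsDiffuse C)
    (hcomm : ∀ x ∈ C, ∀ y ∈ C, x * y = y * x) (Ω : K) {η : ℝ} (hη : 0 < η) :
    IsFineSum C Ω η 1 := by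
  set S : Set K := {x | ∃ p, IsFineSum C Ω η p ∧ p x = x} with hS
  -- the ranges of fine sums are directed, so their union is a subspace
  have hspan : ∀ x ∈ Submodule.span ℂ S, x ∈ S := by
    intro x hx
    induction hx using Submodule.span_induction with
    | mem x hx => exact hx
    | zero => exact ⟨0, .small (zero_mem C) (.zero _) (by simpa using hη.le), by simp⟩
    | add x y _ _ hx hy =>
      obtain ⟨p, hp, hpx⟩ := hx
      obtain ⟨r, hr, hry⟩ := hy
      refine ⟨_, hp.sup hcomm hr, ?_⟩
      have h1 : (p + r * (1 - p)) * p = p := by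
        rw [add_mul, mul_assoc, hp.isStarProjection.one_sub_mul_self, mul_zero, add_zero,
          hp.isStarProjection.isIdempotentElem.eq]
      have h2 : (p + r * (1 - p)) * r = r := by
        rw [add_mul, mul_sub, mul_one, sub_mul, hr.isStarProjection.isIdempotentElem.eq,
          hcomm r hr.mem p hp.mem, mul_assoc, hr.isStarProjection.isIdempotentElem.eq]
        abel
      rw [map_add]
      nth_rw 1 [← hpx]
      nth_rw 1 [← hry]
      rw [← mul_apply_eq_comp, ← mul_apply_eq_comp, h1, h2, hpx, hry]
    | smul c x _ hx =>
      obtain ⟨p, hp, hpx⟩ := hx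
      exact ⟨p, hp, by rw [map_smul, hpx]⟩
  -- the projection onto the closed span of the ranges belongs to `C`
  set W : Submodule ℂ K := (Submodule.span ℂ S).topologicalClosure with hW
  have hWc : CompleteSpace W := (Submodule.isClosed_topologicalClosure _).completeSpace_coe
  have hPW : IsStarProjection W.starProjection := isStarProjection_starProjection
  have hPC : W.starProjection ∈ C := by
    rw [VonNeumannAlgebra.IsStarProjection.mem_iff hPW]
    intro y hy x hx
    have hx' : x ∈ W := by simpa using hx
    have hmaps : Set.MapsTo y (Submodule.span ℂ S : Set K) (Submodule.span ℂ S : Set K) := by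
      intro x hx
      obtain ⟨p, hp, hpx⟩ := hspan x hx
      refine Submodule.subset_span ⟨p, hp, ?_⟩
      have h1 := VonNeumannAlgebra.mem_commutant_iff.1 hy p hp.mem
      rw [← mul_apply_eq_comp, h1, mul_apply_eq_comp, hpx]
    have h2 : y x ∈ W := hmaps.closure y.continuous hx'
    simpa using h2
  -- its complement contains no small nonzero projection of `C`, hence vanishes
  have hP1 : W.starProjection = 1 := by
    by_contra hne
    obtain ⟨r, hrC, hr, hrp, hr0, hle⟩ := hC.exists_small (sub_mem (one_mem C) hPC) hPW.one_sub
      (sub_ne_zero.2 (Ne.symm hne)) Ω hη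
    refine hr0 ?_
    have h1 : W.starProjection * r = r := by
      refine ContinuousLinearMap.ext fun x => Submodule.starProjection_eq_self_iff.2 ?_
      refine Submodule.le_topologicalClosure _ (Submodule.subset_span ⟨r, .small hrC hr hle, ?_⟩)
      exact DFunLike.congr_fun hr.isIdempotentElem.eq x
    rw [← hrp, mul_sub, mul_one, hcomm r hrC _ hPC, h1, sub_self]
  have hΩ : Ω ∈ W := Submodule.starProjection_eq_self_iff.1 (by rw [hP1, one_apply_eq_self])
  obtain ⟨x, hx, hxΩ⟩ := Metric.mem_closure_iff.1 hΩ η hη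
  obtain ⟨p, hp, hpx⟩ := hspan x hx
  have hsmall : ‖(1 - p) Ω‖ ≤ η := by
    have h1 : (1 - p) Ω = (1 - p) (Ω - x) := by
      simp [hpx]
    have h2 := norm_sq_add_norm_sq_sub hp.isStarProjection (mul_one p) (Ω - x)
    rw [one_apply_eq_self] at h2
    rw [dist_eq_norm] at hxΩ
    rw [h1]
    refine le_trans (le_of_sq_le_sq ?_ (norm_nonneg _)) hxΩ.le
    nlinarith [sq_nonneg ‖p (Ω - x)‖]
  -- the rest `1 - p` is itself a small projection
  have h3 := hp.add (.small (sub_mem (one_mem C) hp.mem) hp.isStarProjection.one_sub hsmall)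
    hp.isStarProjection.mul_one_sub_self
  rwa [add_sub_cancel] at h3

end Diffuse

end

/-! ### Asymptotically central vectors -/

section

variable {H : Type*} [NormedAddCommGroup H] [InnerProductSpace ℝ H]
variable {q : Set.Ioo (-1 : ℝ) 1} {e : H} {I : Type*}

theorem rightAct_isStarProjection {p : Fock q H →L[ℂ] Fock q H} (hp : IsStarProjection p) :
    IsStarProjection (rightAct p) where
  isIdempotentElem := by
    rw [IsIdempotentElem, ← rightAct_mul, hp.isIdempotentElem.eq]
  isSelfAdjoint := by
    rw [ContinuousLinearMap.isSelfAdjoint_iff']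
    exact ((ContinuousLinearMap.eq_adjoint_iff _ _).2
      (rightAct_symm (isStarProjection_inner hp))).symm

namespace PaddedBasis

variable {d : I → ℕ} {ξ : I → Fock q H} {α β : ℝ} {N : ℕ}

/-- If `p = ∑ p_i` is a sum of orthogonal projections of small trace, then `E = ∑ p_i ρ(p_i)` is
small on `lowSpace`, but almost equal to `p` on vectors that almost commute with `C`. -/
theorem exists_diagonal (h : PaddedBasis e d ξ α β) (he : ‖e‖ = 1) {A : ℝ} (hA0 : 0 ≤ A)
    (hA : ∀ w ∈ generatorSubalgebra q e, ∀ v ∈ lowSpace e ξ N, ∀ v' ∈ lowSpace e ξ N,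
      ‖⟪w v, v'⟫_ℂ‖ ≤ A * ‖w (vacuum q H)‖ * (‖v‖ * ‖v'‖))
    {C : VonNeumannAlgebra (Fock q H)} (hC : C ≤ generatorSubalgebra q e)
    {η : ℝ} {p : Fock q H →L[ℂ] Fock q H} (hp : IsFineSum C (vacuum q H) η p) :
    ∃ E : Fock q H →L[ℂ] Fock q H, (∀ x y, ⟪E x, y⟫_ℂ = ⟪x, E y⟫_ℂ) ∧ p * E = E ∧
      (∀ y ∈ lowSpace e ξ N, ‖E y‖ ^ 2 ≤ A * η * ‖rightAct p y‖ ^ 2) ∧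
      ∀ (l : Filter ℕ) (x : ℕ → Fock q H),
        (∀ c ∈ C, Tendsto (fun n => rightAct c (x n) - c (x n)) l (𝓝 0)) →
          Tendsto (fun n => E (x n) - p (x n)) l (𝓝 0) := by
  have hcomm : ∀ x ∈ C, ∀ y ∈ C, x * y = y * x := fun x hx y hy =>
    generatorSubalgebra_mul_comm (hC hx) (hC hy)
  induction hp with
  | @small p hpC hp hle =>
    have hpp : ∀ x, p (p x) = p x := fun x => DFunLike.congr_fun hp.isIdempotentElem.eq x
    have hpr : ∀ x, p (rightAct p x) = rightAct p (p x) := by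
      refine rightAct_commute (hC hpC) fun x => ?_
      exact generatorSubalgebra_commute (hC hpC)
        (fun x => (gaussian_rightAct_gaussian e e x)) x
    refine ⟨p * rightAct p, fun x y => ?_, ?_, fun y hy => ?_, fun l x hx => ?_⟩
    · rw [mul_apply_eq_comp, mul_apply_eq_comp, isStarProjection_inner hp,
        rightAct_symm (isStarProjection_inner hp), hpr]
    · rw [← mul_assoc, hp.isIdempotentElem.eq]
    · set z := rightAct p y with hz
      have hzV : z ∈ lowSpace e ξ N := h.rightAct_mem_lowSpace he N (hC hpC) hy
      rw [mul_apply_eq_comp, ← hz]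
      have h1 : ‖p z‖ ^ 2 = ‖⟪p z, z⟫_ℂ‖ := by
        rw [← hpp z, isStarProjection_inner hp (p z) z, inner_self_eq_norm_sq_to_K, norm_pow,
          RCLike.norm_ofReal, abs_norm, hpp]
      rw [h1]
      refine (hA p (hC hpC) z hzV z hzV).trans ?_
      rw [← sq]
      gcongr
    · have h1 : Tendsto (fun n => p (rightAct p (x n) - p (x n))) l (𝓝 0) := by
        have h2 := (p.continuous.tendsto 0).comp (hx p hpC)
        rwa [map_zero] at h2
      refine h1.congr fun n => ?_
      rw [map_sub, hpp, mul_apply_eq_comp]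
  | @add p r hp hr h0 ihp ihr =>
    obtain ⟨E, hE, hpE, hEle, hElim⟩ := ihp
    obtain ⟨F, hF, hrF, hFle, hFlim⟩ := ihr
    have h0' : r * p = 0 := by rw [← hcomm p hp.mem r hr.mem, h0]
    refine ⟨E + F, fun x y => ?_, ?_, fun y hy => ?_, fun l x hx => ?_⟩
    · rw [add_apply, add_apply, inner_add_left, inner_add_right, hE, hF]
    · have h1 : r * E = 0 := by rw [← hpE, ← mul_assoc, h0', zero_mul]
      have h2 : p * F = 0 := by rw [← hrF, ← mul_assoc, h0, zero_mul]
      rw [add_mul, mul_add, mul_add, hpE, hrF, h1, h2, add_zero, zero_add]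
    -- the summands have orthogonal ranges, so the squared norms add up
    · have orth : ∀ {s t S T : Fock q H →L[ℂ] Fock q H}, IsStarProjection s → s * t = 0 →
          s * S = S → t * T = T → ‖(S + T) y‖ ^ 2 = ‖S y‖ ^ 2 + ‖T y‖ ^ 2 := by
        intro s t S T hs hst hS hT
        have h1 : ⟪S y, T y⟫_ℂ = 0 := by
          rw [← hS, ← hT, mul_apply_eq_comp, isStarProjection_inner hs, ← mul_apply_eq_comp,
            ← mul_assoc, hst, zero_mul, zero_apply, inner_zero_right]
        have h2 := norm_add_sq_eq_norm_sq_add_norm_sq_of_inner_eq_zero _ _ h1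
        rw [add_apply]
        nlinarith [h2]
      have h1 := orth hp.isStarProjection h0 hpE hrF
      have h2 := orth (S := rightAct p) (T := rightAct r)
        (rightAct_isStarProjection hp.isStarProjection) (t := rightAct r)
        (by rw [← rightAct_mul, h0]; ext; simp [rightAct_apply])
        (rightAct_isStarProjection hp.isStarProjection).isIdempotentElem.eq
        (rightAct_isStarProjection hr.isStarProjection).isIdempotentElem.eq
      rw [rightAct_add, h1, h2, mul_add]
      exact add_le_add (hEle y hy) (hFle y hy)
    · have h1 := (hElim l x hx).add (hFlim l x hx)
      rw [add_zero] at h1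
      refine h1.congr fun n => ?_
      rw [add_apply, add_apply]
      abel

/-- Bounded sequences of vectors that asymptotically commute with a diffuse subalgebra of `A` are
asymptotically orthogonal to each `lowSpace`. -/
theorem tendsto_starProjection_lowSpace (h : PaddedBasis e d ξ α β) (he : ‖e‖ = 1) (N : ℕ)
    {C : VonNeumannAlgebra (Fock q H)} (hC : C ≤ generatorSubalgebra q e) (hdiff : IsDiffuse C)
    {l : Filter ℕ} {x : ℕ → Fock q H} {X : ℝ} (hX : ∀ n, ‖x n‖ ≤ X)
    (hx : ∀ c ∈ C, Tendsto (fun n => rightAct c (x n) - c (x n)) l (𝓝 0)) :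
    Tendsto (fun n => ‖(lowSpace e ξ N).starProjection (x n)‖) l (𝓝 0) := by
  obtain ⟨A, hA0, hA⟩ := h.exists_inner_le he N
  have hX0 : 0 ≤ X := (norm_nonneg _).trans (hX 0)
  rw [Metric.tendsto_nhds]
  intro ε hε
  -- with this `η`, the operator `E` has norm at most `ε / (2 (X + 1))` on `lowSpace`
  set η := (ε / (2 * (X + 1))) ^ 2 / (A + 1) with hη
  have hη0 : 0 < η := by positivity
  obtain ⟨E, hE, -, hEle, hElim⟩ := h.exists_diagonal he hA0 hA hC (hdiff.isFineSum_one
    (fun x hx y hy => generatorSubalgebra_mul_comm (hC hx) (hC hy)) (vacuum q H) hη0)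
  have hlim := hElim l x hx
  rw [tendsto_zero_iff_norm_tendsto_zero] at hlim
  filter_upwards [hlim.eventually (gt_mem_nhds (half_pos hε))] with n hn
  rw [Real.dist_0_eq_abs, abs_norm]
  set y := (lowSpace e ξ N).starProjection (x n) with hy
  have hyV : y ∈ lowSpace e ξ N := Submodule.starProjection_apply_mem _ _
  have hEy : ‖E y‖ ≤ ε / (2 * (X + 1)) * ‖y‖ := by
    refine le_of_sq_le_sq ?_ (by positivity)
    refine (hEle y hyV).trans ?_
    rw [rightAct_one, one_apply_eq_self, mul_pow]
    gcongr
    rw [hη, mul_div_assoc', div_le_iff₀ (by linarith)]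
    nlinarith [sq_nonneg (ε / (2 * (X + 1)))]
  have h1 : ⟪y, y⟫_ℂ = ⟪y, x n⟫_ℂ := by
    have h2 := Submodule.starProjection_eq_self_iff.2 hyV
    nth_rw 2 [hy]
    rw [← Submodule.inner_starProjection_left_eq_right, h2]
  -- `x n` may be replaced by `E (x n)`, and `E` moved to the small side
  have h3 : ⟪y, x n⟫_ℂ = ⟪E y, x n⟫_ℂ - ⟪y, E (x n) - x n⟫_ℂ := by
    rw [inner_sub_right, hE]
    ring
  have h4 : ‖y‖ ^ 2 ≤ ε / (2 * (X + 1)) * ‖y‖ * X + ‖y‖ * ‖E (x n) - x n‖ := by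
    have h5 : ‖⟪y, y⟫_ℂ‖ = ‖y‖ ^ 2 := by
      rw [inner_self_eq_norm_sq_to_K, norm_pow, RCLike.norm_ofReal, abs_norm]
    rw [← h5, h1, h3]
    refine (norm_sub_le _ _).trans (add_le_add ((norm_inner_le_norm _ _).trans ?_)
      (norm_inner_le_norm _ _))
    exact mul_le_mul hEy (hX n) (norm_nonneg _) (by positivity)
  rw [one_apply_eq_self] at hn
  by_contra! hge
  have hy0 : 0 < ‖y‖ := hε.trans_le hge
  have h6 : ‖y‖ ≤ ε / (2 * (X + 1)) * X + ‖E (x n) - x n‖ := by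
    refine le_of_mul_le_mul_left ?_ hy0
    nlinarith [h4]
  have h7 : ε / (2 * (X + 1)) * X ≤ ε / 2 := by
    rw [div_mul_eq_mul_div, div_le_div_iff₀ (by linarith) two_pos]
    nlinarith
  linarith

/-- Truncations annihilate, asymptotically, the bounded sequences of vectors that asymptotically
commute with a diffuse subalgebra of `A`. -/
theorem tendsto_truncation (h : PaddedBasis e d ξ α β) (he : ‖e‖ = 1)
    {L : Fock q H →L[ℂ] Fock q H} (hL : IsTruncation e ξ N L)
    {C : VonNeumannAlgebra (Fock q H)} (hC : C ≤ generatorSubalgebra q e) (hdiff : IsDiffuse C)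
    {l : Filter ℕ} {x : ℕ → Fock q H} {X : ℝ} (hX : ∀ n, ‖x n‖ ≤ X)
    (hx : ∀ c ∈ C, Tendsto (fun n => rightAct c (x n) - c (x n)) l (𝓝 0)) :
    Tendsto (fun n => ‖L (x n)‖) l (𝓝 0) := by
  have hX0 : 0 ≤ X := (norm_nonneg _).trans (hX 0)
  rw [Metric.tendsto_nhds]
  intro ε hε
  have hδ : 0 < ε ^ 2 / (2 * (X ^ 2 + 1)) := by positivity
  obtain ⟨N', K, hK, hle⟩ := h.exists_norm_truncation_le he hL hδ
  have hlim := (h.tendsto_starProjection_lowSpace he N' hC hdiff hX hx).const_mul (K * X)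
  rw [mul_zero] at hlim
  filter_upwards [hlim.eventually (gt_mem_nhds (show 0 < ε ^ 2 / 2 by positivity))] with n hn
  rw [Real.dist_0_eq_abs, abs_norm]
  refine lt_of_pow_lt_pow_left₀ 2 hε.le ((hle (x n)).trans_lt ?_)
  have h1 : K * ‖x n‖ * ‖(lowSpace e ξ N').starProjection (x n)‖ ≤
      K * X * ‖(lowSpace e ξ N').starProjection (x n)‖ := by
    gcongr
    exact hX n
  have h2 : ε ^ 2 / (2 * (X ^ 2 + 1)) * ‖x n‖ ^ 2 ≤ ε ^ 2 / 2 := by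
    have h3 : ‖x n‖ ^ 2 ≤ X ^ 2 := by
      gcongr
      exact hX n
    rw [div_mul_eq_mul_div, div_le_div_iff₀ (by positivity) two_pos]
    nlinarith [sq_nonneg ε]
  linarith

end PaddedBasis

end

/-! ### Reversing a padded basis -/

section

variable {H : Type*} [NormedAddCommGroup H] [InnerProductSpace ℝ H]
variable {q : Set.Ioo (-1 : ℝ) 1} {e : H} {I : Type*}

theorem flip_eq_of_mem_fockLine {x : Fock q H} (hx : x ∈ fockLine q e) : flip q H x = x := by
  rw [fockLine_eq] at hx
  have h : (Submodule.span ℂ (Set.range fun n =>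
      scaledPad q e n 0 (vacuum q H))).topologicalClosure ≤
      (flip q H - ContinuousLinearMap.id ℂ (Fock q H)).ker := by
    refine Submodule.topologicalClosure_minimal _ (Submodule.span_le.2 ?_)
      (flip q H - ContinuousLinearMap.id ℂ (Fock q H)).isClosed_ker
    rintro _ ⟨n, rfl⟩
    have h1 : scaledPad q e n 0 (vacuum q H) = (leftCre q e ^ n) (vacuum q H) := by
      simp [scaledPad]
    change flip q H (scaledPad q e n 0 (vacuum q H)) - scaledPad q e n 0 (vacuum q H) = 0
    rw [h1, flip_leftCre_pow_vacuum, sub_self]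
  exact sub_eq_zero.1 (h hx)

theorem flip_mem_fockLine_orthogonal {x : Fock q H} (hx : x ∈ (fockLine q e)ᗮ) :
    flip q H x ∈ (fockLine q e)ᗮ := by
  rw [Submodule.mem_orthogonal] at hx ⊢
  intro u hu
  rw [← inner_flip, flip_eq_of_mem_fockLine hu, hx u hu]

theorem flip_padFamily (ξ : I → Fock q H) (p : I × ℕ × ℕ) :
    flip q H (padFamily e ξ p) = padFamily e (fun i => flip q H (ξ i)) (p.1, p.2.2, p.2.1) :=
  flip_dividedPad _ _ _

/-- Reversing all words exchanges the two kinds of padding. -/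
theorem PaddedBasis.flip {d : I → ℕ} {ξ : I → Fock q H} {α β : ℝ} (h : PaddedBasis e d ξ α β) :
    PaddedBasis e d (fun i => QGaussian.flip q H (ξ i)) α β := by
  let σ : I × ℕ × ℕ ≃ I × ℕ × ℕ := (Equiv.refl I).prodCongr (Equiv.prodComm ℕ ℕ)
  have hcomb : ∀ c : I × ℕ × ℕ →₀ ℂ,
      ‖Finsupp.linearCombination ℂ (padFamily e fun i => QGaussian.flip q H (ξ i)) c‖ =
        ‖Finsupp.linearCombination ℂ (padFamily e ξ) (Finsupp.equivMapDomain σ c)‖ := by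
    intro c
    rw [← norm_flip q (Finsupp.linearCombination ℂ (padFamily e ξ) (Finsupp.equivMapDomain σ c))]
    congr 1
    induction c using Finsupp.induction_linear with
    | zero => simp
    | add c c' hc hc' =>
      have h1 : Finsupp.equivMapDomain σ (c + c') =
          Finsupp.equivMapDomain σ c + Finsupp.equivMapDomain σ c' := by
        ext p
        simp [Finsupp.equivMapDomain_apply]
      rw [map_add, hc, hc', h1, map_add, map_add]
    | single p a =>
      rw [Finsupp.equivMapDomain_single, Finsupp.linearCombination_single,
        Finsupp.linearCombination_single, map_smul, flip_padFamily]
      rfl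
  have hsum : ∀ c : I × ℕ × ℕ →₀ ℂ,
      ∑' p, ‖Finsupp.equivMapDomain σ c p‖ ^ 2 = ∑' p, ‖c p‖ ^ 2 := fun c =>
    σ.symm.tsum_eq fun p => ‖c p‖ ^ 2
  refine ⟨fun i => flip_mem_kernelSpace (h.mem i), le_antisymm ?_ ?_, h.pos_left, h.pos_right,
    fun c => ?_, fun c => ?_⟩
  · refine Submodule.topologicalClosure_minimal _ (Submodule.span_le.2 ?_)
      (Submodule.isClosed_orthogonal _)
    rintro _ ⟨p, rfl⟩
    have h1 := flip_padFamily (e := e) ξ (p.1, p.2.2, p.2.1)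
    rw [SetLike.mem_coe, ← h1]
    exact flip_mem_fockLine_orthogonal (h.padFamily_mem _)
  · intro y hy
    have h1 := flip_mem_fockLine_orthogonal hy
    rw [← h.closure_span] at h1
    have hmaps : Set.MapsTo (QGaussian.flip q H)
        (Submodule.span ℂ (Set.range (padFamily e ξ)) : Set (Fock q H))
        (Submodule.span ℂ (Set.range (padFamily e fun i => QGaussian.flip q H (ξ i)))) := by
      intro x hx
      refine (Submodule.span_le (p := (Submodule.span ℂ (Set.range
        (padFamily e fun i => QGaussian.flip q H (ξ i)))).comap
          (QGaussian.flip q H : Fock q H →ₗ[ℂ] Fock q H))).2 ?_ hx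
      rintro _ ⟨p, rfl⟩
      exact Submodule.subset_span ⟨_, (flip_padFamily ξ p).symm⟩
    have h2 := hmaps.closure (QGaussian.flip q H).continuous h1
    rw [flip_flip] at h2
    exact h2
  · rw [hcomb, ← hsum]
    exact h.le_norm _
  · rw [hcomb, ← hsum]
    exact h.norm_le _

/-! ### The Riesz basis of an admissible `q` -/

section Basis

variable {κ : ℕ → Type*} {b : ∀ k, HilbertBasis (κ k) ℂ (kernelSpace q e (k + 1))}

/-- The chosen orthonormal bases, as a single family of vectors. -/
def basisFamily (b : ∀ k, HilbertBasis (κ k) ℂ (kernelSpace q e (k + 1))) (i : Σ k, κ k) :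
    Fock q H :=
  (b i.1 i.2 : kernelSpace q e (i.1 + 1))

theorem padFamily_basisFamily (p : (Σ k, κ k) × ℕ × ℕ) :
    padFamily e (basisFamily b) p =
      ((eulerProd q p.2.1 * eulerProd q p.2.2 : ℝ) : ℂ)⁻¹ • scaledBasisVector b p := rfl

theorem exists_basisVector_eq (p : (Σ k, κ k) × ℕ × ℕ) : ∃ a : ℂ, a ≠ 0 ∧
    basisVector q b p = a • padFamily e (basisFamily b) p := by
  have h1 : ((eulerProd q p.2.1 * eulerProd q p.2.2 : ℝ) : ℂ) ≠ 0 := by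
    exact_mod_cast (mul_pos (eulerProd_q_pos q _) (eulerProd_q_pos q _)).ne'
  have h2 : ((scale q ^ (p.2.1 + p.2.2) : ℝ) : ℂ) ≠ 0 := by
    exact_mod_cast (pow_pos (scale_pos q) _).ne'
  refine ⟨((scale q ^ (p.2.1 + p.2.2) : ℝ) : ℂ)⁻¹ *
    ((eulerProd q p.2.1 * eulerProd q p.2.2 : ℝ) : ℂ), mul_ne_zero (inv_ne_zero h2) h1, ?_⟩
  rw [padFamily_basisFamily, smul_smul, mul_assoc, mul_inv_cancel₀ h1, mul_one,
    scaledBasisVector_eq, smul_smul, inv_mul_cancel₀ h2, one_smul]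

theorem map_basisVector_iff (T : Fock q H →L[ℂ] Fock q H) (P : Prop) [Decidable P]
    (p : (Σ k, κ k) × ℕ × ℕ) :
    (T (basisVector q b p) = if P then basisVector q b p else 0) ↔
      T (padFamily e (basisFamily b) p) = if P then padFamily e (basisFamily b) p else 0 := by
  obtain ⟨a, ha, h⟩ := exists_basisVector_eq (b := b) p
  rw [h, map_smul]
  split_ifs
  · exact (smul_right_injective _ ha).eq_iff
  · rw [smul_eq_zero_iff_right ha]

theorem isLeftTruncation_iff {N : ℕ} {L : Fock q H →L[ℂ] Fock q H} :
    IsLeftTruncation q b N L ↔ PaddedBasis.IsTruncation e (basisFamily b) N L := by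
  constructor
  · intro h
    exact ⟨h.on_line, fun p => (map_basisVector_iff L _ p).1 (h.on_basis p.1 p.2.1 p.2.2)⟩
  · intro h
    exact ⟨h.on_line, fun i r s => (map_basisVector_iff L _ (i, r, s)).2 (h.on_family (i, r, s))⟩

/-- Reversing words exchanges truncations on the right and on the left. -/
theorem isRightTruncation_iff {N : ℕ} {R : Fock q H →L[ℂ] Fock q H} :
    IsRightTruncation q b N R ↔
      PaddedBasis.IsTruncation e (fun i => flip q H (basisFamily b i)) N (rightAct R) := by
  constructor
  · intro h
    refine ⟨fun x hx => ?_, fun p => ?_⟩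
    · rw [rightAct_apply, flip_eq_of_mem_fockLine hx, h.on_line x hx, map_zero]
    · have h1 := flip_padFamily (e := e) (basisFamily b) (p.1, p.2.2, p.2.1)
      rw [rightAct_apply, ← h1, flip_flip,
        (map_basisVector_iff R _ (p.1, p.2.2, p.2.1)).1 (h.on_basis p.1 p.2.2 p.2.1)]
      split_ifs
      · rfl
      · rw [map_zero]
  · intro h
    refine ⟨fun x hx => ?_, fun i r s => (map_basisVector_iff R _ (i, r, s)).2 ?_⟩
    · have h1 := congrArg (flip q H) (h.on_line x hx)
      rwa [rightAct_apply, flip_flip, flip_eq_of_mem_fockLine hx, map_zero] at h1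
    · have h1 := congrArg (flip q H) (h.on_family (i, s, r))
      have h2 := flip_padFamily (e := e) (basisFamily b) (i, r, s)
      rw [rightAct_apply, flip_flip, ← h2, flip_flip] at h1
      rw [h1]
      split_ifs
      · rw [flip_flip]
      · rw [map_zero]

/-- The normalized vectors `ξ^i_{r,s}` and the family `padFamily` differ by scalars that are bounded
above and below. -/
theorem exists_paddedBasis (h : IsSmall q b) :
    ∃ α β : ℝ, PaddedBasis e (fun i : Σ k, κ k => i.1) (basisFamily b) α β := by
  obtain ⟨E, hE, hdiv⟩ := eulerProd_div_le q
  have hup : ∀ n, eulerProd q n ≤ E := fun n => by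
    have h1 := hdiv n 0
    rwa [eulerProd_zero, div_one] at h1
  have hlow : ∀ n, E⁻¹ ≤ eulerProd q n := fun n => by
    have h1 := hdiv 0 n
    rw [eulerProd_zero, div_le_iff₀ (eulerProd_q_pos q n)] at h1
    rwa [inv_le_iff_one_le_mul₀ hE, mul_comm]
  obtain ⟨α, hα, β, hβ, hbounds⟩ := h.riesz.bounds
  -- the normalized vectors differ from the members of the family by the scalars `τ`
  set τ : (Σ k, κ k) × ℕ × ℕ → ℝ := fun p =>
    (eulerProd q p.2.1 * eulerProd q p.2.2)⁻¹ * ‖scaledBasisVector b p‖ with hτ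
  have hnorm : ∀ p, 1 / 2 * E⁻¹ ≤ ‖scaledBasisVector b p‖ ^ 2 ∧
      ‖scaledBasisVector b p‖ ^ 2 ≤ 2 * E := by
    intro p
    have h1 := (pad_bounds_iff p.2.1 p.2.2 _ (1 / 2) 2).1
      (h.norm_bounds _ _ (b p.1.1 p.1.2).2 (norm_basis b p.1) p.2.1 p.2.2)
    have h2 := hlow (p.2.1 + p.2.2)
    have h3 := hup (p.2.1 + p.2.2)
    exact ⟨le_trans (by linarith) h1.1, h1.2.trans (by linarith)⟩
  have hpos : ∀ p, 0 < ‖scaledBasisVector b p‖ := by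
    intro p
    have h1 := (hnorm p).1
    have h2 : 0 < 1 / 2 * E⁻¹ := by positivity
    exact lt_of_le_of_ne' (norm_nonneg _) (sq_pos_iff.1 (h2.trans_le h1))
  have hfam : ∀ p, padFamily e (basisFamily b) p =
      ((τ p : ℝ) : ℂ) • (((‖basisVector q b p‖⁻¹ : ℝ) : ℂ) • basisVector q b p) := by
    intro p
    have h1 : ((‖scaledBasisVector b p‖ : ℝ) : ℂ) ≠ 0 := by exact_mod_cast (hpos p).ne'
    rw [normalized_basisVector, smul_smul, padFamily_basisFamily]
    congr 1
    change _ = (((eulerProd q p.2.1 * eulerProd q p.2.2)⁻¹ * ‖scaledBasisVector b p‖ : ℝ) : ℂ) * _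
    push_cast
    rw [mul_assoc, mul_inv_cancel₀ h1, mul_one]
  have hτlow : ∀ p, (E * E)⁻¹ ^ 2 * (1 / 2 * E⁻¹) ≤ τ p ^ 2 := by
    intro p
    rw [hτ, mul_pow]
    have h1 := eulerProd_q_pos q p.2.1
    have h2 := eulerProd_q_pos q p.2.2
    gcongr
    · exact hup _
    · exact hup _
    · exact (hnorm p).1
  have hτup : ∀ p, τ p ^ 2 ≤ (E⁻¹ * E⁻¹)⁻¹ ^ 2 * (2 * E) := by
    intro p
    rw [hτ, mul_pow]
    have h1 := eulerProd_q_pos q p.2.1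
    have h2 := eulerProd_q_pos q p.2.2
    gcongr
    · exact hlow _
    · exact hlow _
    · exact (hnorm p).2
  have hτ0 : ∀ p, ((τ p : ℝ) : ℂ) ≠ 0 := by
    intro p
    have h1 := mul_pos (inv_pos.2 (mul_pos (eulerProd_q_pos q p.2.1) (eulerProd_q_pos q p.2.2)))
      (hpos p)
    exact_mod_cast h1.ne'
  have hcomb : ∀ c : (Σ k, κ k) × ℕ × ℕ →₀ ℂ,
      Finsupp.linearCombination ℂ (padFamily e (basisFamily b)) c =
        ∑ p ∈ c.support, (c p * ((τ p : ℝ) : ℂ)) •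
          (((‖basisVector q b p‖⁻¹ : ℝ) : ℂ) • basisVector q b p) := by
    intro c
    rw [Finsupp.linearCombination_apply, Finsupp.sum]
    exact Finset.sum_congr rfl fun p _ => by rw [hfam, smul_smul]
  have htsum : ∀ c : (Σ k, κ k) × ℕ × ℕ →₀ ℂ,
      ∑' p, ‖c p‖ ^ 2 = ∑ p ∈ c.support, ‖c p‖ ^ 2 := by
    intro c
    refine tsum_eq_sum fun p hp => ?_
    rw [Finsupp.notMem_support_iff.1 hp, norm_zero, zero_pow two_ne_zero]
  have hterm : ∀ (c : (Σ k, κ k) × ℕ × ℕ →₀ ℂ) p,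
      ‖c p * ((τ p : ℝ) : ℂ)‖ ^ 2 = τ p ^ 2 * ‖c p‖ ^ 2 := by
    intro c p
    rw [norm_mul, Complex.norm_real, mul_pow, Real.norm_eq_abs, sq_abs, mul_comm]
  refine ⟨α * ((E * E)⁻¹ ^ 2 * (1 / 2 * E⁻¹)), β * ((E⁻¹ * E⁻¹)⁻¹ ^ 2 * (2 * E)),
    fun i => (b i.1 i.2).2, ?_, by positivity, by positivity, fun c => ?_, fun c => ?_⟩
  · have h1 : padFamily e (basisFamily b) = fun p =>
        ((τ p : ℝ) : ℂ) • (((‖basisVector q b p‖⁻¹ : ℝ) : ℂ) • basisVector q b p) := funext hfam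
    rw [h1, span_smul_eq hτ0, h.riesz.closure_span]
  · rw [hcomb, htsum, mul_assoc]
    refine le_trans ?_ (hbounds c.support fun p => c p * ((τ p : ℝ) : ℂ)).1
    refine mul_le_mul_of_nonneg_left ?_ hα.le
    rw [Finset.mul_sum]
    refine Finset.sum_le_sum fun p _ => ?_
    rw [hterm]
    exact mul_le_mul_of_nonneg_right (hτlow p) (by positivity)
  · rw [hcomb, htsum, mul_assoc]
    refine (hbounds c.support fun p => c p * ((τ p : ℝ) : ℂ)).2.trans ?_
    refine mul_le_mul_of_nonneg_left ?_ hβ.le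
    rw [Finset.mul_sum]
    refine Finset.sum_le_sum fun p _ => ?_
    rw [hterm]
    exact mul_le_mul_of_nonneg_right (hτup p) (by positivity)

theorem PaddedBasis.existsUnique_truncation {d : I → ℕ} {ξ : I → Fock q H} {α β : ℝ}
    (h : PaddedBasis e d ξ α β) (N : ℕ) : ∃! L, PaddedBasis.IsTruncation e ξ N L := by
  obtain ⟨L, h1, h2⟩ := h.exists_truncation fun p => p.2.1 ≤ N
  refine ⟨L, ⟨h1, h2⟩, fun L' hL' => h.ext_clm (fun x hx => ?_) fun p => ?_⟩
  · rw [h1 x hx, hL'.on_line x hx]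
  · rw [h2, hL'.on_family]

theorem existsUnique_isLeftTruncation (h : IsSmall q b) (N : ℕ) :
    ∃! L, IsLeftTruncation q b N L := by
  obtain ⟨α, β, hb⟩ := exists_paddedBasis h
  simpa only [isLeftTruncation_iff] using hb.existsUnique_truncation N

theorem existsUnique_isRightTruncation (h : IsSmall q b) (N : ℕ) :
    ∃! R, IsRightTruncation q b N R := by
  obtain ⟨α, β, hb⟩ := exists_paddedBasis h
  obtain ⟨L, hL, huniq⟩ := hb.flip.existsUnique_truncation N
  simp only [isRightTruncation_iff]
  refine ⟨rightAct L, ?_, fun R hR => ?_⟩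
  · change PaddedBasis.IsTruncation e _ N (rightAct (rightAct L))
    rwa [rightAct_rightAct]
  · rw [← huniq _ hR, rightAct_rightAct]

theorem tendsto_truncations (he : ‖e‖ = 1) (h : IsSmall q b) {N : ℕ}
    {L R : Fock q H →L[ℂ] Fock q H} (hL : IsLeftTruncation q b N L)
    (hR : IsRightTruncation q b N R) {ω : Ultrafilter ℕ} {C : VonNeumannAlgebra (Fock q H)}
    (hC : C ≤ generatorSubalgebra q e) (hdiff : IsDiffuse C) {z : ℕ → Fock q H →L[ℂ] Fock q H}
    (hz : IsBoundedSeq q (gaussianAlgebra q H) z) (hcomm : CommutesWith q ω C z) :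
    Tendsto (fun n => ‖L (toL2 q (z n))‖) ω (𝓝 0) ∧
      Tendsto (fun n => ‖R (toL2 q (z n))‖) ω (𝓝 0) := by
  obtain ⟨α, β, hb⟩ := exists_paddedBasis h
  obtain ⟨X, hX⟩ := hz.bounded
  have hX' : ∀ n, ‖toL2 q (z n)‖ ≤ X := fun n => by
    have h1 := (z n).le_opNorm (vacuum q H)
    rw [norm_vacuum, mul_one] at h1
    exact h1.trans (hX n)
  have hlim : ∀ c ∈ C, Tendsto (fun n => rightAct c (toL2 q (z n)) - c (toL2 q (z n))) ω (𝓝 0) := by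
    intro c hc
    rw [tendsto_zero_iff_norm_tendsto_zero]
    refine (hcomm c hc).congr fun n => ?_
    rw [toL2, toL2, gaussianAlgebra_commute_rightAct (hz.mem n) (hC hc),
      rightAct_vacuum he (hC hc)]
    rfl
  refine ⟨hb.tendsto_truncation he (isLeftTruncation_iff.1 hL) hC hdiff hX' hlim, ?_⟩
  have hX'' : ∀ n, ‖flip q H (toL2 q (z n))‖ ≤ X := fun n => by
    rw [norm_flip]
    exact hX' n
  have hlim' : ∀ c ∈ C, Tendsto (fun n => rightAct c (flip q H (toL2 q (z n))) -
      c (flip q H (toL2 q (z n)))) ω (𝓝 0) := by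
    intro c hc
    have h1 := hlim c hc
    rw [tendsto_zero_iff_norm_tendsto_zero] at h1 ⊢
    refine h1.congr fun n => ?_
    rw [rightAct_apply c (flip q H _), flip_flip, ← norm_flip, map_sub, rightAct_apply, flip_flip,
      norm_sub_rev]
  refine (hb.flip.tendsto_truncation he (isRightTruncation_iff.1 hR) hC hdiff hX'' hlim').congr
    fun n => ?_
  rw [rightAct_apply, flip_flip, norm_flip]

end Basis

end

end QGaussian

end

theorem theorem4p4 :
    (∃ q₀ > (0 : ℝ), ∀ q : Set.Ioo (-1 : ℝ) 1, |(q : ℝ)| < q₀ →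
      ∀ (H : Type u) [NormedAddCommGroup H] [InnerProductSpace ℝ H] [CompleteSpace H],
        2 ≤ Module.rank ℝ H → ∀ e : H, ‖e‖ = 1 →
      ∀ (κ : ℕ → Type u) (b : ∀ k, HilbertBasis (κ k) ℂ (kernelSpace q e (k + 1))),
        IsSmall q b) ∧
    (∀ (q : Set.Ioo (-1 : ℝ) 1)
      (H : Type u) [NormedAddCommGroup H] [InnerProductSpace ℝ H] [CompleteSpace H],
        2 ≤ Module.rank ℝ H → ∀ e : H, ‖e‖ = 1 →
      ∀ (κ : ℕ → Type u) (b : ∀ k, HilbertBasis (κ k) ℂ (kernelSpace q e (k + 1))),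
        IsSmall q b →
      ∀ N : ℕ,
        (∃! L, IsLeftTruncation q b N L) ∧ (∃! R, IsRightTruncation q b N R) ∧
        ∀ L R, IsLeftTruncation q b N L → IsRightTruncation q b N R →
        ∀ ω : Ultrafilter ℕ, (ω : Filter ℕ) ≤ Filter.cofinite →
        ∀ C : VonNeumannAlgebra (Fock q H), C ≤ generatorSubalgebra q e → IsDiffuse C →
        ∀ z, IsBoundedSeq q (gaussianAlgebra q H) z →
          IsOrthogonal q ω (generatorSubalgebra q e) z → CommutesWith q ω C z →
          Tendsto (fun n => ‖L (toL2 q (z n))‖) ω (𝓝 0) ∧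
          Tendsto (fun n => ‖R (toL2 q (z n))‖) ω (𝓝 0)) := by
  refine ⟨⟨1 / 100, by norm_num, fun q hq H _ _ _ _ e he κ b => isSmall_of_small b hq.le he⟩,
    fun q H _ _ _ _ e he κ b h N => ⟨existsUnique_isLeftTruncation h N,
      existsUnique_isRightTruncation h N, ?_⟩⟩
  intro L R hL hR ω _ C hC hdiff z hz _ hcomm
  exact tendsto_truncations he h hL hR hC hdiff hz hcomm
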